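/- Let $(M,g)$ be a compact smooth Riemannian manifold with smooth boundary, of any dimension $d\ge 1$. Let $SM=\{(x,v)\in TM: g(v,v)=1\}$ be its unit tangent bundle, $\nu$ the outer unit normal of $\partial M$, $\partial SM=\{(x,v)\in SM: x\in\partial M\}$ and $\partial_+SM=\{(x,v)\in \partial SM: g(v,\nu)\le 0\}$. Let $X$ be the geodesic vector field on $SM$, let $\varphi_t(x,v)=(\gamma_{x,v}(t),\dot\gamma_{x,v}(t))$, where $\gamma_{x,v}$ is the geodesic of $M$ starting at $x$ with velocity $v$, and let $\tau(x,v)$ be the time at which $\gamma_{x,v}$ exits $M$. Assume that $\partial M$ is strictly convex (its second fundamental form is positive definite) and that $(M,g)$ is non-trapping ($\tau(x,v)<\infty$ for all $(x,v)\in SM$). For $\mathbb A\in C^\infty(SM,\mathbb C^{n\times n})$ the scattering data $C_{\mathbb A}:\partial_+SM\to GL(n,\mathbb C)$ is defined by $C_{\mathbb A}(x,v)=U(0)$, where $U:[0,\tau(x,v)]\to\mathbb C^{n\times n}$ solves $$\dot U(t)+\mathbb A(\varphi_t(x,v))\,U(t)=0,\qquad U(\tau(x,v))=\mathrm{Id}.$$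 Let $\mathbb A,\mathbb B\in C^\infty(SM,\mathbb C^{n\times n})$. Then $C_{\mathbb A}=C_{\mathbb B}$ on $\partial_+SM$ if and only if there is a smooth $U:SM\to GL(n,\mathbb C)$ with $U|_{\partial SM}=\mathrm{Id}$ and $$\mathbb B=U^{-1}XU+U^{-1}\mathbb A U\quad\text{on } SM.$$ -/

import Mathlib

open Set Bundle Manifold
open scoped ContDiff Matrix.Norms.Operator

noncomputable section

namespace GeodesicTransport

/-! Throughout, `M` is a smooth manifold (with boundary) modelled on `I`, with model space `E`; the
case of interest is the model with corners `𝓡∂ d` of `d`-dimensional manifolds with boundary. -/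

section

variable {E : Type*} [NormedAddCommGroup E] [NormedSpace ℝ E] {H : Type*} [TopologicalSpace H]
  {I : ModelWithCorners ℝ E H} {M : Type*} [TopologicalSpace M] [ChartedSpace H M]

variable (I M) in
/-- A smooth Riemannian metric on the manifold `M`. -/
abbrev RMetric [IsManifold I ∞ M] :=
  ContMDiffRiemannianMetric I ∞ E (fun x : M => TangentSpace I x)

variable [IsManifold I ∞ M]

/-- The unit tangent bundle `SM`, as a subset of the tangent bundle `TM`. -/
def unitTangent (g : RMetric I M) : Set (TangentBundle I M) :=
  {p | g.inner p.1 p.2 p.2 = 1}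

/-- Smoothness (up to the boundary) of a function on `SM`; its values off `SM` play no role. -/
def SmoothOnSM {F : Type*} [NormedAddCommGroup F] [NormedSpace ℝ F] (g : RMetric I M)
    (f : TangentBundle I M → F) : Prop :=
  ContMDiffOn I.tangent 𝓘(ℝ, F) ∞ f (unitTangent g)

/-! ### Levi-Civita connection and geodesic vector field

Mathlib identifies the tangent space at `x` with `E` through the preferred chart at `x`, and the
tangent space of `TM` at `p = (x, v)` with `E × E` through the chart of `TM` which that chart
induces. So the classical coordinate formulas, evaluated at the point `x` in the preferred chart
at `x`, define intrinsic objects. -/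

/-- The metric in the preferred chart at `x₀`: at the point of `M` with coordinates `y`, this is
the bilinear form with coefficients `g_{ij}(y)`. -/
def metricInChart (g : RMetric I M) (x₀ : M) (y : E) : E →L[ℝ] E →L[ℝ] ℝ :=
  let x : M := (extChartAt I x₀).symm y
  let L : E →L[ℝ] TangentSpace I x :=
    (trivializationAt E (TangentSpace I) x₀).symmL ℝ x
  (ContinuousLinearMap.precomp ℝ L).comp ((g.inner x).comp L)

/-- The first derivatives `z, u, w ↦ z^k u^i w^j ∂_k g_{ij}` of the metric coefficients at `x`, in
the preferred chart at `x`. The derivative is taken within the range of the chart, so that it is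
one-sided at a boundary point. -/
def dMetric (g : RMetric I M) (x : M) : E →L[ℝ] E →L[ℝ] E →L[ℝ] ℝ :=
  (fderivWithin ℝ (metricInChart g x) (range I) (extChartAt I x x) :)

/-- The Christoffel symbols of the first kind,
`w ↦ ½ u^i v^j w^k (∂_i g_{jk} + ∂_j g_{ik} - ∂_k g_{ij})`, at `x` in the preferred chart. -/
def christoffelFirst (g : RMetric I M) (x : M) (u v : E) : E →L[ℝ] ℝ :=
  (1 / 2 : ℝ) • (dMetric g x u v + dMetric g x v u - ((dMetric g x).flip u).flip v)

/-- The vector of `T_x M` which represents a covector at `x` through the metric `g`. -/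
def sharp (g : RMetric I M) (x : M) (ξ : E →L[ℝ] ℝ) : TangentSpace I x :=
  let G : E →L[ℝ] E →L[ℝ] ℝ := g.inner x
  let v : E := G.inverse ξ
  v

/-- The Christoffel symbols `Γ(u, v) = Γ^k_{ij} u^i v^j ∂_k` of the Levi-Civita connection at `x`,
in the preferred chart at `x`. -/
def christoffel (g : RMetric I M) (x : M) (u v : TangentSpace I x) :
    TangentSpace I x :=
  sharp g x (christoffelFirst g x (u : E) (v : E))

/-- The geodesic vector field `X(x, v) = v^i ∂_{x^i} - Γ^k_{ij} v^i v^j ∂_{v^k}` on `TM`. It is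
tangent to `SM`. -/
def geodesicField (g : RMetric I M) (p : TangentBundle I M) :
    TangentSpace I.tangent p :=
  ((p.2, -christoffel g p.1 p.2 p.2) : E × E)

/-- The derivative `XU` along the geodesic vector field of a function `U` on `SM`, at a point
of `SM`. As `X` is tangent to `SM`, it may be computed from any extension of `U` off `SM`, and the
extension used here is `(x, v) ↦ U(x, v/|v|)`; the values of `U` off `SM` play no role. -/
def geodesicDeriv {F : Type*} [NormedAddCommGroup F] [NormedSpace ℝ F] (g : RMetric I M)
    (U : TangentBundle I M → F) (p : TangentBundle I M) : F :=
  mfderiv I.tangent 𝓘(ℝ, F)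
    (fun q : TangentBundle I M => U ⟨q.1, (√(g.inner q.1 q.2 q.2))⁻¹ • q.2⟩) p
    (geodesicField g p)

/-! ### Geodesics, exit time, scattering data -/

/-- `β` is the orbit `t ↦ φ_t(p) = (γ(t), γ'(t))` of the geodesic flow on the time interval
`[0, T]`, where `γ` is the geodesic of `M` that starts at `p = (x, v)`. -/
def IsGeodesicOrbit (g : RMetric I M) (p : TangentBundle I M) (T : ℝ)
    (β : ℝ → TangentBundle I M) : Prop :=
  β 0 = p ∧ IsMIntegralCurveOn (I := I.tangent) β (geodesicField g) (Icc 0 T)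

/-- The times `T ≥ 0` such that the geodesic that starts at `p` stays in `M` on `[0, T]`. -/
def lifetimes (g : RMetric I M) (p : TangentBundle I M) : Set ℝ :=
  {T | 0 ≤ T ∧ ∃ β, IsGeodesicOrbit g p T β}

/-- The exit time `τ(p)` of the geodesic that starts at `p`. -/
def exitTime (g : RMetric I M) (p : TangentBundle I M) : ℝ :=
  sSup (lifetimes g p)

/-- The metric is non-trapping: the exit time of every unit speed geodesic is finite. -/
def NonTrapping (g : RMetric I M) : Prop :=
  ∀ p ∈ unitTangent g, BddAbove (lifetimes g p)

/-- `S` is the value `U(0)` of the solution of the matrix differential equation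
`U'(t) + A(φ_t(p)) U(t) = 0` on `[0, τ(p)]` with `U(τ(p)) = Id`. -/
def IsScatteringValue {n : ℕ} (g : RMetric I M)
    (A : TangentBundle I M → Matrix (Fin n) (Fin n) ℂ) (p : TangentBundle I M)
    (S : Matrix (Fin n) (Fin n) ℂ) : Prop :=
  ∃ (β : ℝ → TangentBundle I M) (U : ℝ → Matrix (Fin n) (Fin n) ℂ),
    IsGeodesicOrbit g p (exitTime g p) β ∧
    (∀ t ∈ Icc 0 (exitTime g p),
      HasDerivWithinAt U (-(A (β t) * U t)) (Icc 0 (exitTime g p)) t) ∧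
    U (exitTime g p) = 1 ∧ U 0 = S

open Classical in
/-- The scattering data (non-Abelian X-ray transform) `C_A` of `A`, at a point of `∂₊SM`. -/
def scatteringData {n : ℕ} (g : RMetric I M)
    (A : TangentBundle I M → Matrix (Fin n) (Fin n) ℂ) (p : TangentBundle I M) :
    Matrix (Fin n) (Fin n) ℂ :=
  if h : ∃ S, IsScatteringValue g A p S then h.choose else 0

end

/-! ### Boundary -/

section

variable {d : ℕ} [NeZero d] {M : Type*} [TopologicalSpace M]
  [ChartedSpace (EuclideanHalfSpace d) M] [IsManifold (𝓡∂ d) ∞ M]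

/-- The differential at `x` of the first coordinate `x⁰` of the preferred chart at `x`. When `x` is
a boundary point, `M` is given near `x` by `x⁰ ≥ 0` and `∂M` by `x⁰ = 0`, so that the kernel is
the tangent space of `∂M`. -/
def boundaryConormal (x : M) : TangentSpace (𝓡∂ d) x →L[ℝ] ℝ :=
  (EuclideanSpace.proj (0 : Fin d) : EuclideanSpace ℝ (Fin d) →L[ℝ] ℝ)

/-- The outer unit normal `ν = -∇x⁰ / |∇x⁰|` at a boundary point `x`. -/
def outerNormal (g : RMetric (𝓡∂ d) M) (x : M) : TangentSpace (𝓡∂ d) x :=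
  -((√(g.inner x (sharp g x (boundaryConormal x)) (sharp g x (boundaryConormal x))))⁻¹ •
    sharp g x (boundaryConormal x))

/-- The boundary `∂SM`: the unit vectors at boundary points of `M`. -/
def boundarySM (g : RMetric (𝓡∂ d) M) : Set (TangentBundle (𝓡∂ d) M) :=
  {p | p ∈ unitTangent g ∧ p.1 ∈ (𝓡∂ d).boundary M}

/-- The influx boundary `∂₊SM`: the points `(x, v)` of `∂SM` with `g(v, ν) ≤ 0`. -/
def influx (g : RMetric (𝓡∂ d) M) : Set (TangentBundle (𝓡∂ d) M) :=
  {p | p ∈ boundarySM g ∧ g.inner p.1 p.2 (outerNormal g p.1) ≤ 0}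

/-- The second fundamental form `II(w, w) = g(∇_w ν, w) = -g(ν, ∇_w W)` of `∂M` at a boundary
point `x`, on the diagonal, where `w` is tangent to `∂M`. Here `W` is a field tangent to `∂M`
that extends `w`; for the field with constant coordinates in the preferred chart at `x`,
`∇_w W` is `Γ(w, w)`. The sign is such that `II` is positive for a round ball in `ℝᵈ`. -/
def secondFundamentalForm (g : RMetric (𝓡∂ d) M) (x : M) (w : TangentSpace (𝓡∂ d) x) : ℝ :=
  -g.inner x (outerNormal g x) (christoffel g x w w)

/-- Strict convexity of the boundary: its second fundamental form is positive definite. -/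
def StrictlyConvexBoundary (g : RMetric (𝓡∂ d) M) : Prop :=
  ∀ x ∈ (𝓡∂ d).boundary M, ∀ w : TangentSpace (𝓡∂ d) x,
    boundaryConormal x w = 0 → w ≠ 0 → 0 < secondFundamentalForm g x w

end

end GeodesicTransport

end

/-!
Let `φ_t` be the geodesic flow on `SM`, let `τ` be the exit time, and let `V_A` solve
`V' + A(φ_t) V = 0` along an orbit, with `V(τ) = 1`. As the matrix equation and the condition at the
exit time do not change when the origin of time is moved along the orbit, the scattering data
`C_A`, defined at every point of `SM`, satisfy `C_A(φ_t p) = V_A(t)` (`exists_scatteringData_eq`).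

If `B` is the gauge transform of `A` by `U`, then `U(φ_t) V_B` solves the equation of `V_A`, and
`U = 1` at both ends of the orbit, so that `C_A = C_B` (`scatteringData_eq_of_gauge`).

Conversely, suppose that `C_A = C_B` on the influx boundary, and put `U = C_A C_B⁻¹` on all of `SM`.
Along the flow `U` solves the linear equation `W' = -A W + W B`
(`isTransported_scatteringData_mul_inv`), which is the gauge equation. On `∂SM` it is `1`: a point
of `∂SM` outside the influx boundary has exit time zero (`mem_influx_of_exitTime_pos`). What remains
is the smoothness of `U`, although `τ` is not smooth where geodesics are tangent to the boundary.

* *Near a boundary point at which the geodesic crosses the boundary*, the hitting time is smooth by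
  the implicit function theorem, and `U` is obtained from `1` at the hitting time by solving the
  linear equation backwards (`hasRegularTransport_of_transversal`).
* *Near a boundary point at which the geodesic is tangent to the boundary*, strict convexity says
  that the height above the boundary has a nondegenerate maximum along the orbits of an extension of
  the flow across the boundary. With `T` the time and `b` the value of the maximum, the orbit meets
  the boundary at the two times `T + σ(±√b)`, with `σ` smooth (`exists_morse_coordinate`). Since
  `U = 1` at both of them, transport from either end gives the same value of `U`, so `U = Q(√b)` and
  `U = Q(-√b)` with the same smooth `Q`. Hence `U` is half the sum, an even function of `√b`, and
  Whitney's lemma (`contDiffOn_comp_sqrt`) makes it a smooth function of `b`, up to `b = 0`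
  (`hasRegularTransport_of_glancing`).
* *In the interior*, smoothness of transported functions propagates along orbits
  (`exists_flow_contDiffWithinAt_iff`), and all orbits reach the boundary because the metric is
  non-trapping.

Together these give `smoothOnSM_of_isTransported`. All local arguments are made for finite
differentiability `C^k`, in charts of `TM`, in which the geodesic vector field extends across the
boundary (`exists_contDiff_extension`); orbits which stay in `M` are orbits of the extended flow.
-/

namespace GeodesicTransport

open Filter Topology Metric MeasureTheory

set_option synthInstance.maxHeartbeats 200000
set_option maxHeartbeats 800000

universe u

/-! ### Superposition operators and integrals depending on a parameter -/

section Superposition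

variable {K : Type*} [TopologicalSpace K] [CompactSpace K]
  {F G : Type u} [NormedAddCommGroup F] [NormedSpace ℝ F] [NormedAddCommGroup G] [NormedSpace ℝ G]

variable (K F G) in
/-- Pointwise application of a continuous family of operators to a continuous curve, as a bounded
bilinear map. -/
noncomputable def applyCLM : C(K, F →L[ℝ] G) →L[ℝ] C(K, F) →L[ℝ] C(K, G) :=
  LinearMap.mkContinuous₂ (LinearMap.mk₂ ℝ
    (fun (A : C(K, F →L[ℝ] G)) (γ : C(K, F)) => (⟨fun s => A s (γ s), by fun_prop⟩ : C(K, G)))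
    (fun A B γ => by ext s; simp) (fun c A γ => by ext s; simp)
    (fun A γ η => by ext s; simp) (fun c A γ => by ext s; simp)) 1
    (fun A γ => by
      rw [one_mul, ContinuousMap.norm_le _ (by positivity)]
      intro s
      have h1 : ‖A s‖ ≤ ‖A‖ := A.norm_coe_le_norm s
      have h2 : ‖γ s‖ ≤ ‖γ‖ := γ.norm_coe_le_norm s
      calc ‖A s (γ s)‖ ≤ ‖A s‖ * ‖γ s‖ := (A s).le_opNorm (γ s)
        _ ≤ ‖A‖ * ‖γ‖ := by gcongr)

@[simp] lemma applyCLM_apply (A : C(K, F →L[ℝ] G)) (γ : C(K, F)) (s : K) :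
    applyCLM K F G A γ s = A s (γ s) := rfl

lemma hasFDerivAt_comp_continuousMap {Y : F → G} {Y' : F → F →L[ℝ] G} (hY : Continuous Y)
    (hY' : Continuous Y') (h : ∀ x, HasFDerivAt Y (Y' x) x) (γ₀ : C(K, F)) :
    HasFDerivAt (fun γ : C(K, F) => (ContinuousMap.mk Y hY).comp γ)
      (applyCLM K F G ((ContinuousMap.mk Y' hY').comp γ₀)) γ₀ := by
  rw [hasFDerivAt_iff_isLittleO, Asymptotics.isLittleO_iff]
  intro ε hε
  have hc : Continuous fun γ : C(K, F) => (ContinuousMap.mk Y' hY').comp γ :=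
    ContinuousMap.continuous_postcomp _
  obtain ⟨δ, hδ, H⟩ := Metric.eventually_nhds_iff.1
    (hc.continuousAt.eventually (Metric.ball_mem_nhds ((ContinuousMap.mk Y' hY').comp γ₀) hε))
  filter_upwards [Metric.ball_mem_nhds γ₀ hδ] with γ hγ
  rw [ContinuousMap.norm_le _ (by positivity)]
  intro s
  have key : ∀ y ∈ segment ℝ (γ₀ s) (γ s), ‖Y' y - Y' (γ₀ s)‖ ≤ ε := by
    intro y hy
    rw [segment_eq_image_lineMap] at hy
    obtain ⟨θ, hθ, rfl⟩ := hy
    have h1 : (AffineMap.lineMap γ₀ γ θ : C(K, F)) ∈ Metric.ball γ₀ δ := by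
      have : (AffineMap.lineMap γ₀ γ θ : C(K, F)) ∈ segment ℝ γ₀ γ := by
        rw [segment_eq_image_lineMap]; exact ⟨θ, hθ, rfl⟩
      exact (convex_ball γ₀ δ).segment_subset (mem_ball_self hδ) hγ this
    have h2 := (ContinuousMap.dist_apply_le_dist s).trans (H h1).le
    rw [dist_eq_norm] at h2
    simpa [AffineMap.lineMap_apply] using h2
  have := (convex_segment (γ₀ s) (γ s)).norm_image_sub_le_of_norm_hasFDerivWithin_le'
    (f := Y) (f' := Y') (φ := Y' (γ₀ s)) (C := ε) (fun x _ => (h x).hasFDerivWithinAt) key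
    (left_mem_segment ℝ _ _) (right_mem_segment ℝ _ _)
  refine le_trans (le_of_eq ?_) (this.trans ?_)
  · simp
  · exact mul_le_mul_of_nonneg_left ((γ - γ₀).norm_coe_le_norm s) hε.le

end Superposition

/-- The superposition operator `γ ↦ Y ∘ γ` on continuous curves over a compact space is of class
`C^n` when `Y` is. -/
theorem contDiff_comp_continuousMap {K : Type*} [TopologicalSpace K] [CompactSpace K] (n : ℕ) :
    ∀ {F G : Type u} [NormedAddCommGroup F] [NormedSpace ℝ F] [NormedAddCommGroup G]
    [NormedSpace ℝ G] {Y : F → G} (hY : ContDiff ℝ n Y),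
    ContDiff ℝ n (fun γ : C(K, F) => (ContinuousMap.mk Y hY.continuous).comp γ) := by
  induction n with
  | zero =>
    intro F G _ _ _ _ Y hY
    exact contDiff_zero.2 (ContinuousMap.continuous_postcomp _)
  | succ n ih =>
    intro F G _ _ _ _ Y hY
    have hY1 : ContDiff ℝ ((n : ℕ∞ω) + 1) Y := by exact_mod_cast hY
    obtain ⟨Y', hY', h⟩ := contDiff_succ_iff_hasFDerivAt.1 hY1
    have hlin : ContDiff ℝ n (applyCLM K F G) :=
      ContinuousLinearMap.contDiff (𝕜 := ℝ) (E := C(K, F →L[ℝ] G))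
      (F := C(K, F) →L[ℝ] C(K, G)) (applyCLM K F G)
    have key : ContDiff ℝ ((n : ℕ∞ω) + 1)
        (fun γ : C(K, F) => (ContinuousMap.mk Y hY.continuous).comp γ) :=
      contDiff_succ_iff_hasFDerivAt.2
        ⟨fun γ => applyCLM K F G ((ContinuousMap.mk Y' hY'.continuous).comp γ),
          hlin.comp (ih hY'),
          hasFDerivAt_comp_continuousMap hY.continuous hY'.continuous h⟩
    exact_mod_cast key

/-- The map `γ ↦ (s ↦ ∫₀ˢ γ)` on continuous curves over `[0, 1]`. -/
noncomputable def primitiveCLM (F : Type*) [NormedAddCommGroup F] [NormedSpace ℝ F] :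
    C(Icc (0 : ℝ) 1, F) →L[ℝ] C(Icc (0 : ℝ) 1, F) :=
  LinearMap.mkContinuous
    { toFun := fun γ => ⟨fun s => ∫ r in (0 : ℝ)..s, γ (projIcc 0 1 zero_le_one r), by
        have : Continuous fun r => γ (projIcc (0 : ℝ) 1 zero_le_one r) := by fun_prop
        exact (intervalIntegral.continuous_primitive
          (fun a b => this.intervalIntegrable a b) 0).comp continuous_subtype_val⟩
      map_add' := fun γ η => by
        ext s
        have h1 : Continuous fun r => γ (projIcc (0 : ℝ) 1 zero_le_one r) := by fun_prop
        have h2 : Continuous fun r => η (projIcc (0 : ℝ) 1 zero_le_one r) := by fun_prop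
        simpa using intervalIntegral.integral_add (h1.intervalIntegrable _ _)
          (h2.intervalIntegrable _ _)
      map_smul' := fun c γ => by ext s; simp } 1
    (fun γ => by
      rw [ContinuousMap.norm_le _ (by positivity)]
      intro s
      have := intervalIntegral.norm_integral_le_of_norm_le_const
        (a := (0 : ℝ)) (b := s) (C := ‖γ‖) (f := fun r => γ (projIcc (0 : ℝ) 1 zero_le_one r))
        (fun r _ => γ.norm_coe_le_norm _)
      refine this.trans ?_
      rw [sub_zero, abs_of_nonneg s.2.1, one_mul]
      exact mul_le_of_le_one_right (norm_nonneg _) s.2.2)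

lemma primitiveCLM_apply {F : Type*} [NormedAddCommGroup F] [NormedSpace ℝ F]
    (γ : C(Icc (0 : ℝ) 1, F)) (s : Icc (0 : ℝ) 1) :
    primitiveCLM F γ s = ∫ r in (0 : ℝ)..s, γ (projIcc 0 1 zero_le_one r) := rfl

/-- An integral over `[0, 1]` depends as smoothly on a parameter as its integrand. -/
theorem contDiff_integral_unitInterval {P V : Type u} [NormedAddCommGroup P] [NormedSpace ℝ P]
    [NormedAddCommGroup V] [NormedSpace ℝ V] {n : ℕ} {f : ℝ × P → V} (hf : ContDiff ℝ n f) :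
    ContDiff ℝ n fun p => ∫ r in (0 : ℝ)..1, f (r, p) := by
  -- lift `ℝ` to the universe of `P`, as the superposition lemma has a single universe
  let e : ULift.{u} ℝ →L[ℝ] ℝ := (ContinuousLinearEquiv.ulift : ULift.{u} ℝ ≃L[ℝ] ℝ)
  have hg : ContDiff ℝ n fun z : ULift.{u} ℝ × P => f (e z.1, z.2) :=
    hf.comp ((e.contDiff.comp contDiff_fst).prodMk contDiff_snd)
  let K := Icc (0 : ℝ) 1
  let ι : C(K, ULift.{u} ℝ × P) := ⟨fun r => (ULift.up r.1, 0), by fun_prop⟩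
  let κ : P →L[ℝ] C(K, ULift.{u} ℝ × P) :=
    LinearMap.mkContinuous
      { toFun := fun p => ContinuousMap.const K (0, p)
        map_add' := fun p q => ContinuousMap.ext fun s => by
          change ((0 : ULift.{u} ℝ), p + q) = (0 + 0, p + q)
          rw [add_zero]
        map_smul' := fun c p => ContinuousMap.ext fun s => by
          change ((0 : ULift.{u} ℝ), c • p) = (c • 0, c • p)
          rw [smul_zero] } 1
      (fun p => by
        rw [one_mul, ContinuousMap.norm_le _ (norm_nonneg p)]
        intro s
        change ‖((0 : ULift.{u} ℝ), p)‖ ≤ ‖p‖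
        rw [Prod.norm_mk, norm_zero, max_eq_right (norm_nonneg p)])
  have h1 := (contDiff_comp_continuousMap (K := K) n hg).comp
    ((contDiff_const (c := ι)).add κ.contDiff)
  have h2 := (((ContinuousMap.evalCLM ℝ (⟨1, right_mem_Icc.2 zero_le_one⟩ : K)).comp
    (primitiveCLM V)).contDiff (n := (n : ℕ∞ω))).comp h1
  convert h2 using 1
  funext p
  symm
  change primitiveCLM V _ _ = _
  rw [primitiveCLM_apply]
  refine intervalIntegral.integral_congr ?_
  intro r hr
  rw [uIcc_of_le zero_le_one] at hr
  change f (((projIcc (0 : ℝ) 1 zero_le_one r : K) : ℝ) + 0, 0 + p) = f (r, p)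
  rw [projIcc_of_mem zero_le_one hr, add_zero, zero_add]

/-! ### Local flows of vector fields of class `C^n` -/

section

variable {F : Type u} [NormedAddCommGroup F] [NormedSpace ℝ F]

/-- The constant curves over `[0, 1]`. -/
noncomputable def constCurve (F : Type*) [NormedAddCommGroup F] [NormedSpace ℝ F] :
    F →L[ℝ] C(Icc (0 : ℝ) 1, F) :=
  LinearMap.mkContinuous
    { toFun := fun z => ContinuousMap.const _ z
      map_add' := fun _ _ => rfl
      map_smul' := fun _ _ => rfl } 1
    (fun z => by
      rw [one_mul, ContinuousMap.norm_le _ (norm_nonneg z)]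
      exact fun _ => le_rfl)

/-- The defect of a curve `γ` in the integral equation of the vector field `Y`, run in time `t`
from `z`. -/
noncomputable def picardDefect (Y : F → F) (hY : Continuous Y)
    (x : (ℝ × F) × C(Icc (0 : ℝ) 1, F)) : (ℝ × F) × C(Icc (0 : ℝ) 1, F) :=
  (x.1, x.2 - constCurve F x.1.2 -
    x.1.1 • primitiveCLM F ((ContinuousMap.mk Y hY).comp x.2))

lemma contDiff_picardDefect {n : ℕ} {Y : F → F} (hY : ContDiff ℝ n Y) :
    ContDiff ℝ n (picardDefect Y hY.continuous) := by
  have h1 : ContDiff ℝ n fun x : (ℝ × F) × C(Icc (0 : ℝ) 1, F) => constCurve F x.1.2 :=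
    (constCurve F).contDiff.comp (contDiff_snd.comp contDiff_fst)
  have h2 : ContDiff ℝ n fun x : (ℝ × F) × C(Icc (0 : ℝ) 1, F) =>
      primitiveCLM F ((ContinuousMap.mk Y hY.continuous).comp x.2) :=
    (primitiveCLM F).contDiff.comp ((contDiff_comp_continuousMap n hY).comp contDiff_snd)
  exact contDiff_fst.prodMk ((contDiff_snd.sub h1).sub
    ((contDiff_fst.comp contDiff_fst).smul h2))

/-- At time zero the integral equation is `γ = z`, so that its linearization is a shear. -/
lemma exists_hasFDerivAt_picardDefect {n : ℕ} (hn : n ≠ 0) {Y : F → F} (hY : ContDiff ℝ n Y)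
    (z₀ : F) : ∃ e : ((ℝ × F) × C(Icc (0 : ℝ) 1, F)) ≃L[ℝ] ((ℝ × F) × C(Icc (0 : ℝ) 1, F)),
    HasFDerivAt (picardDefect Y hY.continuous)
      (e : ((ℝ × F) × C(Icc (0 : ℝ) 1, F)) →L[ℝ] ((ℝ × F) × C(Icc (0 : ℝ) 1, F)))
      ((0, z₀), constCurve F z₀) := by
  let C := C(Icc (0 : ℝ) 1, F)
  let c : C := primitiveCLM F ((ContinuousMap.mk Y hY.continuous).comp (constCurve F z₀))
  let f : (ℝ × F) →L[ℝ] C := -((constCurve F).comp (ContinuousLinearMap.snd ℝ ℝ F)) -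
    (ContinuousLinearMap.fst ℝ ℝ F).smulRight c
  refine ⟨ContinuousLinearEquiv.skewProd (ContinuousLinearEquiv.refl ℝ (ℝ × F))
    (ContinuousLinearEquiv.refl ℝ C) f, ?_⟩
  have h2 : DifferentiableAt ℝ (fun x : (ℝ × F) × C =>
      primitiveCLM F ((ContinuousMap.mk Y hY.continuous).comp x.2)) ((0, z₀), constCurve F z₀) :=
    (((primitiveCLM F).contDiff.comp ((contDiff_comp_continuousMap n hY).comp
      contDiff_snd)).differentiable (by exact_mod_cast hn)).differentiableAt
  have h3 : HasFDerivAt (fun x : (ℝ × F) × C => x.1.1)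
      ((ContinuousLinearMap.fst ℝ ℝ F).comp (ContinuousLinearMap.fst ℝ (ℝ × F) C))
      ((0, z₀), constCurve F z₀) := hasFDerivAt_fst.fst
  have h4 : HasFDerivAt (fun x : (ℝ × F) × C => constCurve F x.1.2)
      ((constCurve F).comp ((ContinuousLinearMap.snd ℝ ℝ F).comp
        (ContinuousLinearMap.fst ℝ (ℝ × F) C)))
      ((0, z₀), constCurve F z₀) := (constCurve F).hasFDerivAt.comp _ hasFDerivAt_fst.snd
  have h5 := h3.smul h2.hasFDerivAt
  refine (hasFDerivAt_fst.prodMk ((hasFDerivAt_snd.sub h4).sub h5)).congr_fderiv ?_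
  refine ContinuousLinearMap.ext fun x => Prod.ext rfl ?_
  have hrefl : (ContinuousLinearEquiv.refl ℝ C) x.2 = x.2 := rfl
  simp only [ContinuousLinearEquiv.skewProd, f, c]
  simp [hrefl]
  abel

variable [CompleteSpace F]

/-- By the inverse function theorem, the solution of the integral equation is unique nearby, and is
of class `C^n` as a function of the time and the initial point. -/
lemma exists_contDiffAt_picardDefect_solution {n : ℕ} (hn : n ≠ 0) {Y : F → F} (hY : ContDiff ℝ n Y)
    (z₀ : F) : ∃ h : ℝ × F → C(Icc (0 : ℝ) 1, F), ContDiffAt ℝ n h (0, z₀) ∧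
      ∀ᶠ x in 𝓝 (((0, z₀), constCurve F z₀) : (ℝ × F) × C(Icc (0 : ℝ) 1, F)),
        (picardDefect Y hY.continuous x).2 = 0 → h x.1 = x.2 := by
  obtain ⟨e, he⟩ := exists_hasFDerivAt_picardDefect hn hY z₀
  have hn' : (n : ℕ∞ω) ≠ 0 := by exact_mod_cast hn
  have hc := (contDiff_picardDefect hY).contDiffAt (x := ((0, z₀), constCurve F z₀))
  have h0 : picardDefect Y hY.continuous ((0, z₀), constCurve F z₀) = ((0, z₀), 0) := by
    simp [picardDefect]
  refine ⟨fun y => (hc.localInverse he hn' (y, 0)).2, ?_, ?_⟩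
  · have h1 := hc.to_localInverse he hn'
    rw [h0] at h1
    have h2 : ContDiffAt ℝ n
        (fun y : ℝ × F => hc.localInverse he hn' (y, (0 : C(Icc (0 : ℝ) 1, F)))) (0, z₀) :=
      h1.comp (0, z₀) (contDiffAt_id.prodMk contDiffAt_const)
    exact contDiffAt_snd.comp _ h2
  · have h1 := (hc.hasStrictFDerivAt' he hn').eventually_left_inverse
    filter_upwards [h1] with x hx h2
    have h3 : picardDefect Y hY.continuous x = (x.1, 0) := Prod.ext rfl h2
    rw [h3] at hx
    exact congrArg Prod.snd hx

/-- A vector field of class `C^n`, `n ≥ 1`, has a local flow of class `C^n`. -/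
theorem exists_contDiff_localFlow {n : ℕ} (hn : n ≠ 0) {Y : F → F} (hY : ContDiff ℝ n Y) (z₀ : F) :
    ∃ Φ : ℝ × F → F, ContDiffAt ℝ n Φ (0, z₀) ∧ ∃ ε > 0, ∀ z ∈ ball z₀ ε,
      Φ (0, z) = z ∧ ∀ t ∈ Ioo (-ε) ε, HasDerivAt (fun t => Φ (t, z)) (Y (Φ (t, z))) t := by
  have hY1 : ContDiffAt ℝ 1 Y z₀ :=
    hY.contDiffAt.of_le (by exact_mod_cast Nat.one_le_iff_ne_zero.2 hn)
  obtain ⟨ε, hε, a, r, L, K, hr, H⟩ := IsPicardLindelof.of_contDiffAt_one hY1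
  obtain ⟨α, hα, hαc⟩ := (H 0).exists_forall_mem_closedBall_eq_hasDerivWithinAt_continuousOn
  simp only [zero_sub, zero_add] at hα hαc
  have hder : ∀ z ∈ closedBall z₀ (r : ℝ), ∀ t ∈ Ioo (-ε) ε,
      HasDerivAt (fun t => α (z, t)) (Y (α (z, t))) t := fun z hz t ht =>
    ((hα z hz).2 t (Ioo_subset_Icc_self ht)).hasDerivAt (Icc_mem_nhds ht.1 ht.2)
  obtain ⟨h, hh, hinj⟩ := exists_contDiffAt_picardDefect_solution hn hY z₀
  refine ⟨fun x => α (x.2, x.1), ?_, min ε r, lt_min hε (by exact_mod_cast hr), fun z hz => ?_⟩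
  · -- the curves `s ↦ α (z, t s)` solve the integral equation, hence are given by `h`
    have hev : ∀ᶠ x : ℝ × F in 𝓝 (0, z₀), α (x.2, x.1) = h x ⟨1, right_mem_Icc.2 zero_le_one⟩ := by
      obtain ⟨δ, hδ, hδ'⟩ := Metric.eventually_nhds_iff.1 hinj
      have hα0 : α (z₀, 0) = z₀ := (hα z₀ (mem_closedBall_self r.2)).1
      have hnhds : closedBall z₀ (r : ℝ) ×ˢ Icc (-ε) ε ∈ 𝓝 (z₀, (0 : ℝ)) :=
        prod_mem_nhds (closedBall_mem_nhds _ (by exact_mod_cast hr))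
          (Icc_mem_nhds (by linarith) hε)
      have hcont : ContinuousAt α (z₀, 0) := hαc.continuousAt hnhds
      obtain ⟨η, hη, hη'⟩ := Metric.eventually_nhds_iff.1
        (hcont.eventually (ball_mem_nhds (α (z₀, 0)) (half_pos hδ)))
      have hρ : 0 < min (min δ η) (min ε r) :=
        lt_min (lt_min hδ hη) (lt_min hε (by exact_mod_cast hr))
      filter_upwards [Metric.ball_mem_nhds ((0 : ℝ), z₀) hρ] with x hx
      obtain ⟨t, z⟩ := x
      rw [mem_ball, Prod.dist_eq, max_lt_iff] at hx
      obtain ⟨ht, hz⟩ := hx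
      simp only [dist_zero_right, Real.norm_eq_abs] at ht hz
      simp only [lt_min_iff] at ht hz
      have hts : ∀ s ∈ Icc (0 : ℝ) 1, |t * s| ≤ |t| := fun s hs => by
        rw [abs_mul, abs_of_nonneg hs.1]
        exact mul_le_of_le_one_right (abs_nonneg _) hs.2
      have hzr : z ∈ closedBall z₀ (r : ℝ) := mem_closedBall.2 hz.2.2.le
      have htI : ∀ s ∈ Icc (0 : ℝ) 1, t * s ∈ Ioo (-ε) ε := fun s hs =>
        abs_lt.1 ((hts s hs).trans_lt ht.2.1)
      have hγc : Continuous fun s : Icc (0 : ℝ) 1 => α (z, t * s) := by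
        rw [continuous_iff_continuousAt]
        intro s
        exact ContinuousAt.comp (f := fun s : Icc (0 : ℝ) 1 => t * (s : ℝ))
          (g := fun t => α (z, t)) (hder z hzr _ (htI s s.2)).continuousAt (by fun_prop)
      let γ : C(Icc (0 : ℝ) 1, F) := ⟨_, hγc⟩
      have hdist : dist (((t, z), γ) : (ℝ × F) × C(Icc (0 : ℝ) 1, F))
          ((0, z₀), constCurve F z₀) < δ := by
        rw [Prod.dist_eq, Prod.dist_eq]
        refine max_lt (max_lt (by simpa using ht.1.1) hz.1.1) ?_
        refine lt_of_le_of_lt ?_ (half_lt_self hδ)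
        rw [ContinuousMap.dist_le (half_pos hδ).le]
        intro s
        have : dist (z, t * (s : ℝ)) (z₀, 0) < η := by
          rw [Prod.dist_eq]
          exact max_lt hz.1.2 (by simpa using (hts s s.2).trans_lt ht.1.2)
        have h1 := hη' this
        rw [hα0] at h1
        exact h1.le
      have hdef : (picardDefect Y hY.continuous ((t, z), γ)).2 = 0 := by
        ext s
        have hsub : ∀ r ∈ uIcc (0 : ℝ) s, r ∈ Icc (0 : ℝ) 1 := fun r hr => by
          rw [uIcc_of_le s.2.1] at hr
          exact ⟨hr.1, hr.2.trans s.2.2⟩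
        have hint : ∫ r in (0 : ℝ)..s, t • Y (α (z, t * r)) = α (z, t * s) - α (z, t * 0) := by
          refine intervalIntegral.integral_eq_sub_of_hasDerivAt (f := fun r => α (z, t * r))
            (fun r hr => ?_) ?_
          · have h1 := (hder z hzr _ (htI r (hsub r hr)))
            have h2 : HasDerivAt (fun r : ℝ => t * r) t r := by
              simpa using (hasDerivAt_id r).const_mul t
            exact h1.scomp r h2
          · refine ContinuousOn.intervalIntegrable fun r hr => ContinuousAt.continuousWithinAt ?_
            refine ContinuousAt.const_smul ?_ t
            refine hY.continuous.continuousAt.comp ?_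
            exact ContinuousAt.comp (f := fun s : ℝ => t * s)
              (g := fun t => α (z, t)) (hder z hzr _ (htI r (hsub r hr))).continuousAt (by fun_prop)
        have hz0 : α (z, t * 0) = z := by rw [mul_zero]; exact (hα z hzr).1
        have hprim : t • primitiveCLM F ((ContinuousMap.mk Y hY.continuous).comp γ) s =
            α (z, t * s) - z := by
          rw [hz0] at hint
          rw [← hint, intervalIntegral.integral_smul, primitiveCLM_apply]
          congr 1
          refine intervalIntegral.integral_congr fun r hr => ?_
          have := projIcc_of_mem zero_le_one (hsub r hr)
          simp only [this]
          rfl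
        change α (z, t * s) - z - t • primitiveCLM F _ s = 0
        rw [hprim, sub_self]
      have h1 := hδ' hdist hdef
      change α (z, t) = h (t, z) _
      rw [h1]
      change α (z, t) = α (z, t * 1)
      rw [mul_one]
    have h0 : ContDiff ℝ n (ContinuousMap.evalCLM (M := F) ℝ
        (⟨1, right_mem_Icc.2 zero_le_one⟩ : Icc (0 : ℝ) 1)) :=
      ContinuousLinearMap.contDiff _
    have h1 : ContDiffAt ℝ n (fun x => h x ⟨1, right_mem_Icc.2 zero_le_one⟩) (0, z₀) :=
      h0.contDiffAt.comp _ hh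
    exact h1.congr_of_eventuallyEq hev
  · have hzr : z ∈ closedBall z₀ (r : ℝ) :=
      mem_closedBall.2 ((mem_ball.1 hz).le.trans (min_le_right _ _))
    exact ⟨(hα z hzr).1, fun t ht => hder z hzr t
      ⟨by linarith [ht.1, min_le_left ε (r : ℝ)], by linarith [ht.2, min_le_left ε (r : ℝ)]⟩⟩

end

/-! ### Extension of functions of class `C^n` from a half-space -/

section Extension

variable {F G : Type*} [NormedAddCommGroup F] [NormedSpace ℝ F] [NormedAddCommGroup G]
  [NormedSpace ℝ G]

/-- A germ of class `C^n` has a global representative of class `C^n`. -/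
theorem exists_contDiff_eventuallyEq [FiniteDimensional ℝ F] {n : ℕ} {f : F → G} {x : F}
    (hf : ContDiffAt ℝ n f x) : ∃ f', ContDiff ℝ n f' ∧ f' =ᶠ[𝓝 x] f := by
  obtain ⟨u, hu, hfu⟩ := hf.contDiffOn le_rfl (by simp)
  obtain ⟨r, hr, hru⟩ := Metric.mem_nhds_iff.1 hu
  let b : ContDiffBump x := ⟨r / 4, r / 2, by positivity, by linarith⟩
  refine ⟨fun y => b y • f y, ?_, ?_⟩
  · rw [contDiff_iff_contDiffAt]
    intro y
    by_cases hy : y ∈ ball x r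
    · exact b.contDiff.contDiffAt.smul
        ((hfu.mono hru).contDiffAt (isOpen_ball.mem_nhds hy))
    · have hy' : y ∉ tsupport b := by
        rw [b.tsupport_eq, mem_closedBall]
        rw [mem_ball] at hy
        change ¬ dist y x ≤ r / 2
        linarith
      have : (fun y => b y • f y) =ᶠ[𝓝 y] fun _ => 0 := by
        have h1 := (notMem_tsupport_iff_eventuallyEq.1 hy')
        filter_upwards [h1] with z hz
        rw [hz, Pi.zero_apply, zero_smul]
      exact contDiffAt_const.congr_of_eventuallyEq this
  · filter_upwards [b.eventuallyEq_one] with y hy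
    rw [hy, Pi.one_apply, one_smul]

/-- Two Taylor series on closed pieces of a set, which agree on the overlap, glue. -/
lemma HasFTaylorSeriesUpToOn.union {n : ℕ} {f : F → G}
    {p p₁ p₂ : F → FormalMultilinearSeries ℝ F G} {s s₁ s₂ : Set F}
    (h₁ : HasFTaylorSeriesUpToOn n f p₁ s₁) (h₂ : HasFTaylorSeriesUpToOn n f p₂ s₂)
    (hs : s = s₁ ∪ s₂) (hs₁ : ∀ x ∈ s, x ∉ s₁ → x ∉ closure s₁)
    (hs₂ : ∀ x ∈ s, x ∉ s₂ → x ∉ closure s₂)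
    (hp₁ : ∀ x ∈ s₁, ∀ m ≤ n, p x m = p₁ x m) (hp₂ : ∀ x ∈ s₂, ∀ m ≤ n, p x m = p₂ x m) :
    HasFTaylorSeriesUpToOn n f p s := by
  refine ⟨fun x hx => ?_, fun m hm x hx => ?_, fun m hm x hx => ?_⟩
  · rcases hs ▸ hx with hx | hx
    · rw [hp₁ x hx 0 (Nat.zero_le _)]; exact h₁.zero_eq x hx
    · rw [hp₂ x hx 0 (Nat.zero_le _)]; exact h₂.zero_eq x hx
  · have hm' : m < n := by exact_mod_cast hm
    rw [hs]
    refine HasFDerivWithinAt.union ?_ ?_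
    · by_cases hx1 : x ∈ s₁
      · rw [hp₁ x hx1 _ hm']
        exact (h₁.fderivWithin m hm x hx1).congr (fun y hy => hp₁ y hy m hm'.le)
          (hp₁ x hx1 m hm'.le)
      · exact HasFDerivWithinAt.of_notMem_closure (hs₁ x hx hx1)
    · by_cases hx1 : x ∈ s₂
      · rw [hp₂ x hx1 _ hm']
        exact (h₂.fderivWithin m hm x hx1).congr (fun y hy => hp₂ y hy m hm'.le)
          (hp₂ x hx1 m hm'.le)
      · exact HasFDerivWithinAt.of_notMem_closure (hs₂ x hx hx1)
  · have hm' : m ≤ n := by exact_mod_cast hm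
    rw [hs]
    refine ContinuousWithinAt.union ?_ ?_
    · by_cases hx1 : x ∈ s₁
      · exact (h₁.cont m hm x hx1).congr (fun y hy => hp₁ y hy m hm') (hp₁ x hx1 m hm')
      · rw [ContinuousWithinAt, notMem_closure_iff_nhdsWithin_eq_bot.1 (hs₁ x hx hx1)]
        exact tendsto_bot
    · by_cases hx1 : x ∈ s₂
      · exact (h₂.cont m hm x hx1).congr (fun y hy => hp₂ y hy m hm') (hp₂ x hx1 m hm')
      · rw [ContinuousWithinAt, notMem_closure_iff_nhdsWithin_eq_bot.1 (hs₂ x hx hx1)]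
        exact tendsto_bot

/-- The weights of the reflection extension: their moments of order `≤ n` against the reflection
ratios `-1, -2, …, -(n + 1)` are all `1`. -/
lemma exists_reflection_weights (n : ℕ) :
    ∃ a : Fin (n + 1) → ℝ, ∀ i ≤ n, ∑ j, a j * (-((j : ℕ) + 1 : ℝ)) ^ i = 1 := by
  let μ : Fin (n + 1) → ℝ := fun j => -((j : ℕ) + 1 : ℝ)
  have hμ : Function.Injective μ := by
    intro i j hij
    simp only [μ, neg_inj, add_left_inj, Nat.cast_inj] at hij
    exact Fin.ext hij
  have hdet : IsUnit (Matrix.vandermonde μ).det :=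
    (Matrix.det_vandermonde_ne_zero_iff.2 hμ).isUnit
  refine ⟨Matrix.vecMul (fun _ => 1) (Matrix.vandermonde μ)⁻¹, fun i hi => ?_⟩
  have h1 : Matrix.vecMul (Matrix.vecMul (fun _ => (1 : ℝ)) (Matrix.vandermonde μ)⁻¹)
      (Matrix.vandermonde μ) = fun _ => 1 := by
    rw [Matrix.vecMul_vecMul, Matrix.nonsing_inv_mul _ hdet, Matrix.vecMul_one]
  have h2 := congrFun h1 ⟨i, Nat.lt_succ_of_le hi⟩
  rw [Matrix.vecMul, dotProduct] at h2
  simpa [Matrix.vandermonde_apply, μ] using h2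

/-- The map which multiplies the normal coordinate `ℓ` by `μ`, along the transversal `e`. -/
noncomputable def normalScaling (ℓ : F →L[ℝ] ℝ) (e : F) (μ : ℝ) : F →L[ℝ] F :=
  ContinuousLinearMap.id ℝ F - (1 - μ) • ℓ.smulRight e

lemma normalScaling_apply (ℓ : F →L[ℝ] ℝ) (e : F) (μ : ℝ) (z : F) :
    normalScaling ℓ e μ z = μ • (ℓ z • e) + (z - ℓ z • e) := by
  simp only [normalScaling, sub_apply, ContinuousLinearMap.id_apply,
    smul_apply, ContinuousLinearMap.smulRight_apply, sub_smul, one_smul]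
  abel

/-- The weighted sum of the reflections preserves the multilinear maps of degree `≤ n`. -/
lemma sum_weights_compContinuousLinearMap {n : ℕ} {a : Fin (n + 1) → ℝ}
    (ha : ∀ i ≤ n, ∑ j, a j * (-((j : ℕ) + 1 : ℝ)) ^ i = 1) (ℓ : F →L[ℝ] ℝ) (e : F) {m : ℕ}
    (hm : m ≤ n) (Q : ContinuousMultilinearMap ℝ (fun _ : Fin m => F) G) :
    ∑ j, a j • Q.compContinuousLinearMap (fun _ => normalScaling ℓ e (-((j : ℕ) + 1 : ℝ))) = Q := by
  classical
  ext v
  have key : ∀ μ : ℝ, Q (fun k => normalScaling ℓ e μ (v k)) = ∑ T : Finset (Fin m),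
      μ ^ T.card • Q (T.piecewise (fun k => ℓ (v k) • e) (fun k => v k - ℓ (v k) • e)) := by
    intro μ
    simp_rw [normalScaling_apply]
    have := Q.toMultilinearMap.map_add_univ (fun k => μ • (ℓ (v k) • e))
      (fun k => v k - ℓ (v k) • e)
    refine this.trans (Finset.sum_congr rfl fun T _ => ?_)
    have h2 := Q.toMultilinearMap.map_piecewise_smul (fun _ => μ)
      (T.piecewise (fun k => ℓ (v k) • e) (fun k => v k - ℓ (v k) • e)) T
    rw [Finset.prod_const] at h2
    refine Eq.trans ?_ h2
    congr 1
    ext k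
    by_cases hk : k ∈ T <;> simp [hk]
  have key1 : Q v = ∑ T : Finset (Fin m),
      Q (T.piecewise (fun k => ℓ (v k) • e) (fun k => v k - ℓ (v k) • e)) := by
    have := key 1
    simp only [one_pow, one_smul] at this
    rw [← this]
    congr 1
    ext k
    rw [normalScaling_apply, one_smul]
    abel
  simp only [sum_apply, smul_apply,
    ContinuousMultilinearMap.compContinuousLinearMap_apply, key, Finset.smul_sum]
  rw [Finset.sum_comm, key1]
  refine Finset.sum_congr rfl fun T _ => ?_
  simp_rw [smul_smul]
  rw [← Finset.sum_smul, ha _ ((Finset.card_le_univ T).trans (by simpa using hm)), one_smul]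

/-- A function of class `C^n` on a half-space, up to the boundary, extends to a function of class
`C^n` near any given point: across the boundary, take a combination of reflections of the function
which match its derivatives up to order `n`. -/
theorem exists_contDiff_extension [FiniteDimensional ℝ F] {n : ℕ} (ℓ : F →L[ℝ] ℝ) (hℓ : ℓ ≠ 0)
    {f : F → G} {q : F} (hq : 0 ≤ ℓ q) (hf : ContDiffWithinAt ℝ n f {z | 0 ≤ ℓ z} q) :
    ∃ f', ContDiff ℝ n f' ∧ ∀ᶠ z in 𝓝 q, 0 ≤ ℓ z → f' z = f z := by
  rcases hq.lt_or_eq with hq | hq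
  · have hnhds : {z | 0 ≤ ℓ z} ∈ 𝓝 q := by
      filter_upwards [ℓ.continuous.continuousAt.eventually (lt_mem_nhds hq)] with z hz
      exact le_of_lt hz
    obtain ⟨f', hf', h⟩ := exists_contDiff_eventuallyEq (hf.contDiffAt hnhds)
    exact ⟨f', hf', h.mono fun z hz _ => hz⟩
  obtain ⟨e, he⟩ : ∃ e, ℓ e = 1 := by
    obtain ⟨v, hv⟩ := DFunLike.ne_iff.1 hℓ
    exact ⟨(ℓ v)⁻¹ • v, by simpa using inv_mul_cancel₀ hv⟩
  obtain ⟨a, ha⟩ := exists_reflection_weights n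
  obtain ⟨u, hu, p, hp⟩ := contDiffWithinAt_nat.1 hf
  rw [insert_eq_of_mem (show q ∈ {z | 0 ≤ ℓ z} from hq.le)] at hu
  obtain ⟨r, hr, hru⟩ := Metric.mem_nhdsWithin_iff.1 hu
  have hp1 := hp.mono hru
  let R : Fin (n + 1) → F →L[ℝ] F := fun j => normalScaling ℓ e (-((j : ℕ) + 1 : ℝ))
  have hRq : ∀ j, R j q = q := fun j => by simp [R, normalScaling_apply, ← hq]
  have hRℓ : ∀ j z, ℓ (R j z) = -((j : ℕ) + 1 : ℝ) * ℓ z := fun j z => by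
    simp [R, normalScaling_apply, he]
  have hRz : ∀ j z, ℓ z = 0 → R j z = z := fun j z hz => by simp [R, normalScaling_apply, hz]
  -- a ball which all the reflections map into the domain of the given Taylor series
  obtain ⟨δ, hδ, hδr⟩ : ∃ δ > 0, ∀ z ∈ ball q δ, z ∈ ball q r ∧ ∀ j, R j z ∈ ball q r := by
    have h1 : ∀ᶠ z in 𝓝 q, z ∈ ball q r ∧ ∀ j, R j z ∈ ball q r := by
      refine (show ∀ᶠ z in 𝓝 q, z ∈ ball q r from ball_mem_nhds q hr).and
        (eventually_all.2 fun j => ?_)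
      refine (R j).continuous.continuousAt.eventually ?_
      rw [hRq]
      exact ball_mem_nhds q hr
    exact Metric.eventually_nhds_iff.1 h1
  let s₁ := {z | 0 ≤ ℓ z} ∩ ball q δ
  let s₂ := {z | ℓ z ≤ 0} ∩ ball q δ
  let f₂ : F → G := fun z => ∑ j, a j • f (R j z)
  let f' : F → G := fun z => if 0 ≤ ℓ z then f z else f₂ z
  let p₂ : F → FormalMultilinearSeries ℝ F G := fun z m =>
    ∑ j, a j • (p (R j z) m).compContinuousLinearMap (fun _ => R j)
  let p' : F → FormalMultilinearSeries ℝ F G := fun z => if 0 ≤ ℓ z then p z else p₂ z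
  have hsum : ∑ j, a j = 1 := by simpa using ha 0 (Nat.zero_le _)
  have h₁ : HasFTaylorSeriesUpToOn n f' p s₁ := by
    refine (hp1.mono (fun z hz => ⟨(hδr z hz.2).1, hz.1⟩)).congr fun z hz => ?_
    exact if_pos hz.1
  have h₂ : HasFTaylorSeriesUpToOn n f' p₂ s₂ := by
    have h3 : HasFTaylorSeriesUpToOn n f₂ p₂ s₂ := by
      have h4 : ∀ j, HasFTaylorSeriesUpToOn n (fun z => f (R j z))
          (fun z m => (p (R j z) m).compContinuousLinearMap (fun _ => R j)) s₂ := fun j => by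
        refine (hp1.compContinuousLinearMap (R j)).mono fun z hz => ?_
        refine ⟨(hδr z hz.2).2 j, ?_⟩
        change 0 ≤ ℓ (R j z)
        rw [hRℓ]
        exact mul_nonneg_of_nonpos_of_nonpos (by linarith [Nat.cast_nonneg (α := ℝ) (j : ℕ)]) hz.1
      have h5 := hasFTaylorSeriesUpToOn_pi.2 h4
      have h6 := h5.continuousLinearMap_comp
        (∑ j, a j • (ContinuousLinearMap.proj (R := ℝ) (φ := fun _ : Fin (n + 1) => G) j))
      refine (h6.congr (f₁ := f₂) fun z _ => by simp [f₂]).congr_series ?_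
      intro m _ z _
      ext v
      simp [p₂]
    refine h3.congr fun z hz => ?_
    by_cases hz0 : 0 ≤ ℓ z
    · have hz1 : ℓ z = 0 := le_antisymm hz.1 hz0
      simp only [f', if_pos hz0, f₂, hRz _ z hz1]
      rw [← Finset.sum_smul, hsum, one_smul]
    · exact if_neg hz0
  have hT : HasFTaylorSeriesUpToOn n f' p' (ball q δ) := by
    refine HasFTaylorSeriesUpToOn.union h₁ h₂ ?_ ?_ ?_ ?_ ?_
    · ext z
      simp only [s₁, s₂, mem_union, mem_inter_iff, mem_ofPred_eq]
      rcases le_total 0 (ℓ z) with h | h <;> simp [h]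
    · intro x hx hx1 hxc
      have h4 := closure_minimal (inter_subset_left : s₁ ⊆ {z | 0 ≤ ℓ z})
        (isClosed_le continuous_const ℓ.continuous) hxc
      exact hx1 ⟨h4, hx⟩
    · intro x hx hx1 hxc
      have h4 := closure_minimal (inter_subset_left : s₂ ⊆ {z | ℓ z ≤ 0})
        (isClosed_le ℓ.continuous continuous_const) hxc
      exact hx1 ⟨h4, hx⟩
    · intro x hx m _
      simp only [p', if_pos (show 0 ≤ ℓ x from hx.1)]
    · intro x hx m hm
      by_cases hx0 : 0 ≤ ℓ x
      · have hx1 : ℓ x = 0 := le_antisymm hx.1 hx0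
        have hp' : p' x m = p x m := by simp only [p', if_pos hx0]
        rw [hp']
        simp only [p₂, hRz _ x hx1]
        exact (sum_weights_compContinuousLinearMap ha ℓ e hm (p x m)).symm
      · simp only [p', if_neg hx0]
  have hC : ContDiffAt ℝ n f' q := by
    refine (contDiffWithinAt_nat.2 ⟨ball q δ, ?_, p', hT⟩ :
      ContDiffWithinAt ℝ n f' univ q).contDiffAt univ_mem
    rw [insert_eq_of_mem (mem_univ q), nhdsWithin_univ]
    exact ball_mem_nhds q hδ
  obtain ⟨f'', hf'', h⟩ := exists_contDiff_eventuallyEq hC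
  refine ⟨f'', hf'', h.mono fun z hz hz0 => ?_⟩
  rw [hz]
  exact if_pos hz0

end Extension

/-! ### Even functions, implicit functions and a Morse normal form, with parameters -/

section OneVariable

variable {P : Type u} [NormedAddCommGroup P] [NormedSpace ℝ P] {V : Type*} [NormedAddCommGroup V]
  [NormedSpace ℝ V]

lemma hasDerivAt_comp_mul_left {f : ℝ × P → V} (hf : Differentiable ℝ f) (x r : ℝ) (p : P) :
    HasDerivAt (fun r => f (r * x, p)) (x • fderiv ℝ f (r * x, p) (1, 0)) r := by
  have h1 : HasDerivAt (fun r : ℝ => (r * x, p)) ((x, 0) : ℝ × P) r := by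
    refine HasDerivAt.prodMk ?_ (hasDerivAt_const r p)
    simpa using (hasDerivAt_id r).mul_const x
  have h2 := (hf (r * x, p)).hasFDerivAt.comp_hasDerivAt r h1
  refine h2.congr_deriv ?_
  rw [← map_smul]
  simp

lemma contDiff_fderiv_apply {n : ℕ} {f : ℝ × P → V} (hf : ContDiff ℝ (n + 1 : ℕ) f) (w : ℝ × P) :
    ContDiff ℝ n fun z => fderiv ℝ f z w :=
  (hf.fderiv_right (m := n) (by norm_cast)).clm_apply contDiff_const

/-- Hadamard's lemma. -/
lemma eq_add_smul_integral {f : ℝ × P → V} [CompleteSpace V] (hf : ContDiff ℝ 1 f)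
    (x : ℝ) (p : P) :
    f (x, p) = f (0, p) + x • ∫ r in (0 : ℝ)..1, fderiv ℝ f (r * x, p) (1, 0) := by
  have hd := hf.differentiable one_ne_zero
  have hc : Continuous fun r : ℝ => fderiv ℝ f (r * x, p) (1, 0) :=
    ((hf.continuous_fderiv one_ne_zero).comp (by fun_prop)).clm_apply continuous_const
  have h := intervalIntegral.integral_eq_sub_of_hasDerivAt (a := 0) (b := 1)
    (fun r _ => hasDerivAt_comp_mul_left hd x r p) ((hc.const_smul x).intervalIntegrable _ _)
  rw [intervalIntegral.integral_smul] at h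
  rw [h]
  simp

/-- Taylor's formula of order two with integral remainder. -/
lemma taylor_two_integral {h : ℝ × P → ℝ} (hh : ContDiff ℝ 2 h) (s : ℝ) (p : P) :
    h (s, p) = h (0, p) + s * fderiv ℝ h (0, p) (1, 0) + s ^ 2 *
      ∫ r in (0 : ℝ)..1, (1 - r) * fderiv ℝ (fun z => fderiv ℝ h z (1, 0)) (r * s, p) (1, 0) := by
  have hd := hh.differentiable two_ne_zero
  have h1 : ContDiff ℝ 1 fun z => fderiv ℝ h z (1, 0) := contDiff_fderiv_apply (n := 1) hh _
  have hd1 := h1.differentiable one_ne_zero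
  have hc : Continuous fun r : ℝ => fderiv ℝ (fun z => fderiv ℝ h z (1, 0)) (r * s, p) (1, 0) :=
    ((h1.continuous_fderiv one_ne_zero).comp (by fun_prop)).clm_apply continuous_const
  have hder : ∀ r ∈ uIcc (0 : ℝ) 1, HasDerivAt
      (fun r : ℝ => (1 - r) * (s * fderiv ℝ h (r * s, p) (1, 0)) + h (r * s, p))
      (s ^ 2 * ((1 - r) * fderiv ℝ (fun z => fderiv ℝ h z (1, 0)) (r * s, p) (1, 0))) r := by
    intro r _
    have e1 := hasDerivAt_comp_mul_left hd s r p
    have e2 := (hasDerivAt_comp_mul_left hd1 s r p).const_mul s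
    have e3 : HasDerivAt (fun r : ℝ => 1 - r) (-1) r := by
      simpa using (hasDerivAt_id r).const_sub 1
    refine ((e3.mul e2).add e1).congr_deriv ?_
    simp only [smul_eq_mul]
    ring
  have h := intervalIntegral.integral_eq_sub_of_hasDerivAt hder
    ((((by fun_prop : Continuous fun r : ℝ => 1 - r).mul hc).const_smul
      (s ^ 2)).intervalIntegrable _ _)
  rw [intervalIntegral.integral_const_mul] at h
  rw [h]
  simp
  ring

/-- The reflection of the first variable. -/
noncomputable def reflectFst (P : Type*) [NormedAddCommGroup P] [NormedSpace ℝ P] :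
    ℝ × P →L[ℝ] ℝ × P :=
  (-ContinuousLinearMap.fst ℝ ℝ P).prod (ContinuousLinearMap.snd ℝ ℝ P)

lemma reflectFst_apply (x : ℝ) (p : P) : reflectFst P (x, p) = (-x, p) := rfl

lemma fderiv_reflectFst {E : ℝ × P → V} (hE : Differentiable ℝ E)
    (heven : ∀ z, E (reflectFst P z) = E z) (z w : ℝ × P) :
    fderiv ℝ E (reflectFst P z) (reflectFst P w) = fderiv ℝ E z w := by
  have h1 := (hE (reflectFst P z)).hasFDerivAt.comp z (reflectFst P).hasFDerivAt
  have h2 : E ∘ reflectFst P = E := funext heven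
  rw [h2] at h1
  rw [h1.fderiv]
  rfl

/-- If the even function `E` is written `E (x, p) = G (x², p)`, then `D (x, p)` is the derivative of
`G` at `(x², p)`. -/
lemma exists_even_deriv {V : Type u} [NormedAddCommGroup V] [NormedSpace ℝ V] [CompleteSpace V]
    {n : ℕ} {E : ℝ × P → V} (hE : ContDiff ℝ (n + 2 : ℕ) E)
    (heven : ∀ z, E (reflectFst P z) = E z) :
    ∃ D : ℝ × P → ℝ × P →L[ℝ] V, ContDiff ℝ n D ∧ (∀ z, D (reflectFst P z) = D z) ∧
      ∀ x p τ ζ, fderiv ℝ E (x, p) (τ, ζ) = D (x, p) (2 * x * τ, ζ) := by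
  have hd : Differentiable ℝ E := hE.differentiable (by norm_cast)
  have hE1 : ContDiff ℝ (n + 1 : ℕ) fun z => fderiv ℝ E z (1, 0) :=
    contDiff_fderiv_apply (n := n + 1) hE _
  have hE2 : ContDiff ℝ n fun z => fderiv ℝ (fun z => fderiv ℝ E z (1, 0)) z (1, 0) :=
    contDiff_fderiv_apply hE1 _
  let K : ℝ × P → V := fun z => (2⁻¹ : ℝ) • ∫ r in (0 : ℝ)..1,
    fderiv ℝ (fun z => fderiv ℝ E z (1, 0)) (r * z.1, z.2) (1, 0)
  have hodd : ∀ z, fderiv ℝ E (reflectFst P z) (1, 0) = -fderiv ℝ E z (1, 0) := by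
    intro z
    rw [← fderiv_reflectFst hd heven z, ← map_neg]
    congr 1
    simp [reflectFst_apply]
  have heven2 : ∀ z, fderiv ℝ (fun z => fderiv ℝ E z (1, 0)) (reflectFst P z) (1, 0) =
      fderiv ℝ (fun z => fderiv ℝ E z (1, 0)) z (1, 0) := by
    intro z
    have hd1 : Differentiable ℝ fun z => fderiv ℝ E z (1, 0) := hE1.differentiable (by norm_cast)
    have h1 := (hd1 (reflectFst P z)).hasFDerivAt.comp z (reflectFst P).hasFDerivAt
    have h2 : (fun z => fderiv ℝ E z (1, 0)) ∘ reflectFst P = -fun z => fderiv ℝ E z (1, 0) :=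
      funext hodd
    rw [h2] at h1
    have h3 := congrArg (fun L : ℝ × P →L[ℝ] V => L (-1, 0)) h1.fderiv
    rw [fderiv_neg] at h3
    have h4 : ((-1, 0) : ℝ × P) = -(1, 0) := by simp
    simp only [ContinuousLinearMap.comp_apply, reflectFst_apply, neg_neg, neg_apply] at h3
    rw [← h3, h4, map_neg, neg_neg]
  have hK : ContDiff ℝ n K := by
    refine contDiff_const.smul (contDiff_integral_unitInterval (P := ℝ × P)
      (f := fun y : ℝ × ℝ × P =>
        fderiv ℝ (fun z => fderiv ℝ E z (1, 0)) (y.1 * y.2.1, y.2.2) (1, 0)) ?_)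
    exact hE2.comp ((contDiff_fst.mul (contDiff_fst.comp contDiff_snd)).prodMk
      (contDiff_snd.comp contDiff_snd))
  have hKeven : ∀ z, K (reflectFst P z) = K z := by
    rintro ⟨x, p⟩
    simp only [K, reflectFst_apply]
    congr 1
    refine intervalIntegral.integral_congr fun r _ => ?_
    have := heven2 (r * x, p)
    rw [reflectFst_apply] at this
    simpa using this
  have hKx : ∀ x p, fderiv ℝ E (x, p) (1, 0) = (2 * x) • K (x, p) := by
    intro x p
    have h1 := eq_add_smul_integral (hE1.of_le (by norm_cast; omega)) x p
    have h0 : fderiv ℝ E (0, p) (1, 0) = 0 := by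
      have := hodd (0, p)
      rw [reflectFst_apply, neg_zero] at this
      have h2 : (2 : ℝ) • fderiv ℝ E (0, p) (1, 0) = 0 := by
        rw [two_smul]; nth_rewrite 1 [this]; simp
      simpa using h2
    rw [h1, h0, zero_add, smul_smul]
    congr 1
    ring
  let inr : P →L[ℝ] ℝ × P := ContinuousLinearMap.inr ℝ ℝ P
  let snd : ℝ × P →L[ℝ] P := ContinuousLinearMap.snd ℝ ℝ P
  refine ⟨fun z => (fderiv ℝ E z).comp (inr.comp snd) +
    (ContinuousLinearMap.fst ℝ ℝ P).smulRight (K z), ?_, ?_, ?_⟩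
  · refine ContDiff.add ?_ ?_
    · exact (hE.fderiv_right (m := n) (by norm_cast; omega)).clm_comp contDiff_const
    · exact (ContinuousLinearMap.smulRightL ℝ (ℝ × P) V
        (ContinuousLinearMap.fst ℝ ℝ P)).contDiff.comp hK
  · intro z
    refine ContinuousLinearMap.ext fun w => ?_
    have h1 := fderiv_reflectFst hd heven z (0, w.2)
    rw [reflectFst_apply 0 w.2, neg_zero] at h1
    change fderiv ℝ E (reflectFst P z) (0, w.2) + w.1 • K (reflectFst P z) =
      fderiv ℝ E z (0, w.2) + w.1 • K z
    rw [h1, hKeven]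
  · intro x p τ ζ
    have h1 : ((τ, ζ) : ℝ × P) = τ • (1, 0) + (0, ζ) := by simp
    rw [h1, map_add, map_smul, hKx]
    simp only [add_apply, ContinuousLinearMap.comp_apply,
      ContinuousLinearMap.smulRight_apply, inr, snd]
    simp only [ContinuousLinearMap.coe_snd', ContinuousLinearMap.inr_apply,
      ContinuousLinearMap.coe_fst', smul_smul]
    rw [add_comm]
    congr 2
    ring

/-- **Whitney's lemma on even functions**: an even function of class `C^(2k)` is a function of
class `C^k` of the square of its variable, up to the boundary. -/
theorem contDiffOn_comp_sqrt (k : ℕ) : ∀ {V : Type u} [NormedAddCommGroup V] [NormedSpace ℝ V]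
    [CompleteSpace V] {E : ℝ × P → V} (_ : ContDiff ℝ (2 * k : ℕ) E)
    (_ : ∀ z, E (reflectFst P z) = E z),
    ContDiffOn ℝ k (fun y : ℝ × P => E (√y.1, y.2)) (Ici (0 : ℝ) ×ˢ univ) := by
  induction k with
  | zero =>
    intro V _ _ _ E hE _
    refine contDiffOn_zero.2 (Continuous.continuousOn ?_)
    exact hE.continuous.comp (by fun_prop)
  | succ k ih =>
    intro V _ _ _ E hE heven
    obtain ⟨D, hD, hDeven, hDE⟩ := exists_even_deriv (n := 2 * k) hE heven
    have hd : Differentiable ℝ E := hE.differentiable (by norm_cast)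
    set G : ℝ × P → V := fun y => E (√y.1, y.2)
    have hGc : Continuous G := hE.continuous.comp (by fun_prop)
    have hpos : ∀ y ∈ Ioi (0 : ℝ) ×ˢ (univ : Set P), HasFDerivAt G (D (√y.1, y.2)) y := by
      rintro ⟨s, p⟩ ⟨hs, -⟩
      simp only [mem_Ioi] at hs
      have h1 : HasFDerivAt (fun y : ℝ × P => (√y.1, y.2))
          (((1 / (2 * √s)) • ContinuousLinearMap.fst ℝ ℝ P).prod (ContinuousLinearMap.snd ℝ ℝ P))
          (s, p) :=
        ((hasFDerivAt_fst (𝕜 := ℝ) (p := ((s, p) : ℝ × P))).sqrt hs.ne').prodMk hasFDerivAt_snd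
      refine ((hd (√s, p)).hasFDerivAt.comp (s, p) h1).congr_fderiv ?_
      refine ContinuousLinearMap.ext fun w => ?_
      obtain ⟨τ, ζ⟩ := w
      have hs' : √s ≠ 0 := (Real.sqrt_pos.2 hs).ne'
      change fderiv ℝ E (√s, p) ((1 / (2 * √s)) * τ, ζ) = _
      rw [hDE]
      congr 2
      field_simp
    have hDc : Continuous fun y : ℝ × P => D (√y.1, y.2) := hD.continuous.comp (by fun_prop)
    have hcl : closure (Ioi (0 : ℝ) ×ˢ (univ : Set P)) = Ici (0 : ℝ) ×ˢ univ := by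
      rw [closure_prod_eq, closure_Ioi, closure_univ]
    have hder : ∀ y ∈ Ici (0 : ℝ) ×ˢ (univ : Set P),
        HasFDerivWithinAt G (D (√y.1, y.2)) (Ici (0 : ℝ) ×ˢ univ) y := by
      intro y _
      rw [← hcl]
      refine hasFDerivWithinAt_closure_of_tendsto_fderiv
        (fun z hz => (hpos z hz).differentiableAt.differentiableWithinAt)
        ((convex_Ioi 0).prod convex_univ) (isOpen_Ioi.prod isOpen_univ)
        (fun z _ => hGc.continuousWithinAt) ?_
      refine (hDc.continuousAt.tendsto.mono_left nhdsWithin_le_nhds).congr' ?_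
      filter_upwards [self_mem_nhdsWithin] with z hz
      exact (hpos z hz).fderiv.symm
    have hfin := ih hD hDeven
    intro y hy
    rw [Nat.cast_add, Nat.cast_one, contDiffWithinAt_succ_iff_hasFDerivWithinAt (by simp)]
    refine ⟨Ici (0 : ℝ) ×ˢ univ, ?_, by simp, _, hder, hfin y hy⟩
    rw [insert_eq_of_mem hy]
    exact self_mem_nhdsWithin

/-- The implicit function theorem for one real unknown: the local inverse `σ` of `f (·, p)`. -/
theorem exists_inverse_fst [CompleteSpace P] {n : ℕ} (hn : n ≠ 0) {f : ℝ × P → ℝ} {t₀ : ℝ} {p₀ : P}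
    (hf : ContDiffAt ℝ n f (t₀, p₀)) (ha : fderiv ℝ f (t₀, p₀) (1, 0) ≠ 0) :
    ∃ σ : ℝ × P → ℝ, ContDiffAt ℝ n σ (f (t₀, p₀), p₀) ∧ σ (f (t₀, p₀), p₀) = t₀ ∧
      (∀ᶠ y in 𝓝 (f (t₀, p₀), p₀), f (σ y, y.2) = y.1) ∧
      ∀ᶠ z in 𝓝 (t₀, p₀), σ (f z, z.2) = z.1 := by
  have hn' : (n : ℕ∞ω) ≠ 0 := by exact_mod_cast hn
  set a := fderiv ℝ f (t₀, p₀) (1, 0)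
  let fst : ℝ × P →L[ℝ] ℝ := ContinuousLinearMap.fst ℝ ℝ P
  let snd : ℝ × P →L[ℝ] P := ContinuousLinearMap.snd ℝ ℝ P
  let L := fderiv ℝ f (t₀, p₀)
  have hL : ∀ τ ζ, L (τ, ζ) = τ * a + L (0, ζ) := by
    intro τ ζ
    have h1 : ((τ, ζ) : ℝ × P) = τ • (1, 0) + (0, ζ) := by simp
    rw [h1, map_add, map_smul]
    simp [L, a]
  let e : (ℝ × P) ≃L[ℝ] (ℝ × P) := ContinuousLinearEquiv.equivOfInverse
    (L.prod snd) ((a⁻¹ • (fst - (L.comp (ContinuousLinearMap.inr ℝ ℝ P)).comp snd)).prod snd)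
    (by
      rintro ⟨τ, ζ⟩
      simp only [ContinuousLinearMap.prod_apply, smul_apply, sub_apply,
        ContinuousLinearMap.comp_apply, ContinuousLinearMap.inr_apply, fst, snd,
        ContinuousLinearMap.coe_fst', ContinuousLinearMap.coe_snd', smul_eq_mul]
      rw [hL]
      congr 1
      field_simp
      ring)
    (by
      rintro ⟨τ, ζ⟩
      simp only [ContinuousLinearMap.prod_apply, smul_apply, sub_apply,
        ContinuousLinearMap.comp_apply, ContinuousLinearMap.inr_apply, fst, snd,
        ContinuousLinearMap.coe_fst', ContinuousLinearMap.coe_snd', smul_eq_mul]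
      rw [hL]
      congr 1
      field_simp
      ring)
  let Ψ : ℝ × P → ℝ × P := fun z => (f z, z.2)
  have hΨ : ContDiffAt ℝ n Ψ (t₀, p₀) := hf.prodMk contDiffAt_snd
  have hΨ' : HasFDerivAt Ψ (e : (ℝ × P) →L[ℝ] (ℝ × P)) (t₀, p₀) :=
    (hf.differentiableAt hn').hasFDerivAt.prodMk hasFDerivAt_snd
  have hinv := hΨ.hasStrictFDerivAt' hΨ' hn'
  have hr : ∀ᶠ y in 𝓝 (Ψ (t₀, p₀)), Ψ (hΨ.localInverse hΨ' hn' y) = y :=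
    hinv.eventually_right_inverse
  have hl : ∀ᶠ z in 𝓝 (t₀, p₀), hΨ.localInverse hΨ' hn' (Ψ z) = z :=
    hinv.eventually_left_inverse
  refine ⟨fun y => (hΨ.localInverse hΨ' hn' y).1, ?_, ?_, ?_, ?_⟩
  · exact contDiffAt_fst.comp _ (hΨ.to_localInverse hΨ' hn')
  · exact congrArg Prod.fst (hΨ.localInverse_apply_image hΨ' hn')
  · filter_upwards [hr] with y hy
    have h2 : (hΨ.localInverse hΨ' hn' y).2 = y.2 :=
      (congrArg Prod.snd hy : (Ψ _).2 = _)
    rw [← h2]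
    exact congrArg Prod.fst hy
  · filter_upwards [hl] with z hz
    exact congrArg Prod.fst hz

/-- Near a nondegenerate maximum in its first variable, a function is the maximum minus the square
of a coordinate. -/
theorem exists_morse_coordinate [CompleteSpace P] {n : ℕ} (hn : n ≠ 0) {h : ℝ × P → ℝ} {p₀ : P}
    (hh : ContDiff ℝ (n + 2 : ℕ) h) (hcrit : ∀ᶠ p in 𝓝 p₀, fderiv ℝ h (0, p) (1, 0) = 0)
    (hneg : fderiv ℝ (fun z => fderiv ℝ h z (1, 0)) (0, p₀) (1, 0) < 0) :
    ∃ x : ℝ × P → ℝ, ContDiffAt ℝ n x (0, p₀) ∧ (∀ p, x (0, p) = 0) ∧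
      0 < fderiv ℝ x (0, p₀) (1, 0) ∧
      ∀ᶠ z in 𝓝 ((0, p₀) : ℝ × P), h z = h (0, z.2) - x z ^ 2 := by
  have hh1 : ContDiff ℝ (n + 1 : ℕ) fun z => fderiv ℝ h z (1, 0) :=
    contDiff_fderiv_apply (n := n + 1) hh _
  have hh2 : ContDiff ℝ n fun z => fderiv ℝ (fun z => fderiv ℝ h z (1, 0)) z (1, 0) :=
    contDiff_fderiv_apply hh1 _
  let e : ℝ × P → ℝ := fun z => -∫ r in (0 : ℝ)..1,
    (1 - r) * fderiv ℝ (fun z => fderiv ℝ h z (1, 0)) (r * z.1, z.2) (1, 0)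
  have he : ContDiff ℝ n e := by
    -- the parametric integral lemma has a single universe, so the values are lifted
    let E₀ : ℝ × (ℝ × P) → ULift.{u} ℝ := fun y => ULift.up ((1 - y.1) *
        fderiv ℝ (fun z => fderiv ℝ h z (1, 0)) (y.1 * y.2.1, y.2.2) (1, 0))
    have h1 : ContDiff ℝ n E₀ := by
      refine (ContinuousLinearEquiv.ulift : ULift.{u} ℝ ≃L[ℝ] ℝ).symm.contDiff.comp
        (ContDiff.mul (contDiff_const.sub contDiff_fst) (hh2.comp
          ((contDiff_fst.mul (contDiff_fst.comp contDiff_snd)).prodMk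
            (contDiff_snd.comp contDiff_snd))))
    have h2 := (ContinuousLinearEquiv.ulift : ULift.{u} ℝ ≃L[ℝ] ℝ).contDiff.comp
      (contDiff_integral_unitInterval h1)
    refine ContDiff.neg ?_
    convert h2 using 1
    funext z
    rw [Function.comp_apply]
    have h3 := ContinuousLinearMap.intervalIntegral_comp_comm
      (ContinuousLinearEquiv.ulift : ULift.{u} ℝ ≃L[ℝ] ℝ).toContinuousLinearMap
      (μ := volume) (a := 0) (b := 1) (f := fun r => E₀ (r, z))
      ((h1.continuous.comp (by fun_prop : Continuous fun r : ℝ => (r, z))).intervalIntegrable _ _)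
    exact h3
  have he0 : 0 < e (0, p₀) := by
    simp only [e, mul_zero, intervalIntegral.integral_mul_const]
    have : ∫ r in (0 : ℝ)..1, (1 - r) = 1 / 2 := by
      rw [intervalIntegral.integral_sub (by simp) (by simp)]
      norm_num
    rw [this]
    linarith
  have hepos : ∀ᶠ z in 𝓝 ((0, p₀) : ℝ × P), 0 < e z :=
    he.continuous.continuousAt.eventually (lt_mem_nhds he0)
  have hx : ContDiffAt ℝ n (fun z : ℝ × P => z.1 * √(e z)) (0, p₀) :=
    contDiffAt_fst.mul (he.contDiffAt.sqrt he0.ne')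
  refine ⟨fun z => z.1 * √(e z), hx, fun p => by simp, ?_, ?_⟩
  · have hn' : (n : ℕ∞ω) ≠ 0 := by exact_mod_cast hn
    have h1 := (hasFDerivAt_fst (𝕜 := ℝ) (p := ((0, p₀) : ℝ × P))).mul
      ((he.contDiffAt.sqrt he0.ne').differentiableAt hn').hasFDerivAt
    have h2 : fderiv ℝ (fun z : ℝ × P => z.1 * √(e z)) (0, p₀) = _ := h1.fderiv
    rw [h2]
    simpa using he0
  · have h1 : ∀ᶠ z in 𝓝 ((0, p₀) : ℝ × P), fderiv ℝ h (0, z.2) (1, 0) = 0 :=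
      (continuous_snd.continuousAt (x := ((0, p₀) : ℝ × P))).eventually hcrit
    filter_upwards [hepos, h1] with z hz hz1
    rw [mul_pow, Real.sq_sqrt hz.le]
    have h2 := taylor_two_integral (hh.of_le (by norm_cast; omega)) z.1 z.2
    rw [Prod.mk.eta] at h2
    rw [h2, hz1]
    simp only [e]
    ring

end OneVariable

/-! ### Linear transport along the flow, near the boundary of a half-space -/

/-- `c` solves `c' = Y(c)` on `[a, b]`. -/
def IsODESolution {F : Type*} [NormedAddCommGroup F] [NormedSpace ℝ F] (Y : F → F) (c : ℝ → F)
    (a b : ℝ) : Prop :=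
  ∀ t ∈ Icc a b, HasDerivWithinAt c (Y (c t)) (Icc a b) t

/-- `W` solves the linear equation `W' = N(c) W` on `[a, b]`, along the curve `c`. -/
def IsTransport {F V : Type*} [NormedAddCommGroup V] [NormedSpace ℝ V] (N : F → V →L[ℝ] V)
    (c : ℝ → F) (W : ℝ → V) (a b : ℝ) : Prop :=
  ∀ t ∈ Icc a b, HasDerivWithinAt W (N (c t) (W t)) (Icc a b) t

lemma IsODESolution.mono {F : Type*} [NormedAddCommGroup F] [NormedSpace ℝ F] {Y : F → F}
    {c : ℝ → F} {a b a' b' : ℝ} (h : IsODESolution Y c a b) (ha : a ≤ a') (hb : b' ≤ b) :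
    IsODESolution Y c a' b' := fun t ht =>
  (h t (Icc_subset_Icc ha hb ht)).mono (Icc_subset_Icc ha hb)

/-- Uniqueness of the solutions of an autonomous equation of class `C^1`. -/
theorem IsODESolution.eqOn {F : Type*} [NormedAddCommGroup F] [NormedSpace ℝ F]
    [FiniteDimensional ℝ F] {Y : F → F} (hY : ContDiff ℝ 1 Y) {a b t₀ : ℝ} {f g : ℝ → F}
    (hf : IsODESolution Y f a b) (hg : IsODESolution Y g a b) (ht₀ : t₀ ∈ Icc a b)
    (h : f t₀ = g t₀) : EqOn f g (Icc a b) := by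
  have hfc : ContinuousOn f (Icc a b) := fun t ht => (hf t ht).continuousWithinAt
  have hgc : ContinuousOn g (Icc a b) := fun t ht => (hg t ht).continuousWithinAt
  obtain ⟨R, hR⟩ := ((isCompact_Icc.image_of_continuousOn hfc).union
    (isCompact_Icc.image_of_continuousOn hgc)).isBounded.subset_closedBall 0
  have : ProperSpace F := FiniteDimensional.proper_real F
  obtain ⟨K, hK⟩ := hY.contDiffOn.exists_lipschitzOnWith one_ne_zero
    (convex_closedBall (0 : F) R) (isCompact_closedBall (0 : F) R)
  have hfR : ∀ t ∈ Icc a b, f t ∈ closedBall (0 : F) R := fun t ht =>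
    hR (Or.inl (mem_image_of_mem f ht))
  have hgR : ∀ t ∈ Icc a b, g t ∈ closedBall (0 : F) R := fun t ht =>
    hR (Or.inr (mem_image_of_mem g ht))
  have right : ∀ {f : ℝ → F}, IsODESolution Y f a b → ∀ t ∈ Ico t₀ b,
      HasDerivWithinAt f (Y (f t)) (Ici t) t := fun hf t ht => by
    refine (hf t ⟨ht₀.1.trans ht.1, ht.2.le⟩).mono_of_mem_nhdsWithin ?_
    refine mem_of_superset (Icc_mem_nhdsGE ht.2) (Icc_subset_Icc (ht₀.1.trans ht.1) le_rfl)
  have left : ∀ {f : ℝ → F}, IsODESolution Y f a b → ∀ t ∈ Ioc a t₀,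
      HasDerivWithinAt f (Y (f t)) (Iic t) t := fun hf t ht => by
    refine (hf t ⟨ht.1.le, ht.2.trans ht₀.2⟩).mono_of_mem_nhdsWithin ?_
    refine mem_of_superset (Icc_mem_nhdsLE ht.1) (Icc_subset_Icc le_rfl (ht.2.trans ht₀.2))
  have sub1 : Icc a t₀ ⊆ Icc a b := Icc_subset_Icc le_rfl ht₀.2
  have sub2 : Icc t₀ b ⊆ Icc a b := Icc_subset_Icc ht₀.1 le_rfl
  rw [← Icc_union_Icc_eq_Icc ht₀.1 ht₀.2]
  refine EqOn.union ?_ ?_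
  · exact ODE_solution_unique_of_mem_Icc_left (v := fun _ => Y) (s := fun _ => closedBall 0 R)
      (fun _ _ => hK) (hfc.mono sub1) (left hf)
      (fun t ht => hfR t (sub1 (Ioc_subset_Icc_self ht))) (hgc.mono sub1) (left hg)
      (fun t ht => hgR t (sub1 (Ioc_subset_Icc_self ht))) h
  · exact ODE_solution_unique_of_mem_Icc_right (v := fun _ => Y) (s := fun _ => closedBall 0 R)
      (fun _ _ => hK) (hfc.mono sub2) (right hf)
      (fun t ht => hfR t (sub2 (Ico_subset_Icc_self ht))) (hgc.mono sub2) (right hg)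
      (fun t ht => hgR t (sub2 (Ico_subset_Icc_self ht))) h

lemma exists_box {F : Type*} [PseudoMetricSpace F] {z₀ : F} {p : ℝ × F → Prop}
    (h : ∀ᶠ y in 𝓝 ((0 : ℝ), z₀), p y) :
    ∃ δ > 0, ∀ t z, |t| < δ → dist z z₀ < δ → p (t, z) := by
  obtain ⟨δ, hδ, H⟩ := Metric.eventually_nhds_iff.1 h
  refine ⟨δ, hδ, fun t z ht hz => H ?_⟩
  rw [Prod.dist_eq]
  exact max_lt (by simpa using ht) hz

section

variable {F V : Type u} [NormedAddCommGroup F] [NormedSpace ℝ F]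
  [NormedAddCommGroup V] [NormedSpace ℝ V]

/-- The local flow `φ` of `Y` and, along it, the solution operator of `W' = N W`: here `S (t, z)` is
the value at time `0` of the solution along `φ (·, z)` whose value at time `t` is `w₀`. -/
structure LocalTransport (Y : F → F) (N : F → V →L[ℝ] V) (w₀ : V) (z₀ : F) (m : ℕ) where
  /-- the flow -/
  φ : ℝ × F → F
  /-- the solution operator -/
  S : ℝ × F → V
  /-- the size of the domain -/
  ε : ℝ
  ε_pos : 0 < ε
  contDiffAt_φ : ContDiffAt ℝ m φ (0, z₀)
  contDiffAt_S : ContDiffAt ℝ m S (0, z₀)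
  φ_zero : ∀ z ∈ ball z₀ ε, φ (0, z) = z
  hasDerivAt_φ : ∀ z ∈ ball z₀ ε, ∀ t ∈ Ioo (-ε) ε,
    HasDerivAt (fun t => φ (t, z)) (Y (φ (t, z))) t
  eq_S : ∀ z ∈ ball z₀ ε, ∀ t ∈ Ioo (-ε) ε, ∀ a b W, a ≤ 0 → 0 ≤ b → t ∈ Icc a b →
    -ε < a → b < ε → IsTransport N (fun t => φ (t, z)) W a b → W t = w₀ → W 0 = S (t, z)

lemma hasDerivAt_fst_of_differentiableAt {G : Type*} [NormedAddCommGroup G] [NormedSpace ℝ G]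
    {f : ℝ × F → G} {t : ℝ} {z : F} (hf : DifferentiableAt ℝ f (t, z)) :
    HasDerivAt (fun t => f (t, z)) (fderiv ℝ f (t, z) (1, 0)) t :=
  hf.hasFDerivAt.comp_hasDerivAt t ((hasDerivAt_id t).prodMk (hasDerivAt_const t z))

lemma LocalTransport.hasDerivAt_normal {Y : F → F} {N : F → V →L[ℝ] V} {w₀ : V} {z₀ : F} {m : ℕ}
    (L : LocalTransport Y N w₀ z₀ m) (ℓ : F →L[ℝ] ℝ) {z : F} (hz : z ∈ ball z₀ L.ε) {t : ℝ}
    (ht : t ∈ Ioo (-L.ε) L.ε) :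
    HasDerivAt (fun t => ℓ (L.φ (t, z))) (ℓ (Y (L.φ (t, z)))) t :=
  ℓ.hasFDerivAt.comp_hasDerivAt t (L.hasDerivAt_φ z hz t ht)

variable [FiniteDimensional ℝ F] [FiniteDimensional ℝ V]

/-- The solution operator is read off the local flow of the system `z' = Y(z)`, `W' = N(z) W`, run
backwards in time. -/
theorem exists_localTransport {m : ℕ} (hm : m ≠ 0) {Y : F → F} (hY : ContDiff ℝ m Y)
    {N : F → V →L[ℝ] V} (hN : ContDiff ℝ m N) (w₀ : V) (z₀ : F) :
    Nonempty (LocalTransport Y N w₀ z₀ m) := by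
  let Z : F × V → F × V := fun y => (Y y.1, N y.1 y.2)
  have hZ : ContDiff ℝ m Z := (hY.comp contDiff_fst).prodMk
    ((hN.comp contDiff_fst).clm_apply contDiff_snd)
  have hZ1 : ContDiff ℝ 1 Z := hZ.of_le (by exact_mod_cast Nat.one_le_iff_ne_zero.2 hm)
  have : CompleteSpace (F × V) := FiniteDimensional.complete ℝ _
  obtain ⟨Φ, hΦ, ε, hε, H⟩ := exists_contDiff_localFlow hm hZ (z₀, w₀)
  let φ : ℝ × F → F := fun y => (Φ (y.1, (y.2, w₀))).1
  have hΦ0 : Φ (0, (z₀, w₀)) = (z₀, w₀) := (H _ (mem_ball_self hε)).1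
  have hφ : ContDiffAt ℝ m φ (0, z₀) := by
    have h1 : ContDiffAt ℝ m (fun y : ℝ × F => (y.1, (y.2, w₀))) (0, z₀) := by fun_prop
    exact contDiffAt_fst.comp _ (ContDiffAt.comp (0, z₀) hΦ h1)
  have hφ0 : φ (0, z₀) = z₀ := congrArg Prod.fst hΦ0
  let S : ℝ × F → V := fun y => (Φ (-y.1, (φ y, w₀))).2
  have hS : ContDiffAt ℝ m S (0, z₀) := by
    have h1 : ContDiffAt ℝ m (fun y : ℝ × F => (-y.1, (φ y, w₀))) (0, z₀) :=
      contDiffAt_fst.neg.prodMk (hφ.prodMk contDiffAt_const)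
    have h2 : ContDiffAt ℝ m Φ ((fun y : ℝ × F => (-y.1, (φ y, w₀))) (0, z₀)) := by
      simpa [hφ0] using hΦ
    exact contDiffAt_snd.comp _ (ContDiffAt.comp (0, z₀) h2 h1)
  have hball : ∀ z ∈ ball z₀ ε, (z, w₀) ∈ ball (z₀, w₀) ε := fun z hz => by
    rw [mem_ball, Prod.dist_eq, dist_self]
    exact max_lt hz hε
  obtain ⟨δ, hδ, hδ'⟩ := exists_box
    (hφ.continuousAt.eventually (show ball (φ (0, z₀)) ε ∈ 𝓝 (φ (0, z₀)) from ball_mem_nhds _ hε))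
  rw [hφ0] at hδ'
  have hm1 : min δ (ε / 2) ≤ δ := min_le_left _ _
  have hm2 : min δ (ε / 2) ≤ ε / 2 := min_le_right _ _
  have hder : ∀ z ∈ ball z₀ ε, ∀ t ∈ Ioo (-ε) ε,
      HasDerivAt (fun t => φ (t, z)) (Y (φ (t, z))) t := fun z hz t ht =>
    ((H _ (hball z hz)).2 t ht).fst
  refine ⟨⟨φ, S, min δ (ε / 2), lt_min hδ (half_pos hε), hφ, hS, fun z hz => ?_,
    fun z hz t ht => ?_, ?_⟩⟩
  · rw [mem_ball] at hz
    exact congrArg Prod.fst (H _ (hball z (mem_ball.2 (by linarith)))).1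
  · rw [mem_ball] at hz
    exact hder z (mem_ball.2 (by linarith)) t ⟨by linarith [ht.1], by linarith [ht.2]⟩
  · intro z hz t ht a b W ha hb htab ha' hb' hW hWt
    rw [mem_ball] at hz
    have hzε : z ∈ ball z₀ ε := mem_ball.2 (by linarith)
    have hφz : (φ (t, z), w₀) ∈ ball (z₀, w₀) ε := hball _
      (hδ' t z (abs_lt.2 ⟨by linarith [ht.1], by linarith [ht.2]⟩) (by linarith))
    have h1 : IsODESolution Z (fun r => (φ (r, z), W r)) a b := fun r hr =>
      (hder z hzε r ⟨by linarith [hr.1], by linarith [hr.2]⟩).hasDerivWithinAt.prodMk (hW r hr)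
    have h2 : IsODESolution Z (fun r => Φ (r - t, (φ (t, z), w₀))) a b := fun r hr => by
      have h3 := (H _ hφz).2 (r - t)
        ⟨by linarith [hr.1, ht.2], by linarith [hr.2, ht.1]⟩
      exact (HasDerivAt.comp_sub_const r t h3).hasDerivWithinAt
    have h3 : (φ (t, z), W t) = Φ (t - t, (φ (t, z), w₀)) := by
      rw [sub_self, (H _ hφz).1, hWt]
    have h4 := h1.eqOn hZ1 h2 htab h3 ⟨ha, hb⟩
    have h5 := congrArg Prod.snd h4
    simpa [S] using h5

/-- The conclusion of the local analysis at a boundary point `z₀` of the half-space `ℓ ≥ 0`: near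
`z₀`, the orbits of `Y` in the half-space are followed up to an end on the boundary, at which a
transported vector equals `w₀`, and the transported vectors then form a function of class `C^k`. -/
def HasRegularTransport (Y : F → F) (N : F → V →L[ℝ] V) (w₀ : V) (ℓ : F →L[ℝ] ℝ) (z₀ : F) (k : ℕ) :
    Prop :=
  ∃ U : F → V, ContDiffWithinAt ℝ k U {z | 0 ≤ ℓ z} z₀ ∧ ∀ O ∈ 𝓝 z₀, ∀ᶠ z in 𝓝 z₀, 0 ≤ ℓ z →
    ∃ (a b : ℝ) (c : ℝ → F), a ≤ 0 ∧ 0 ≤ b ∧ c 0 = z ∧ IsODESolution Y c a b ∧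
      (∀ t ∈ Icc a b, c t ∈ O ∧ 0 ≤ ℓ (c t)) ∧
      ∀ W, IsTransport N c W a b → (ℓ (c a) = 0 → W a = w₀) → (ℓ (c b) = 0 → W b = w₀) → W 0 = U z

/-- At a boundary point where `Y` is transversal to the boundary, the hitting time is smooth. -/
theorem hasRegularTransport_of_transversal {k : ℕ} (hk : k ≠ 0) {Y : F → F} (hY : ContDiff ℝ k Y)
    {N : F → V →L[ℝ] V} (hN : ContDiff ℝ k N) (w₀ : V) {ℓ : F →L[ℝ] ℝ} {z₀ : F} (h0 : ℓ z₀ = 0)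
    (h1 : ℓ (Y z₀) ≠ 0) : HasRegularTransport Y N w₀ ℓ z₀ k := by
  obtain ⟨L⟩ := exists_localTransport hk hY hN w₀ z₀
  have hk' : (k : ℕ∞ω) ≠ 0 := by exact_mod_cast hk
  have : CompleteSpace F := FiniteDimensional.complete ℝ _
  let f : ℝ × F → ℝ := fun y => ℓ (L.φ y)
  have hf : ContDiffAt ℝ k f (0, z₀) := ℓ.contDiff.contDiffAt.comp _ L.contDiffAt_φ
  have hφ0 : L.φ (0, z₀) = z₀ := L.φ_zero z₀ (mem_ball_self L.ε_pos)
  have hf0 : f (0, z₀) = 0 := by simp only [f, hφ0, h0]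
  have hder : fderiv ℝ f (0, z₀) (1, 0) = ℓ (Y z₀) := by
    have e1 := hasDerivAt_fst_of_differentiableAt (hf.differentiableAt hk')
    have e2 := L.hasDerivAt_normal ℓ (mem_ball_self L.ε_pos)
      (t := 0) ⟨neg_lt_zero.2 L.ε_pos, L.ε_pos⟩
    rw [hφ0] at e2
    exact e1.unique e2
  obtain ⟨σ, hσ, hσ0, hfσ, -⟩ := exists_inverse_fst hk hf (hder ▸ h1)
  rw [hf0] at hσ hσ0 hfσ
  let τ : F → ℝ := fun z => σ (0, z)
  have hτ : ContDiffAt ℝ k τ z₀ := hσ.comp z₀ (contDiffAt_const.prodMk contDiffAt_id)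
  have hτ0 : τ z₀ = 0 := hσ0
  have hτt : Tendsto τ (𝓝 z₀) (𝓝 0) := hτ0 ▸ hτ.continuousAt
  refine ⟨fun z => L.S (τ z, z), ?_, fun O hO => ?_⟩
  · have e1 : ContDiffAt ℝ k (fun z => (τ z, z)) z₀ := hτ.prodMk contDiffAt_id
    have e2 : ContDiffAt ℝ k L.S ((fun z => (τ z, z)) z₀) := by
      simp only [hτ0]; exact L.contDiffAt_S
    exact (ContDiffAt.comp (f := fun z => (τ z, z)) (g := L.S) z₀ e2 e1).contDiffWithinAt
  -- a box on which the normal velocity has a constant sign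
  have hsign : ∀ᶠ y in 𝓝 ((0 : ℝ), z₀), 0 < ℓ (Y z₀) * ℓ (Y (L.φ y)) ∧ L.φ y ∈ O := by
    have e1 : ContinuousAt (fun y => ℓ (Y z₀) * ℓ (Y (L.φ y))) (0, z₀) :=
      continuousAt_const.mul (ℓ.continuous.continuousAt.comp
        (hY.continuous.continuousAt.comp L.contDiffAt_φ.continuousAt))
    refine (e1.eventually (lt_mem_nhds ?_)).and (L.contDiffAt_φ.continuousAt.eventually ?_)
    · simp only [hφ0]; exact mul_self_pos.2 h1
    · rw [hφ0]; exact hO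
  obtain ⟨δ, hδ, hbox⟩ := exists_box hsign
  have hσz : ∀ᶠ z in 𝓝 z₀, f (τ z, z) = 0 := by
    have e1 : Tendsto (fun z : F => ((0 : ℝ), z)) (𝓝 z₀) (𝓝 (0, z₀)) :=
      (continuous_const.prodMk continuous_id).continuousAt
    exact e1.eventually hfσ
  filter_upwards [hσz, hτt.eventually (ball_mem_nhds 0 (lt_min hδ L.ε_pos)),
    ball_mem_nhds z₀ (lt_min hδ L.ε_pos)] with z hz hτz hzb hℓz
  simp only [mem_ball, lt_min_iff, Real.dist_eq, sub_zero] at hτz hzb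
  have hzε : z ∈ ball z₀ L.ε := hzb.2
  have hmem : ∀ t ∈ uIcc 0 (τ z), |t| < δ ∧ t ∈ Ioo (-L.ε) L.ε := fun t ht => by
    have : |t| ≤ |τ z| := by
      rcases abs_cases (τ z) with ⟨e1, e2⟩ | ⟨e1, e2⟩
      · rw [uIcc_of_le e2] at ht
        rw [e1, abs_of_nonneg ht.1]; exact ht.2
      · rw [uIcc_of_ge e2.le] at ht
        rw [e1, abs_of_nonpos ht.2]; linarith [ht.1]
    exact ⟨this.trans_lt hτz.1, abs_lt.1 (this.trans_lt hτz.2)⟩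
  have hnonneg : ∀ t ∈ uIcc 0 (τ z), 0 ≤ ℓ (L.φ (t, z)) := by
    have hcont : ContinuousOn (fun t => ℓ (L.φ (t, z))) (uIcc 0 (τ z)) := fun t ht =>
      (L.hasDerivAt_normal ℓ hzε (hmem t ht).2).continuousAt.continuousWithinAt
    have hmono : MonotoneOn (fun t => ℓ (L.φ (t, z))) (uIcc 0 (τ z)) ∨
        AntitoneOn (fun t => ℓ (L.φ (t, z))) (uIcc 0 (τ z)) := by
      rcases h1.lt_or_gt with hlt | hlt
      · right
        refine antitoneOn_of_deriv_nonpos (convex_uIcc _ _) hcont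
          (fun t ht => (L.hasDerivAt_normal ℓ hzε
            (hmem t (interior_subset ht)).2).differentiableAt.differentiableWithinAt)
          (fun t ht => ?_)
        rw [(L.hasDerivAt_normal ℓ hzε (hmem t (interior_subset ht)).2).deriv]
        have := (hbox t z (hmem t (interior_subset ht)).1 hzb.1).1
        exact (neg_of_mul_pos_right this hlt.le).le
      · left
        refine monotoneOn_of_deriv_nonneg (convex_uIcc _ _) hcont
          (fun t ht => (L.hasDerivAt_normal ℓ hzε
            (hmem t (interior_subset ht)).2).differentiableAt.differentiableWithinAt)
          (fun t ht => ?_)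
        rw [(L.hasDerivAt_normal ℓ hzε (hmem t (interior_subset ht)).2).deriv]
        have := (hbox t z (hmem t (interior_subset ht)).1 hzb.1).1
        exact (pos_of_mul_pos_right this hlt.le).le
    have hends : ℓ (L.φ (0, z)) = ℓ z := by rw [L.φ_zero z hzε]
    intro t ht
    have hz' : ℓ (L.φ (τ z, z)) = 0 := hz
    have hin : ℓ (L.φ (t, z)) ∈ uIcc (ℓ (L.φ (0, z))) (ℓ (L.φ (τ z, z))) := by
      rcases hmono with hm | hm
      · rcases le_total 0 (τ z) with e | e
        · rw [uIcc_of_le e] at ht hm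
          exact mem_uIcc.2 (Or.inl ⟨hm (left_mem_Icc.2 e) ht ht.1, hm ht (right_mem_Icc.2 e) ht.2⟩)
        · rw [uIcc_of_ge e] at ht hm
          exact mem_uIcc.2 (Or.inr ⟨hm (left_mem_Icc.2 e) ht ht.1, hm ht (right_mem_Icc.2 e) ht.2⟩)
      · rcases le_total 0 (τ z) with e | e
        · rw [uIcc_of_le e] at ht hm
          exact mem_uIcc.2 (Or.inr ⟨hm ht (right_mem_Icc.2 e) ht.2, hm (left_mem_Icc.2 e) ht ht.1⟩)
        · rw [uIcc_of_ge e] at ht hm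
          exact mem_uIcc.2 (Or.inl ⟨hm ht (right_mem_Icc.2 e) ht.2, hm (left_mem_Icc.2 e) ht ht.1⟩)
    rw [hends, hz', uIcc_of_ge hℓz] at hin
    exact hin.1
  refine ⟨min 0 (τ z), max 0 (τ z), fun t => L.φ (t, z), min_le_left _ _, le_max_left _ _,
    L.φ_zero z hzε, fun t ht => (L.hasDerivAt_φ z hzε t (hmem t ht).2).hasDerivWithinAt,
    fun t ht => ⟨(hbox t z (hmem t ht).1 hzb.1).2, hnonneg t ht⟩, fun W hW hWa hWb => ?_⟩
  refine L.eq_S z hzε (τ z) (hmem _ right_mem_uIcc).2 _ _ W (min_le_left _ _) (le_max_left _ _)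
    right_mem_uIcc (lt_min (neg_lt_zero.2 L.ε_pos) (hmem _ right_mem_uIcc).2.1)
    (max_lt L.ε_pos (hmem _ right_mem_uIcc).2.2) hW ?_
  have hz' : ℓ (L.φ (τ z, z)) = 0 := hz
  rcases le_total 0 (τ z) with e | e
  · rw [max_eq_right e] at hWb; exact hWb hz'
  · rw [min_eq_right e] at hWa; exact hWa hz'

end

section

variable {F V : Type u} [NormedAddCommGroup F] [NormedSpace ℝ F]
  [NormedAddCommGroup V] [NormedSpace ℝ V]

/-- If `fderiv f (1, 0)` is positive at a point, then `f` is increasing in its first variable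
nearby. -/
lemma exists_strictMonoOn_fst {n : ℕ} (hn : n ≠ 0) {x : ℝ × F → ℝ} {z₀ : F}
    (hx : ContDiffAt ℝ n x (0, z₀)) (h : 0 < fderiv ℝ x (0, z₀) (1, 0)) :
    ∃ δ > 0, ∀ z, dist z z₀ < δ → StrictMonoOn (fun s => x (s, z)) (Ioo (-δ) δ) := by
  have hn' : (n : ℕ∞ω) ≠ 0 := by exact_mod_cast hn
  have hx1 : ContDiffAt ℝ 1 x (0, z₀) :=
    hx.of_le (by exact_mod_cast Nat.one_le_iff_ne_zero.2 hn)
  have h1 : ContinuousAt (fun y => fderiv ℝ x y (1, 0)) (0, z₀) :=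
    ((hx1.fderiv_right (m := 0) (by simp)).continuousAt).clm_apply continuousAt_const
  have h2 : ∀ᶠ y in 𝓝 ((0 : ℝ), z₀), DifferentiableAt ℝ x y :=
    (hx1.eventually (by simp)).mono fun y hy => hy.differentiableAt one_ne_zero
  obtain ⟨δ, hδ, H⟩ := exists_box (h2.and (h1.eventually (lt_mem_nhds h)))
  refine ⟨δ, hδ, fun z hz => ?_⟩
  have hd : ∀ s ∈ Ioo (-δ) δ, HasDerivAt (fun s => x (s, z)) (fderiv ℝ x (s, z) (1, 0)) s :=
    fun s hs => hasDerivAt_fst_of_differentiableAt (H s z (abs_lt.2 hs) hz).1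
  refine strictMonoOn_of_deriv_pos (convex_Ioo _ _)
    (fun s hs => (hd s hs).continuousAt.continuousWithinAt) fun s hs => ?_
  rw [interior_Ioo] at hs
  rw [(hd s hs).deriv]
  exact (H s z (abs_lt.2 hs) hz).2

variable [FiniteDimensional ℝ F] [FiniteDimensional ℝ V]

/-- At a boundary point where `Y` is tangent to the boundary and the orbit bends outwards: the two
hitting times are `T + σ(±√b)` for the maximal height `b` of the orbit, and the two transported
values agree, so that their common value is an even function of `√b`. -/
theorem hasRegularTransport_of_glancing {k m : ℕ} (hm : 2 * k + 3 ≤ m) {Y : F → F}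
    (hY : ContDiff ℝ m Y)
    {N : F → V →L[ℝ] V} (hN : ContDiff ℝ m N) (w₀ : V) {ℓ : F →L[ℝ] ℝ} {z₀ : F} (h0 : ℓ z₀ = 0)
    (h1 : ℓ (Y z₀) = 0) (h2 : ℓ (fderiv ℝ Y z₀ (Y z₀)) < 0) :
    HasRegularTransport Y N w₀ ℓ z₀ k := by
  replace hY : ContDiff ℝ (2 * k + 3 : ℕ) Y := hY.of_le (by exact_mod_cast hm)
  replace hN : ContDiff ℝ (2 * k + 3 : ℕ) N := hN.of_le (by exact_mod_cast hm)
  obtain ⟨L⟩ := exists_localTransport (by omega) hY hN w₀ z₀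
  have hne : ((2 * k + 3 : ℕ) : ℕ∞ω) ≠ 0 := by exact_mod_cast (by omega : 2 * k + 3 ≠ 0)
  have : CompleteSpace F := FiniteDimensional.complete ℝ _
  have : CompleteSpace V := FiniteDimensional.complete ℝ _
  have hφ0 : L.φ (0, z₀) = z₀ := L.φ_zero z₀ (mem_ball_self L.ε_pos)
  let f : ℝ × F → ℝ := fun y => ℓ (L.φ y)
  have hf : ContDiffAt ℝ (2 * k + 3 : ℕ) f (0, z₀) := ℓ.contDiff.contDiffAt.comp _ L.contDiffAt_φ
  let g : ℝ × F → ℝ := fun y => ℓ (Y (L.φ y))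
  have hg : ContDiffAt ℝ (2 * k + 3 : ℕ) g (0, z₀) :=
    ℓ.contDiff.contDiffAt.comp _ (hY.contDiffAt.comp _ L.contDiffAt_φ)
  have hfg : ∀ z ∈ ball z₀ L.ε, ∀ t ∈ Ioo (-L.ε) L.ε, HasDerivAt (fun t => f (t, z)) (g (t, z)) t :=
    fun z hz t ht => L.hasDerivAt_normal ℓ hz ht
  have hg0 : g (0, z₀) = 0 := by simp only [g, hφ0, h1]
  have hgder : fderiv ℝ g (0, z₀) (1, 0) = ℓ (fderiv ℝ Y z₀ (Y z₀)) := by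
    have e1 := hasDerivAt_fst_of_differentiableAt (hg.differentiableAt hne)
    have e2 := L.hasDerivAt_φ z₀ (mem_ball_self L.ε_pos) 0 ⟨neg_lt_zero.2 L.ε_pos, L.ε_pos⟩
    have e3 := ℓ.hasFDerivAt.comp_hasDerivAt 0
      ((hY.differentiable hne (L.φ (0, z₀))).hasFDerivAt.comp_hasDerivAt 0 e2)
    rw [hφ0] at e3
    exact e1.unique e3
  -- the time `T` of maximal height
  obtain ⟨σ₁, hσ₁, hσ₁0, hgσ₁, -⟩ := exists_inverse_fst (by omega) hg (by rw [hgder]; exact h2.ne)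
  rw [hg0] at hσ₁ hσ₁0 hgσ₁
  let T : F → ℝ := fun z => σ₁ (0, z)
  have hT : ContDiffAt ℝ (2 * k + 3 : ℕ) T z₀ := hσ₁.comp z₀ (contDiffAt_const.prodMk contDiffAt_id)
  have hT0 : T z₀ = 0 := hσ₁0
  have hgT : ∀ᶠ z in 𝓝 z₀, g (T z, z) = 0 :=
    ((continuous_const.prodMk continuous_id).continuousAt
      (x := z₀) (f := fun z : F => ((0 : ℝ), z))).eventually hgσ₁
  let A : ℝ × F → ℝ × F := fun y => (T y.2 + y.1, y.2)
  have hA : ContDiffAt ℝ (2 * k + 3 : ℕ) A (0, z₀) :=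
    ((ContDiffAt.comp (0, z₀) hT contDiffAt_snd).add contDiffAt_fst).prodMk contDiffAt_snd
  have hA0 : A (0, z₀) = (0, z₀) := by simp [A, hT0]
  have hAt : Tendsto A (𝓝 (0, z₀)) (𝓝 (0, z₀)) := by
    have := hA.continuousAt.tendsto
    rwa [hA0] at this
  obtain ⟨h, hh, hhf⟩ := exists_contDiff_eventuallyEq
    (ContDiffAt.comp (0, z₀) (f := A) (g := f) (hA0.symm ▸ hf) hA)
  have hhder : (fun y => fderiv ℝ h y (1, 0)) =ᶠ[𝓝 (0, z₀)] fun y => g (A y) := by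
    have e1 : ∀ᶠ y in 𝓝 ((0 : ℝ), z₀), A y ∈ Ioo (-L.ε) L.ε ×ˢ ball z₀ L.ε :=
      hAt.eventually (prod_mem_nhds (Ioo_mem_nhds (neg_lt_zero.2 L.ε_pos) L.ε_pos)
        (ball_mem_nhds _ L.ε_pos))
    filter_upwards [e1, hhf.eventually_nhds] with y hy hy2
    have e2 := hasDerivAt_fst_of_differentiableAt (t := y.1) (z := y.2)
      (hh.differentiable hne y)
    have e3 : HasDerivAt (fun s => f (T y.2 + s, y.2)) (g (A y)) y.1 :=
      (hfg y.2 hy.2 _ hy.1).comp_const_add (T y.2) y.1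
    have e4 : (fun s => h (s, y.2)) =ᶠ[𝓝 y.1] fun s => f (T y.2 + s, y.2) :=
      ((continuous_id.prodMk continuous_const).continuousAt
        (f := fun s : ℝ => (s, y.2)) (x := y.1)).eventually hy2
    exact e2.unique (e3.congr_of_eventuallyEq e4)
  have hcrit : ∀ᶠ z in 𝓝 z₀, fderiv ℝ h (0, z) (1, 0) = 0 := by
    have e1 := ((continuous_const.prodMk continuous_id).continuousAt
      (x := z₀) (f := fun z : F => ((0 : ℝ), z))).eventually hhder
    filter_upwards [e1, hgT] with z hz hz2
    have hz' : fderiv ℝ h (0, z) (1, 0) = g (A (0, z)) := hz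
    rw [hz']
    simpa [A] using hz2
  have hneg : fderiv ℝ (fun y => fderiv ℝ h y (1, 0)) (0, z₀) (1, 0) < 0 := by
    rw [hhder.fderiv_eq]
    have e1 : HasDerivAt (fun s => g (T z₀ + s, z₀)) (fderiv ℝ g (0, z₀) (1, 0)) 0 := by
      have e2 := hasDerivAt_fst_of_differentiableAt (hg.differentiableAt hne)
      refine HasDerivAt.comp_const_add (f := fun s => g (s, z₀)) (T z₀) 0 ?_
      rwa [hT0, add_zero]
    have e3 : DifferentiableAt ℝ (fun y => g (A y)) (0, z₀) :=
      DifferentiableAt.comp (g := g) (0, z₀) (by rw [hA0]; exact hg.differentiableAt hne)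
        (hA.differentiableAt hne)
    have e4 := hasDerivAt_fst_of_differentiableAt e3
    rw [e4.unique e1, hgder]
    exact h2
  obtain ⟨x, hx, hx0, hxpos, hxh⟩ := exists_morse_coordinate (n := 2 * k + 1) (by omega) hh hcrit
    hneg
  obtain ⟨σ, hσ, hσ0, hxσ, -⟩ := exists_inverse_fst (by omega) hx hxpos.ne'
  rw [hx0] at hσ hσ0 hxσ
  let b : F → ℝ := fun z => h (0, z)
  have hb : ContDiff ℝ (2 * k + 3 : ℕ) b := hh.comp (contDiff_const.prodMk contDiff_id)
  have hb0 : b z₀ = 0 := by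
    have := hhf.self_of_nhds
    rw [Function.comp_apply, hA0] at this
    simp only [b, this, f, hφ0, h0]
  -- the transported value, as a function of the coordinate `y = ±√b`
  let t' : ℝ × F → ℝ := fun y => T y.2 + σ y
  have ht' : ContDiffAt ℝ (2 * k + 1 : ℕ) t' (0, z₀) := by
    have e1 : ContDiffAt ℝ (2 * k + 1 : ℕ) (fun y : ℝ × F => T y.2) (0, z₀) :=
      ContDiffAt.of_le (ContDiffAt.comp (0, z₀) (g := T) hT contDiffAt_snd) (by norm_cast; omega)
    exact e1.add hσ
  have ht'0 : t' (0, z₀) = 0 := by simp [t', hT0, hσ0]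
  have hQ0 : ContDiffAt ℝ (2 * k + 1 : ℕ) (fun y => L.S (t' y, y.2)) (0, z₀) :=
    ContDiffAt.comp (0, z₀) (g := L.S) (f := fun y : ℝ × F => (t' y, y.2))
      (by simp only [ht'0]; exact L.contDiffAt_S.of_le (by norm_cast; omega))
      (ht'.prodMk contDiffAt_snd)
  obtain ⟨Q, hQ, hQS⟩ := exists_contDiff_eventuallyEq hQ0
  let E : ℝ × F → V := fun y => (2⁻¹ : ℝ) • (Q y + Q (reflectFst F y))
  have hE : ContDiff ℝ (2 * k : ℕ) E :=
    (contDiff_const.smul (hQ.add (hQ.comp (reflectFst F).contDiff))).of_le (by norm_cast; omega)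
  have hEeven : ∀ y, E (reflectFst F y) = E y := by
    rintro ⟨y, z⟩
    simp only [E, reflectFst_apply, neg_neg]
    rw [add_comm]
  have hEsqrt := contDiffOn_comp_sqrt k hE hEeven
  -- the maximal height is at least the height
  have hbℓ : ∀ᶠ z in 𝓝 z₀, b z - x (-T z, z) ^ 2 = ℓ z := by
    have e0 : Tendsto (fun z => (-T z, z)) (𝓝 z₀) (𝓝 (0, z₀)) := by
      have : ContinuousAt (fun z => (-T z, z)) z₀ := hT.continuousAt.neg.prodMk continuousAt_id
      simpa [ContinuousAt, hT0] using this
    filter_upwards [e0.eventually hhf, e0.eventually hxh, ball_mem_nhds z₀ L.ε_pos] with z e1 e2 e3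
    rw [← e2, e1]
    simp [A, f, L.φ_zero z e3]
  refine ⟨fun z => E (√(b z), z), ?_, fun O hO => ?_⟩
  · have e1 : ContDiffWithinAt ℝ k (fun z => E (√(b z), z)) {z | 0 ≤ b z} z₀ := by
      refine ContDiffWithinAt.comp (g := fun y : ℝ × F => E (√y.1, y.2)) (f := fun z => (b z, z))
        (t := Ici (0 : ℝ) ×ˢ univ) z₀ (hEsqrt _ ⟨hb0.ge, mem_univ _⟩) ?_
        (fun z hz => ⟨hz, mem_univ _⟩)
      exact ((hb.of_le (by norm_cast; omega)).prodMk contDiff_id).contDiffWithinAt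
    refine e1.mono_of_mem_nhdsWithin ?_
    filter_upwards [nhdsWithin_le_nhds hbℓ, self_mem_nhdsWithin] with z e2 e3
    have e4 : 0 ≤ ℓ z := e3
    have := sq_nonneg (x (-T z, z))
    change 0 ≤ b z
    linarith
  obtain ⟨δ₁, hδ₁, hmono⟩ := exists_strictMonoOn_fst (by omega) hx hxpos
  obtain ⟨δ₂, hδ₂, hbox⟩ := exists_box (hxh.and hhf)
  obtain ⟨δ₃, hδ₃, hbox'⟩ := exists_box (L.contDiffAt_φ.continuousAt.eventually
    (show O ∈ 𝓝 (L.φ (0, z₀)) by rw [hφ0]; exact hO))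
  set δ := min (min δ₁ δ₂) (min δ₃ L.ε) with hδdef
  have hδ : 0 < δ := lt_min (lt_min hδ₁ hδ₂) (lt_min hδ₃ L.ε_pos)
  have hle1 : δ ≤ δ₁ := (min_le_left _ _).trans (min_le_left _ _)
  have hle2 : δ ≤ δ₂ := (min_le_left _ _).trans (min_le_right _ _)
  have hle3 : δ ≤ δ₃ := (min_le_right _ _).trans (min_le_left _ _)
  have hle4 : δ ≤ L.ε := (min_le_right _ _).trans (min_le_right _ _)
  have hTt : Tendsto T (𝓝 z₀) (𝓝 0) := hT0 ▸ hT.continuousAt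
  have hsq : Tendsto (fun z => √(b z)) (𝓝 z₀) (𝓝 0) := by
    have : ContinuousAt (fun z => √(b z)) z₀ := hb.continuous.continuousAt.sqrt
    simpa [ContinuousAt, hb0] using this
  have hp : Tendsto (fun z => (√(b z), z)) (𝓝 z₀) (𝓝 (0, z₀)) := hsq.prodMk_nhds tendsto_id
  have hmn : Tendsto (fun z => (-√(b z), z)) (𝓝 z₀) (𝓝 (0, z₀)) := by
    have := hsq.neg.prodMk_nhds (tendsto_id (x := 𝓝 z₀))
    simpa using this
  have hσt : Tendsto σ (𝓝 (0, z₀)) (𝓝 0) := by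
    have := hσ.continuousAt.tendsto
    rwa [hσ0] at this
  have hsmall := ball_mem_nhds (0 : ℝ) (half_pos hδ)
  filter_upwards [hbℓ, hTt.eventually hsmall, hp.eventually (hσt.eventually hsmall),
    hmn.eventually (hσt.eventually hsmall), hp.eventually hxσ, hmn.eventually hxσ,
    hp.eventually hQS, hmn.eventually hQS, ball_mem_nhds z₀ hδ]
    with z hbz hTz hσp hσm hxp hxm hQp hQm hz hℓz
  simp only [mem_ball, Real.dist_eq, sub_zero] at hTz hσp hσm hz
  rw [abs_lt] at hTz hσp hσm
  have hzε : z ∈ ball z₀ L.ε := mem_ball.2 (hz.trans_le hle4)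
  set s₁ := σ (-√(b z), z)
  set s₂ := σ (√(b z), z)
  have hmz := hmono z (hz.trans_le hle1)
  have hb_nonneg : 0 ≤ b z := by nlinarith [sq_nonneg (x (-T z, z))]
  have hroot : |x (-T z, z)| ≤ √(b z) := Real.abs_le_sqrt (by linarith)
  rw [abs_le] at hroot
  have mem : ∀ {s}, -(δ / 2) < s → s < δ / 2 → s ∈ Ioo (-δ₁) δ₁ := fun h h' =>
    ⟨by linarith, by linarith⟩
  have hs₁ : s₁ ≤ -T z := by
    refine (hmz.le_iff_le (mem hσm.1 hσm.2) (mem (by linarith) (by linarith))).1 ?_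
    change x (s₁, z) ≤ x (-T z, z)
    rw [hxm]; exact hroot.1
  have hs₂ : -T z ≤ s₂ := by
    refine (hmz.le_iff_le (mem (by linarith) (by linarith)) (mem hσp.1 hσp.2)).1 ?_
    change x (-T z, z) ≤ x (s₂, z)
    rw [hxp]; exact hroot.2
  have htime : ∀ t ∈ Icc (T z + s₁) (T z + s₂), |t| < δ := fun t ht =>
    abs_lt.2 ⟨by linarith [ht.1], by linarith [ht.2]⟩
  have htimeε : ∀ t ∈ Icc (T z + s₁) (T z + s₂), t ∈ Ioo (-L.ε) L.ε := fun t ht =>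
    abs_lt.1 ((htime t ht).trans_le hle4)
  have hheight : ∀ t ∈ Icc (T z + s₁) (T z + s₂), ℓ (L.φ (t, z)) = b z - x (t - T z, z) ^ 2 := by
    intro t ht
    have e1 : |t - T z| < δ₂ := abs_lt.2 ⟨by linarith [ht.1], by linarith [ht.2]⟩
    obtain ⟨e2, e3⟩ := hbox (t - T z) z e1 (hz.trans_le hle2)
    rw [← e2, e3]
    simp [A, f]
  have hle : T z + s₁ ≤ T z + s₂ := by linarith
  have hend₁ : ℓ (L.φ (T z + s₁, z)) = 0 := by
    rw [hheight _ (left_mem_Icc.2 hle), add_sub_cancel_left, hxm, neg_sq, Real.sq_sqrt hb_nonneg,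
      sub_self]
  have hend₂ : ℓ (L.φ (T z + s₂, z)) = 0 := by
    rw [hheight _ (right_mem_Icc.2 hle), add_sub_cancel_left, hxp, Real.sq_sqrt hb_nonneg,
      sub_self]
  refine ⟨T z + s₁, T z + s₂, fun t => L.φ (t, z), by linarith, by linarith, L.φ_zero z hzε,
    fun t ht => (L.hasDerivAt_φ z hzε t (htimeε t ht)).hasDerivWithinAt, fun t ht => ⟨?_, ?_⟩,
    fun W hW hWa hWb => ?_⟩
  · exact hbox' t z ((htime t ht).trans_le hle3) (hz.trans_le hle3)
  · rw [hheight t ht]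
    have e1 : t - T z ∈ Ioo (-δ₁) δ₁ := mem (by linarith [ht.1]) (by linarith [ht.2])
    have e2 := (hmz.le_iff_le (mem hσm.1 hσm.2) e1).2 (by linarith [ht.1])
    have e3 := (hmz.le_iff_le e1 (mem hσp.1 hσp.2)).2 (by linarith [ht.2])
    change x (s₁, z) ≤ x (t - T z, z) at e2
    change x (t - T z, z) ≤ x (s₂, z) at e3
    rw [hxm] at e2
    rw [hxp] at e3
    have := sq_le_sq' e2 e3
    rw [Real.sq_sqrt hb_nonneg] at this
    linarith
  · have e1 := L.eq_S z hzε _ (htimeε _ (left_mem_Icc.2 hle)) _ _ W (by linarith) (by linarith)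
      (left_mem_Icc.2 hle) (htimeε _ (left_mem_Icc.2 hle)).1 (htimeε _ (right_mem_Icc.2 hle)).2 hW
      (hWa hend₁)
    have e2 := L.eq_S z hzε _ (htimeε _ (right_mem_Icc.2 hle)) _ _ W (by linarith) (by linarith)
      (right_mem_Icc.2 hle) (htimeε _ (left_mem_Icc.2 hle)).1 (htimeε _ (right_mem_Icc.2 hle)).2 hW
      (hWb hend₂)
    change W 0 = (2⁻¹ : ℝ) • (Q (√(b z), z) + Q (-√(b z), z))
    rw [hQp, hQm]
    change W 0 = (2⁻¹ : ℝ) • (L.S (T z + s₂, z) + L.S (T z + s₁, z))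
    rw [← e1, ← e2, ← two_smul ℝ, smul_smul]
    norm_num

end

/-! ### Linear differential equations -/

section

variable {V : Type*} [NormedAddCommGroup V] [NormedSpace ℝ V]

/-- Two derivatives within adjacent intervals give a derivative within their union. -/
lemma HasDerivWithinAt.union_Icc {f : ℝ → V} {f' : V} {a b c t : ℝ} (hab : a ≤ b) (hbc : b ≤ c)
    (h1 : t ∈ Icc a b → HasDerivWithinAt f f' (Icc a b) t)
    (h2 : t ∈ Icc b c → HasDerivWithinAt f f' (Icc b c) t) (ht : t ∈ Icc a c) :
    HasDerivWithinAt f f' (Icc a c) t := by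
  rcases lt_trichotomy t b with h | h | h
  · refine (h1 ⟨ht.1, h.le⟩).mono_of_mem_nhdsWithin ?_
    filter_upwards [self_mem_nhdsWithin, nhdsWithin_le_nhds (Iio_mem_nhds h)] with s hs hs'
    exact ⟨hs.1, le_of_lt hs'⟩
  · rw [← Icc_union_Icc_eq_Icc hab hbc]
    exact (h1 ⟨ht.1, h.le⟩).union (h2 ⟨h.ge, ht.2⟩)
  · refine (h2 ⟨h.le, ht.2⟩).mono_of_mem_nhdsWithin ?_
    filter_upwards [self_mem_nhdsWithin, nhdsWithin_le_nhds (Ioi_mem_nhds h)] with s hs hs'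
    exact ⟨le_of_lt hs', hs.2⟩

/-- Short time solvability of a linear equation, with a time of existence which does not depend on
the initial value. -/
lemma exists_linear_solution_short [CompleteSpace V] {N : ℝ → V →L[ℝ] V} {a b K : ℝ}
    (hab : a ≤ b) (hN : ContinuousOn N (Icc a b)) (hK : ∀ t ∈ Icc a b, ‖N t‖ ≤ K) (hK0 : 0 ≤ K)
    (h : (2 * K + 1) * (b - a) ≤ 1) (w : V) :
    ∃ W : ℝ → V, W b = w ∧ ∀ t ∈ Icc a b, HasDerivWithinAt W (N t (W t)) (Icc a b) t := by
  have hball : ∀ x ∈ closedBall w (‖w‖ + 1), ‖x‖ ≤ 2 * ‖w‖ + 1 := fun x hx => by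
    have h1 : ‖x - w‖ ≤ ‖w‖ + 1 := by simpa [dist_eq_norm] using hx
    have h2 := norm_add_le (x - w) w
    rw [sub_add_cancel] at h2
    linarith
  have hw := norm_nonneg w
  have hP : IsPicardLindelof (fun t x => N t x) (tmin := a) (tmax := b) ⟨b, right_mem_Icc.2 hab⟩ w
      ⟨‖w‖ + 1, by linarith⟩ 0 ⟨K * (2 * ‖w‖ + 1), by positivity⟩ ⟨K, hK0⟩ := by
    refine ⟨fun t ht => ?_, fun x _ => hN.clm_apply continuousOn_const, fun t ht x hx => ?_, ?_⟩
    · exact ((N t).lipschitz.weaken (show ‖N t‖₊ ≤ _ from hK t ht)).lipschitzOnWith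
    · exact ((N t).le_opNorm x).trans
        (mul_le_mul (hK t ht) (hball x hx) (norm_nonneg _) hK0)
    · change K * (2 * ‖w‖ + 1) * max (b - b) (b - a) ≤ ‖w‖ + 1 - 0
      rw [sub_self, max_eq_right (sub_nonneg.2 hab)]
      nlinarith [mul_nonneg hw (sub_nonneg.2 hab), mul_nonneg hK0 (sub_nonneg.2 hab)]
  obtain ⟨W, hW, hW'⟩ := hP.exists_eq_forall_mem_Icc_hasDerivWithinAt₀
  exact ⟨W, hW, hW'⟩

/-- A linear equation with continuous coefficients has solutions with any final value. -/
theorem exists_linear_solution [CompleteSpace V] {N : ℝ → V →L[ℝ] V} {a b : ℝ}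
    (hab : a ≤ b) (hN : ContinuousOn N (Icc a b)) (w : V) :
    ∃ W : ℝ → V, W b = w ∧ ∀ t ∈ Icc a b, HasDerivWithinAt W (N t (W t)) (Icc a b) t := by
  obtain ⟨K, hK⟩ := isCompact_Icc.exists_bound_of_continuousOn hN
  have hK0 : 0 ≤ K := (norm_nonneg _).trans (hK a (left_mem_Icc.2 hab))
  set δ := (2 * K + 1)⁻¹ with hδ
  have hδ0 : 0 < δ := by positivity
  have step : ∀ (n : ℕ) (c : ℝ), a ≤ c → c ≤ b → c - a ≤ n * δ → ∀ w : V,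
      ∃ W : ℝ → V, W c = w ∧ ∀ t ∈ Icc a c, HasDerivWithinAt W (N t (W t)) (Icc a c) t := by
    intro n
    induction n with
    | zero =>
      intro c h1 h2 h3 w
      obtain rfl : c = a := le_antisymm (by simpa using h3) h1
      refine exists_linear_solution_short le_rfl (hN.mono (Icc_subset_Icc le_rfl h2))
        (fun t ht => hK t (Icc_subset_Icc le_rfl h2 ht)) hK0 (by simp) w
    | succ n ih =>
      intro c h1 h2 h3 w
      have h4 : a ≤ max a (c - δ) := le_max_left _ _
      have h5 : max a (c - δ) ≤ c := max_le h1 (by linarith)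
      have hsub : Icc (max a (c - δ)) c ⊆ Icc a b := Icc_subset_Icc h4 h2
      obtain ⟨W₁, hW₁, hW₁'⟩ := exists_linear_solution_short h5 (hN.mono hsub)
        (fun t ht => hK t (hsub ht)) hK0 (by
          have : c - max a (c - δ) ≤ δ := by linarith [le_max_right a (c - δ)]
          calc (2 * K + 1) * (c - max a (c - δ)) ≤ (2 * K + 1) * δ := by gcongr
            _ = 1 := by rw [hδ]; field_simp) w
      obtain ⟨W₂, hW₂, hW₂'⟩ := ih (max a (c - δ)) h4 (h5.trans h2) (by
        rcases max_choice a (c - δ) with h | h <;> rw [h]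
        · rw [sub_self]; positivity
        · push_cast at h3; linarith) (W₁ (max a (c - δ)))
      set e := max a (c - δ)
      refine ⟨fun t => if t ≤ e then W₂ t else W₁ t, ?_, fun t ht => ?_⟩
      · by_cases h : c ≤ e
        · have : e = c := le_antisymm h5 h
          simp only [if_pos h]
          rw [← this, hW₂, this, hW₁]
        · simp only [if_neg h, hW₁]
      have g2 : EqOn (fun t => if t ≤ e then W₂ t else W₁ t) W₂ (Icc a e) := fun s hs => if_pos hs.2
      have g1 : EqOn (fun t => if t ≤ e then W₂ t else W₁ t) W₁ (Icc e c) := fun s hs => by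
        rcases hs.1.eq_or_lt with h | h
        · simp only [← h, le_refl, if_true, hW₂]
        · exact if_neg (not_le.2 h)
      refine HasDerivWithinAt.union_Icc h4 h5 (fun h => ?_) (fun h => ?_) ht
      · rw [g2 h]
        exact (hW₂' t h).congr g2 (g2 h)
      · rw [g1 h]
        exact (hW₁' t h).congr g1 (g1 h)
  obtain ⟨n, hn⟩ := exists_nat_ge ((b - a) / δ)
  exact step n b hab le_rfl ((div_le_iff₀ hδ0).1 hn) w

end

/-! ### Propagation of smoothness along a flow -/

section

variable {F V : Type u} [NormedAddCommGroup F] [NormedSpace ℝ F]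
  [NormedAddCommGroup V] [NormedSpace ℝ V] [FiniteDimensional ℝ F] [FiniteDimensional ℝ V]

/-- If `U` is transported along the flow of `Y` on an invariant set `S`, then the smoothness of `U`
(as a function on `S`) propagates along the orbits of `Y`. -/
theorem exists_flow_contDiffWithinAt_iff {m : ℕ} (hm : m ≠ 0) {Y : F → F} (hY : ContDiff ℝ m Y)
    {N : F → V →L[ℝ] V} (hN : ContDiff ℝ m N) (z₀ : F) :
    ∃ (φ : ℝ × F → F) (ρ : ℝ), 0 < ρ ∧ ContinuousAt φ (0, z₀) ∧
      (∀ z ∈ ball z₀ ρ, φ (0, z) = z ∧ IsODESolution Y (fun t => φ (t, z)) (-ρ) ρ) ∧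
      ∀ (ε : ℝ), 0 < ε → ε ≤ ρ → ∀ (U : F → V) (S : Set F),
        (∀ z ∈ S ∩ ball z₀ ε, (∀ t ∈ Icc (-ε) ε, φ (t, z) ∈ S) ∧
          IsTransport N (fun t => φ (t, z)) (fun t => U (φ (t, z))) (-ε) ε) →
        ∃ δ > 0, δ ≤ ε ∧ (z₀ ∈ S → ∀ t ∈ Ioo (-δ) δ,
          (ContDiffWithinAt ℝ m U S (φ (t, z₀)) ↔ ContDiffWithinAt ℝ m U S z₀)) := by
  let Z : F × V → F × V := fun y => (Y y.1, N y.1 y.2)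
  have hZ : ContDiff ℝ m Z := (hY.comp contDiff_fst).prodMk
    ((hN.comp contDiff_fst).clm_apply contDiff_snd)
  have hm1 : (1 : ℕ∞ω) ≤ m := by exact_mod_cast Nat.one_le_iff_ne_zero.2 hm
  have hZ1 : ContDiff ℝ 1 Z := hZ.of_le hm1
  have : CompleteSpace (F × V) := FiniteDimensional.complete ℝ _
  obtain ⟨Φ, hΦ, ε₀, hε₀, H⟩ := exists_contDiff_localFlow hm hZ (z₀, (0 : V))
  have hball : ∀ z ∈ ball z₀ ε₀, (z, (0 : V)) ∈ ball (z₀, (0 : V)) ε₀ := fun z hz => by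
    rw [mem_ball, Prod.dist_eq, dist_self]
    exact max_lt hz hε₀
  let φ : ℝ × F → F := fun y => (Φ (y.1, (y.2, (0 : V)))).1
  have hΦev : ∀ᶠ y in 𝓝 ((0 : ℝ), (z₀, (0 : V))), ContDiffAt ℝ m Φ y :=
    hΦ.eventually (by simp)
  obtain ⟨ε₁, hε₁, hΦε⟩ := exists_box hΦev
  set ρ := min (ε₀ / 2) (ε₁ / 2) with hρ
  have hρpos : 0 < ρ := lt_min (half_pos hε₀) (half_pos hε₁)
  have hρ0 : ρ ≤ ε₀ / 2 := min_le_left _ _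
  have hρ1 : ρ ≤ ε₁ / 2 := min_le_right _ _
  have hφ0 : ∀ z ∈ ball z₀ ε₀, φ (0, z) = z := fun z hz => congrArg Prod.fst (H _ (hball z hz)).1
  have hφsol : ∀ z ∈ ball z₀ ε₀, ∀ t ∈ Ioo (-ε₀) ε₀,
      HasDerivAt (fun t => φ (t, z)) (Y (φ (t, z))) t := fun z hz t ht =>
    ((H _ (hball z hz)).2 t ht).fst
  have hφC : ∀ t z, |t| < ε₁ → dist z z₀ < ε₁ → ContDiffAt ℝ m φ (t, z) := fun t z ht hz => by
    have h1 : ContDiffAt ℝ m Φ (t, (z, (0 : V))) := hΦε t (z, 0) ht (by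
      rw [Prod.dist_eq, dist_self]; exact max_lt hz hε₁)
    exact contDiffAt_fst.comp _ (ContDiffAt.comp (t, z)
      (f := fun y : ℝ × F => (y.1, (y.2, (0 : V)))) h1 (by fun_prop))
  have hz0φ : φ (0, z₀) = z₀ := hφ0 z₀ (mem_ball_self hε₀)
  have hcont : ContinuousAt φ (0, z₀) := (hφC 0 z₀ (by simpa) (by simpa)).continuousAt
  refine ⟨φ, ρ, hρpos, hcont, fun z hz => ⟨hφ0 z ?_, fun t ht =>
    (hφsol z ?_ t ?_).hasDerivWithinAt⟩,
    ?_⟩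
  · exact ball_subset_ball (by linarith) hz
  · exact ball_subset_ball (by linarith) hz
  · exact ⟨by linarith [ht.1], by linarith [ht.2]⟩
  intro ε hεpos hερ U S hS
  have hle0 : ε ≤ ε₀ / 2 := hερ.trans hρ0
  have hle1 : ε ≤ ε₁ / 2 := hερ.trans hρ1
  obtain ⟨δ₀, hδ₀, hδφ⟩ := exists_box (hcont.eventually
    (show ball z₀ ε ∈ 𝓝 (φ (0, z₀)) by rw [hz0φ]; exact ball_mem_nhds _ hεpos))
  set δ := min δ₀ ε with hδ
  have hδpos : 0 < δ := lt_min hδ₀ hεpos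
  have hleδ : δ ≤ ε := min_le_right _ _
  refine ⟨δ, hδpos, hleδ, fun hz₀S => ?_⟩
  -- smoothness at `φ (t, z)` implies smoothness at `z`
  have key : ∀ z ∈ S ∩ ball z₀ ε, ∀ t ∈ Ioo (-δ) δ, φ (t, z) ∈ ball z₀ ε →
      ContDiffWithinAt ℝ m U S (φ (t, z)) → ContDiffWithinAt ℝ m U S z := by
    rintro z ⟨hzS, hz⟩ t ht htz hU
    have htε : t ∈ Icc (-ε) ε := ⟨by linarith [ht.1], by linarith [ht.2]⟩
    have hzd : dist z z₀ < ε := hz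
    have htzd : dist (φ (t, z)) z₀ < ε := htz
    have hφt : ContDiffAt ℝ m (fun z => φ (t, z)) z :=
      ContDiffAt.comp z (g := φ) (f := fun z => (t, z))
        (hφC t z (abs_lt.2 ⟨by linarith [htε.1], by linarith [htε.2]⟩) (by linarith))
        (contDiffAt_const.prodMk contDiffAt_id)
    have hmaps : ∀ᶠ z' in 𝓝[S] z, z' ∈ S ∩ ball z₀ ε := by
      filter_upwards [self_mem_nhdsWithin, nhdsWithin_le_nhds (isOpen_ball.mem_nhds hz)]
        with z' h1 h2 using ⟨h1, h2⟩
    have hmapsS : ∀ᶠ z' in 𝓝[S] z, φ (t, z') ∈ S := hmaps.mono fun z' hz' => (hS z' hz').1 t htε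
    have hUφ : ContDiffWithinAt ℝ m (fun z => U (φ (t, z))) S z := by
      have h1 := hU.comp_of_preimage_mem_nhdsWithin z hφt.contDiffWithinAt (s := S) hmapsS
      exact h1
    -- the equation is linear: rescale the transported vectors to be small
    obtain ⟨η, hη, hηU⟩ : ∃ η : ℝ, 0 < η ∧ ‖η • U (φ (t, z))‖ < ε := by
      refine ⟨ε / (2 * (‖U (φ (t, z))‖ + 1)), by positivity, ?_⟩
      rw [norm_smul, Real.norm_of_nonneg (by positivity), div_mul_eq_mul_div, div_lt_iff₀
        (by positivity)]
      nlinarith [norm_nonneg (U (φ (t, z)))]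
    have hηev : ∀ᶠ z' in 𝓝[S] z, ‖η • U (φ (t, z'))‖ < ε := by
      have h1 : ContinuousWithinAt (fun z' => ‖η • U (φ (t, z'))‖) S z :=
        (hUφ.continuousWithinAt.const_smul η).norm
      exact h1.eventually (gt_mem_nhds hηU)
    have hφev : ∀ᶠ z' in 𝓝[S] z, φ (t, z') ∈ ball z₀ ε :=
      nhdsWithin_le_nhds (hφt.continuousAt.eventually (isOpen_ball.mem_nhds htz))
    have hformula : ∀ z' ∈ S, z' ∈ ball z₀ ε → φ (t, z') ∈ ball z₀ ε → ‖η • U (φ (t, z'))‖ < ε →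
        U z' = η⁻¹ • (Φ (-t, (φ (t, z'), η • U (φ (t, z'))))).2 := by
      intro z' hz'S hz' hφz' hηz'
      have hb : (φ (t, z'), η • U (φ (t, z'))) ∈ ball (z₀, (0 : V)) ε₀ := by
        rw [mem_ball, Prod.dist_eq, dist_zero_right]
        exact max_lt (by have : dist (φ (t, z')) z₀ < ε := hφz'
                         linarith) (by linarith)
      have h1 : IsODESolution Z (fun r => (φ (r, z'), η • U (φ (r, z')))) (-ε) ε := fun r hr => by
        have h2 := (hS z' ⟨hz'S, hz'⟩).2 r hr
        have h3 := (h2.const_smul η)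
        have h4 := (hφsol z' (ball_subset_ball (by linarith) hz') r
          ⟨by linarith [hr.1], by linarith [hr.2]⟩).hasDerivWithinAt (s := Icc (-ε) ε)
        have h5 := h4.prodMk h3
        simpa [Z] using h5
      have h2 : IsODESolution Z (fun r => Φ (r - t, (φ (t, z'), η • U (φ (t, z'))))) (-ε) ε :=
        fun r hr => (HasDerivAt.comp_sub_const r t ((H _ hb).2 (r - t)
          ⟨by linarith [hr.1, ht.2], by linarith [hr.2, ht.1]⟩)).hasDerivWithinAt
      have h3 := h1.eqOn hZ1 h2 htε (by simp only [sub_self, (H _ hb).1])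
        (show (0 : ℝ) ∈ Icc (-ε) ε from ⟨by linarith, hεpos.le⟩)
      have h4 := congrArg Prod.snd h3
      simp only [zero_sub, hφ0 z' (ball_subset_ball (by linarith) hz')] at h4
      rw [← h4, inv_smul_smul₀ hη.ne']
    have hΦt : ContDiffAt ℝ m Φ (-t, (φ (t, z), η • U (φ (t, z)))) := by
      refine hΦε (-t) _ (by
        rw [abs_neg]; exact abs_lt.2 ⟨by linarith [ht.1], by linarith [ht.2]⟩) ?_
      rw [Prod.dist_eq, dist_zero_right]
      exact max_lt (by linarith) (by linarith)
    have hmain : ContDiffWithinAt ℝ m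
        (fun z' => η⁻¹ • (Φ (-t, (φ (t, z'), η • U (φ (t, z'))))).2) S z := by
      have h1 : ContDiffWithinAt ℝ m (fun z' => (-t, (φ (t, z'), η • U (φ (t, z'))))) S z :=
        contDiffWithinAt_const.prodMk (hφt.contDiffWithinAt.prodMk (hUφ.const_smul η))
      exact (contDiffAt_snd.comp_contDiffWithinAt z
        (ContDiffAt.comp_contDiffWithinAt z (g := Φ) hΦt h1)).const_smul η⁻¹
    refine hmain.congr_of_eventuallyEq ?_ (hformula z hzS hz htz hηU)
    filter_upwards [hmaps, hηev, hφev] with z' h1 h2 h3 using hformula z' h1.1 h1.2 h3 h2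
  intro t ht
  have hz₀ : z₀ ∈ S ∩ ball z₀ ε := ⟨hz₀S, mem_ball_self hεpos⟩
  have htε : t ∈ Icc (-ε) ε := ⟨by linarith [ht.1], by linarith [ht.2]⟩
  have ht0 : φ (t, z₀) ∈ ball z₀ ε := hδφ t z₀
    ((abs_lt.2 ht).trans_le (min_le_left _ _)) (by simpa)
  refine ⟨key z₀ hz₀ t ht ht0, fun hU => ?_⟩
  have hback : φ (-t, φ (t, z₀)) = z₀ := by
    have h1 : IsODESolution Y (fun r => φ (r, z₀)) (-ε) ε := fun r hr =>
      (hφsol z₀ (mem_ball_self hε₀) r ⟨by linarith [hr.1], by linarith [hr.2]⟩).hasDerivWithinAt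
    have h2 : IsODESolution Y (fun r => φ (r - t, φ (t, z₀))) (-ε) ε := fun r hr =>
      (HasDerivAt.comp_sub_const r t (hφsol _ (ball_subset_ball (by linarith) ht0) (r - t)
        ⟨by linarith [hr.1, ht.2], by linarith [hr.2, ht.1]⟩)).hasDerivWithinAt
    have h3 := h1.eqOn (hY.of_le hm1) h2 htε
      (by simp only [sub_self, hφ0 _ (ball_subset_ball (by linarith) ht0)])
      (show (0 : ℝ) ∈ Icc (-ε) ε from ⟨by linarith, hεpos.le⟩)
    simp only [zero_sub, hz0φ] at h3
    exact h3.symm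
  refine key _ ⟨(hS z₀ hz₀).1 t htε, ht0⟩ (-t) ⟨by linarith [ht.2], by linarith [ht.1]⟩ ?_ ?_
  · rw [hback]; exact hz₀.2
  · rwa [hback]

end

/-! ### The geodesic equation in coordinates -/

section

variable {E : Type*} [NormedAddCommGroup E] [NormedSpace ℝ E]

/-- The Christoffel symbols of the first kind, on the diagonal, of a metric `G` given in coordinates
on the set `s`: this is the covector `w ↦ ∂_v G(v, w) - ½ ∂_w G(v, v)`. -/
noncomputable def christoffelFirstOf (G : E → E →L[ℝ] E →L[ℝ] ℝ) (s : Set E) (y v : E) :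
    E →L[ℝ] ℝ :=
  fderivWithin ℝ (fun z => G z v) s y v - (1 / 2 : ℝ) • fderivWithin ℝ (fun z => G z v v) s y

/-- The vector field of the geodesic equation `y'' = -Γ(y)(y', y')` of a metric `G` given in
coordinates on the set `s`. -/
noncomputable def sprayOf (G : E → E →L[ℝ] E →L[ℝ] ℝ) (s : Set E) (z : E × E) : E × E :=
  (z.2, -(G z.1).inverse (christoffelFirstOf G s z.1 z.2))

lemma fderivWithin_apply_const {F W : Type*} [NormedAddCommGroup F] [NormedSpace ℝ F]
    [NormedAddCommGroup W] [NormedSpace ℝ W] {c : E → F →L[ℝ] W} {s : Set E} {y : E}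
    (hs : UniqueDiffWithinAt ℝ s y) (hc : DifferentiableWithinAt ℝ c s y) (a : E) (u : F) :
    fderivWithin ℝ (fun z => c z u) s y a = fderivWithin ℝ c s y a u := by
  rw [(hc.hasFDerivWithinAt.clm_apply (hasFDerivWithinAt_const u y s)).fderivWithin hs]
  simp

lemma differentiableWithinAt_apply_const {F W : Type*} [NormedAddCommGroup F] [NormedSpace ℝ F]
    [NormedAddCommGroup W] [NormedSpace ℝ W] {c : E → F →L[ℝ] W} {s : Set E} {y : E}
    (hc : DifferentiableWithinAt ℝ c s y) (u : F) :
    DifferentiableWithinAt ℝ (fun z => c z u) s y :=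
  hc.clm_apply (differentiableWithinAt_const u)

lemma hasDerivWithinAt_comp_fderivWithin {W : Type*} [NormedAddCommGroup W] [NormedSpace ℝ W]
    {c : E → W} {s : Set E} {y : ℝ → E} {y' : E} {J : Set ℝ} {t : ℝ}
    (hc : DifferentiableWithinAt ℝ c s (y t)) (hy : HasDerivWithinAt y y' J t)
    (h : MapsTo y J s) : HasDerivWithinAt (fun r => c (y r)) (fderivWithin ℝ c s (y t) y') J t :=
  hc.hasFDerivWithinAt.comp_hasDerivWithinAt t hy h

lemma hasFDerivWithinAt_comp_fderivWithin {W : Type*} [NormedAddCommGroup W] [NormedSpace ℝ W]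
    {c : E → W} {s : Set E} {φ : E → E} {φ' : E →L[ℝ] E} {y : E}
    (hc : DifferentiableWithinAt ℝ c s (φ y)) (hφ : HasFDerivWithinAt φ φ' s y)
    (h : ∀ᶠ z in 𝓝[s] y, φ z ∈ s) :
    HasFDerivWithinAt (fun z => c (φ z)) ((fderivWithin ℝ c s (φ y)).comp φ') s y :=
  HasFDerivWithinAt.comp_of_tendsto y hc.hasFDerivWithinAt hφ
    (tendsto_nhdsWithin_iff.2 ⟨hφ.continuousWithinAt, h⟩)

lemma christoffelFirstOf_apply {G : E → E →L[ℝ] E →L[ℝ] ℝ} {s : Set E} {y : E}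
    (hs : UniqueDiffWithinAt ℝ s y) (hG : DifferentiableWithinAt ℝ G s y) (v w : E) :
    christoffelFirstOf G s y v w =
      fderivWithin ℝ G s y v v w - 1 / 2 * fderivWithin ℝ G s y w v v := by
  rw [christoffelFirstOf, sub_apply, smul_apply, smul_eq_mul,
    fderivWithin_apply_const hs (differentiableWithinAt_apply_const hG v),
    fderivWithin_apply_const hs hG, fderivWithin_apply_const hs hG]

lemma isInvertible_of_posDef [FiniteDimensional ℝ E] {b : E →L[ℝ] E →L[ℝ] ℝ}
    (hb : ∀ v, v ≠ 0 → 0 < b v v) : b.IsInvertible := by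
  have hinj : Function.Injective b := by
    rw [injective_iff_map_eq_zero]
    intro v hv
    by_contra h
    have := hb v h
    rw [hv] at this
    simp at this
  have hdim : Module.finrank ℝ E = Module.finrank ℝ (E →L[ℝ] ℝ) := by
    rw [← (LinearMap.toContinuousLinearMap (𝕜 := ℝ) (E := E) (F' := ℝ)).finrank_eq]
    exact (Subspace.dual_finrank_eq).symm
  exact ⟨(LinearEquiv.ofInjectiveOfFinrankEq (b : E →ₗ[ℝ] E →L[ℝ] ℝ) hinj hdim
    ).toContinuousLinearEquiv, by ext; rfl⟩

lemma apply_inverse_of_isInvertible {b : E →L[ℝ] E →L[ℝ] ℝ} (hb : b.IsInvertible)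
    (ξ : E →L[ℝ] ℝ) : b (b.inverse ξ) = ξ := by
  obtain ⟨e, rfl⟩ := hb
  simp

lemma eq_inverse_of_isInvertible {b : E →L[ℝ] E →L[ℝ] ℝ} (hb : b.IsInvertible)
    {ξ : E →L[ℝ] ℝ} {v : E} (h : b v = ξ) : v = b.inverse ξ := by
  obtain ⟨e, rfl⟩ := hb
  simp [← h]

/-- The geodesic equation conserves the energy. -/
lemma hasDerivWithinAt_energy {G : E → E →L[ℝ] E →L[ℝ] ℝ} {s : Set E} {J : Set ℝ}
    {c : ℝ → E × E} {t : ℝ} (hs : UniqueDiffWithinAt ℝ s (c t).1)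
    (hG : DifferentiableWithinAt ℝ G s (c t).1)
    (hsymm : ∀ u v, G (c t).1 u v = G (c t).1 v u) (hinv : (G (c t).1).IsInvertible)
    (hc : HasDerivWithinAt c (sprayOf G s (c t)) J t) (hmaps : MapsTo (fun r => (c r).1) J s) :
    HasDerivWithinAt (fun r => G (c r).1 (c r).2 (c r).2) 0 J t := by
  have h1 := hasDerivWithinAt_comp_fderivWithin (c := G) hG hc.fst hmaps
  have h2 := (h1.clm_apply hc.snd).clm_apply hc.snd
  refine h2.congr_deriv ?_
  have h3 := DFunLike.congr_fun
    (apply_inverse_of_isInvertible hinv (christoffelFirstOf G s (c t).1 (c t).2)) (c t).2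
  rw [christoffelFirstOf_apply hs hG] at h3
  have h4 := hsymm (c t).2 ((G (c t).1).inverse (christoffelFirstOf G s (c t).1 (c t).2))
  simp only [sprayOf, map_neg, add_apply, neg_apply]
  linarith

/-- The transformation law of the Christoffel symbols. -/
lemma fderivWithin_christoffel {G G' : E → E →L[ℝ] E →L[ℝ] ℝ} {s : Set E} {φ : E → E} {y : E}
    (hs : UniqueDiffOn ℝ s) (hy : y ∈ s) (hy' : y ∈ closure (interior s))
    (hφ : ContDiffWithinAt ℝ 2 φ s y) (hmaps : ∀ᶠ z in 𝓝[s] y, φ z ∈ s)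
    (hG : DifferentiableWithinAt ℝ G s (φ y))
    (hG' : ∀ᶠ z in 𝓝[s] y, ∀ u v, G' z u v = G (φ z) (fderivWithin ℝ φ s z u)
      (fderivWithin ℝ φ s z v))
    (hdG' : DifferentiableWithinAt ℝ G' s y)
    (hsymm : ∀ u v, G (φ y) u v = G (φ y) v u) (hinv : (G (φ y)).IsInvertible)
    (hinv' : (G' y).IsInvertible) (hsurj : Function.Surjective (fderivWithin ℝ φ s y)) (v : E) :
    fderivWithin ℝ φ s y ((G' y).inverse (christoffelFirstOf G' s y v)) =
      (G (φ y)).inverse (christoffelFirstOf G s (φ y) (fderivWithin ℝ φ s y v)) +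
        fderivWithin ℝ (fderivWithin ℝ φ s) s y v v := by
  set D := fderivWithin ℝ φ s y with hD
  set D2 := fderivWithin ℝ (fderivWithin ℝ φ s) s y with hD2
  have hφ1 : DifferentiableWithinAt ℝ φ s y := hφ.differentiableWithinAt (by simp)
  have hDφ : HasFDerivWithinAt (fderivWithin ℝ φ s) D2 s y :=
    ((hφ.fderivWithin_right hs (m := 1) (by norm_num) hy).differentiableWithinAt
      one_ne_zero).hasFDerivWithinAt
  have hD2symm : ∀ u w, D2 u w = D2 w u := fun u w =>
    (hφ.isSymmSndFDerivWithinAt (by simp) hs hy' hy) u w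
  have hGφ := hasFDerivWithinAt_comp_fderivWithin (c := G) hG hφ1.hasFDerivWithinAt hmaps
  -- the derivative of the transformed metric
  have hder : ∀ a u w, fderivWithin ℝ G' s y a u w = fderivWithin ℝ G s (φ y) (D a) (D u) (D w)
      + G (φ y) (D2 a u) (D w) + G (φ y) (D u) (D2 a w) := by
    intro a u w
    have h1 : HasFDerivWithinAt (fun z => G' z u w) _ s y :=
      (hdG'.hasFDerivWithinAt.clm_apply (hasFDerivWithinAt_const u y s)).clm_apply
        (hasFDerivWithinAt_const w y s)
    have h2 : HasFDerivWithinAt (fun z => G (φ z) (fderivWithin ℝ φ s z u)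
        (fderivWithin ℝ φ s z w)) _ s y :=
      (hGφ.clm_apply (hDφ.clm_apply (hasFDerivWithinAt_const u y s))).clm_apply
        (hDφ.clm_apply (hasFDerivWithinAt_const w y s))
    have h3 : (fun z => G' z u w) =ᶠ[𝓝[s] y] fun z => G (φ z) (fderivWithin ℝ φ s z u)
        (fderivWithin ℝ φ s z w) := hG'.mono fun z hz => hz u w
    have h4 := (hs y hy).eq h1 (h2.congr_of_eventuallyEq h3 (h3.self_of_nhdsWithin hy))
    have h5 := DFunLike.congr_fun h4 a
    simp at h5
    rw [h5]
    ring
  have hchr : ∀ w, christoffelFirstOf G' s y v w =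
      christoffelFirstOf G s (φ y) (D v) (D w) + G (φ y) (D2 v v) (D w) := by
    intro w
    rw [christoffelFirstOf_apply (hs y hy) hdG',
      christoffelFirstOf_apply (hs _ (hmaps.self_of_nhdsWithin hy)) hG, hder, hder, hD2symm w v,
      hsymm (D2 v w) (D v)]
    ring
  have hpull : ∀ u w, G' y u w = G (φ y) (D u) (D w) := fun u w =>
    hG'.self_of_nhdsWithin hy u w
  have h1 : D ((G' y).inverse (christoffelFirstOf G' s y v)) - D2 v v =
      (G (φ y)).inverse (christoffelFirstOf G s (φ y) (D v)) := by
    refine eq_inverse_of_isInvertible hinv ?_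
    ext x
    obtain ⟨w, rfl⟩ := hsurj x
    rw [map_sub, sub_apply, ← hpull, apply_inverse_of_isInvertible hinv', hchr]
    ring
  rw [← h1, sub_add_cancel]

/-- Under a change of coordinates `φ`, the map `(y, v) ↦ (φ y, Dφ(y) v)` relates the vector fields
of the geodesic equations. -/
lemma hasFDerivWithinAt_tangent_spray {G G' : E → E →L[ℝ] E →L[ℝ] ℝ} {s : Set E} {φ : E → E}
    {y : E} (hs : UniqueDiffOn ℝ s) (hy : y ∈ s) (hy' : y ∈ closure (interior s))
    (hφ : ContDiffWithinAt ℝ 2 φ s y) (hmaps : ∀ᶠ z in 𝓝[s] y, φ z ∈ s)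
    (hG : DifferentiableWithinAt ℝ G s (φ y))
    (hG' : ∀ᶠ z in 𝓝[s] y, ∀ u v, G' z u v = G (φ z) (fderivWithin ℝ φ s z u)
      (fderivWithin ℝ φ s z v))
    (hdG' : DifferentiableWithinAt ℝ G' s y)
    (hsymm : ∀ u v, G (φ y) u v = G (φ y) v u) (hinv : (G (φ y)).IsInvertible)
    (hinv' : (G' y).IsInvertible) (hsurj : Function.Surjective (fderivWithin ℝ φ s y)) (v : E) :
    ∃ L : E × E →L[ℝ] E × E,
      HasFDerivWithinAt (fun z : E × E => (φ z.1, fderivWithin ℝ φ s z.1 z.2)) L (s ×ˢ univ) (y, v)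
      ∧ L (sprayOf G' s (y, v)) = sprayOf G s (φ y, fderivWithin ℝ φ s y v) := by
  have hφ1 : HasFDerivWithinAt φ (fderivWithin ℝ φ s y) s y :=
    (hφ.differentiableWithinAt (by simp)).hasFDerivWithinAt
  have hDφ : HasFDerivWithinAt (fderivWithin ℝ φ s) (fderivWithin ℝ (fderivWithin ℝ φ s) s y) s y :=
    ((hφ.fderivWithin_right hs (m := 1) (by norm_num) hy).differentiableWithinAt
      one_ne_zero).hasFDerivWithinAt
  have hfst : HasFDerivWithinAt (fun z : E × E => z.1) (ContinuousLinearMap.fst ℝ E E)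
    (s ×ˢ univ) (y, v) := hasFDerivWithinAt_fst
  have hsnd : HasFDerivWithinAt (fun z : E × E => z.2) (ContinuousLinearMap.snd ℝ E E)
    (s ×ˢ univ) (y, v) := hasFDerivWithinAt_snd
  have hm : MapsTo (fun z : E × E => z.1) (s ×ˢ univ) s := fun z hz => hz.1
  have h1 := HasFDerivWithinAt.comp (y, v) (f := fun z : E × E => z.1) hφ1 hfst hm
  have h2 := (HasFDerivWithinAt.comp (y, v) (f := fun z : E × E => z.1) hDφ hfst hm).clm_apply hsnd
  refine ⟨_, h1.prodMk h2, ?_⟩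
  have h3 := fderivWithin_christoffel hs hy hy' hφ hmaps hG hG' hdG' hsymm hinv hinv' hsurj v
  ext
  · simp [sprayOf]
  · simp [sprayOf, h3]

lemma ContDiffWithinAt.sprayOf [FiniteDimensional ℝ E] {G : E → E →L[ℝ] E →L[ℝ] ℝ} {s : Set E}
    {z : E × E} (hs : UniqueDiffOn ℝ s) (hz : z.1 ∈ s) (hG : ContDiffWithinAt ℝ ∞ G s z.1)
    (hinv : (G z.1).IsInvertible) :
    ContDiffWithinAt ℝ ∞ (sprayOf G s) (s ×ˢ univ) z := by
  have : CompleteSpace E := FiniteDimensional.complete ℝ _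
  have hm : MapsTo (fun z : E × E => z.1) (s ×ˢ univ) s := fun z hz => hz.1
  have hG1 : ContDiffWithinAt ℝ ∞ (fun z : E × E => G z.1) (s ×ˢ univ) z :=
    ContDiffWithinAt.comp z (f := fun z : E × E => z.1) hG contDiffWithinAt_fst hm
  have hI : ContDiffWithinAt ℝ ∞ (fun z : E × E => (G z.1).inverse) (s ×ˢ univ) z := by
    obtain ⟨e, he⟩ := hinv
    have h1 : ContDiffAt ℝ ∞ ContinuousLinearMap.inverse (G z.1) := he ▸ contDiffAt_map_inverse e
    exact ContDiffAt.comp_contDiffWithinAt z h1 hG1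
  have hv : ContDiffWithinAt ℝ ∞ (fun z : E × E => z.2) (s ×ˢ univ) z := contDiffWithinAt_snd
  have hst : s ×ˢ univ ⊆ (fun z : E × E => z.1) ⁻¹' s := fun z hz => hz.1
  have hzs : z ∈ s ×ˢ (univ : Set E) := ⟨hz, mem_univ _⟩
  have hGv : ContDiffWithinAt ℝ ∞ (fun p : (E × E) × E => G p.2 p.1.2) ((s ×ˢ univ) ×ˢ s)
      (z, z.1) := by
    have h1 : ContDiffWithinAt ℝ ∞ (fun p : (E × E) × E => G p.2) ((s ×ˢ univ) ×ˢ s) (z, z.1) :=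
      ContDiffWithinAt.comp (z, z.1) (f := fun p : (E × E) × E => p.2) hG contDiffWithinAt_snd
        (fun p hp => hp.2)
    exact h1.clm_apply (contDiff_fst.snd.contDiffWithinAt)
  have hGvv : ContDiffWithinAt ℝ ∞ (fun p : (E × E) × E => G p.2 p.1.2 p.1.2) ((s ×ˢ univ) ×ˢ s)
      (z, z.1) := hGv.clm_apply (contDiff_fst.snd.contDiffWithinAt)
  have h1 : ContDiffWithinAt ℝ ∞ (fun p : E × E => fderivWithin ℝ (fun y => G y p.2) s p.1)
      (s ×ˢ univ) z :=
    ContDiffWithinAt.fderivWithin (f := fun (p : E × E) y => G y p.2) hGv contDiffWithinAt_fst hs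
      (by simp) hzs hst
  have h2 : ContDiffWithinAt ℝ ∞ (fun p : E × E => fderivWithin ℝ (fun y => G y p.2 p.2) s p.1)
      (s ×ˢ univ) z :=
    ContDiffWithinAt.fderivWithin (f := fun (p : E × E) y => G y p.2 p.2) hGvv contDiffWithinAt_fst
      hs (by simp) hzs hst
  exact hv.prodMk (hI.clm_apply ((h1.clm_apply hv).sub (h2.const_smul (1 / 2 : ℝ)))).neg

end

/-! ### The tangent bundle in charts -/

section

variable {E : Type*} [NormedAddCommGroup E] [NormedSpace ℝ E] {H : Type*} [TopologicalSpace H]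
  {I : ModelWithCorners ℝ E H} {M : Type*} [TopologicalSpace M] [ChartedSpace H M]
  [IsManifold I ∞ M]

instance : IsManifold I 1 M := IsManifold.of_le (n := ∞) (by simp)

instance : IsManifold I 2 M :=
  IsManifold.of_le (n := ∞) (WithTop.coe_le_coe.2 (le_top : (2 : ℕ∞) ≤ ⊤))

instance : ContMDiffVectorBundle ∞ E (TangentSpace I : M → Type _) I :=
  have : IsManifold I (∞ + 1) M := ‹IsManifold I ∞ M›
  TangentBundle.contMDiffVectorBundle

instance : IsManifold I.tangent ∞ (TangentBundle I M) :=
  Bundle.TotalSpace.isManifold E (TangentSpace I)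

lemma extChartAt_tangent_apply (q p : TangentBundle I M) :
    extChartAt I.tangent q p = (extChartAt I q.1 p.1, tangentCoordChange I p.1 q.1 p.1 p.2) := rfl

lemma extChartAt_tangent_source (q : TangentBundle I M) :
    (extChartAt I.tangent q).source = {p | p.1 ∈ (extChartAt I q.1).source} := by
  ext p
  rw [extChartAt_source, mem_ofPred_eq, extChartAt_source]
  exact TangentBundle.mem_chart_source_iff p q

lemma mem_extChartAt_tangent_source {q p : TangentBundle I M} :
    p ∈ (extChartAt I.tangent q).source ↔ p.1 ∈ (extChartAt I q.1).source := by
  rw [extChartAt_tangent_source]; rfl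

lemma mem_extChartAt_tangent_target {q : TangentBundle I M} {z : E × E} :
    z ∈ (extChartAt I.tangent q).target ↔ z.1 ∈ (extChartAt I q.1).target := by
  rw [extChartAt_target, extChartAt_target, mem_inter_iff, mem_inter_iff, mem_preimage,
    mem_preimage, TangentBundle.mem_chart_target_iff]
  refine and_congr Iff.rfl ?_
  rw [ModelWithCorners.range_prod]
  simp

lemma range_tangent : range (I.tangent) = range I ×ˢ (univ : Set E) := by
  rw [ModelWithCorners.range_prod]
  simp

/-- The scalar product of the tangent space at `x`, as a bilinear form on the model space. -/
def metricAt (g : RMetric I M) (x : M) : E →L[ℝ] E →L[ℝ] ℝ := g.inner x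

lemma metricInChart_apply (g : RMetric I M) {x₀ : M} {y : E} (hy : y ∈ (extChartAt I x₀).target)
    (u v : E) : metricInChart g x₀ y u v = metricAt g ((extChartAt I x₀).symm y)
      (tangentCoordChange I x₀ ((extChartAt I x₀).symm y) ((extChartAt I x₀).symm y) u)
      (tangentCoordChange I x₀ ((extChartAt I x₀).symm y) ((extChartAt I x₀).symm y) v) := by
  have h : (extChartAt I x₀).symm y ∈ (chartAt H x₀).source := by
    rw [← extChartAt_source I]; exact (extChartAt I x₀).map_target hy
  have h1 := TangentBundle.symmL_trivializationAt_eq_core (I := I) h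
  exact congrArg₂ (fun a b => metricAt g ((extChartAt I x₀).symm y) a b) (DFunLike.congr_fun h1 u)
    (DFunLike.congr_fun h1 v)

lemma metricAt_symm (g : RMetric I M) (x : M) (u v : E) : metricAt g x u v = metricAt g x v u :=
  g.symm x u v

lemma metricAt_pos (g : RMetric I M) (x : M) {v : E} (hv : v ≠ 0) : 0 < metricAt g x v v :=
  g.pos x v hv

end

/-! ### The geodesic vector field in charts -/

section

variable {E : Type*} [NormedAddCommGroup E] [NormedSpace ℝ E] {H : Type*} [TopologicalSpace H]
  {I : ModelWithCorners ℝ E H} {M : Type*} [TopologicalSpace M] [ChartedSpace H M]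
  [IsManifold I ∞ M]

variable (I) in
/-- The change of coordinates from the chart at `x` to the chart at `x'`. -/
noncomputable def chartChange (x x' : M) : E → E := extChartAt I x' ∘ (extChartAt I x).symm

lemma tangentCoordChange_eq_fderivWithin (x x' : M) {y : E} (hy : y ∈ (extChartAt I x).target) :
    tangentCoordChange I x x' ((extChartAt I x).symm y) =
      fderivWithin ℝ (chartChange I x x') (range I) y := by
  rw [tangentCoordChange_def, (extChartAt I x).right_inv hy]
  rfl

lemma tangentCoordChange_tangentCoordChange {x x' z : M} (hx : z ∈ (extChartAt I x).source)
    (hx' : z ∈ (extChartAt I x').source) (v : E) :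
    tangentCoordChange I x' z z (tangentCoordChange I x x' z v) = tangentCoordChange I x z z v :=
  tangentCoordChange_comp ⟨⟨hx, hx'⟩, mem_extChartAt_source z⟩

lemma tangentCoordChange_inverse {x x' z : M} (hx : z ∈ (extChartAt I x).source)
    (hx' : z ∈ (extChartAt I x').source) (v : E) :
    tangentCoordChange I x' x z (tangentCoordChange I x x' z v) = v := by
  rw [tangentCoordChange_comp ⟨⟨hx, hx'⟩, hx⟩, tangentCoordChange_self hx]

lemma extChartAt_tangent_comp_symm (q q' : TangentBundle I M) {z : E × E}
    (hz : z.1 ∈ (extChartAt I q.1).target)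
    (hz' : (extChartAt I q.1).symm z.1 ∈ (extChartAt I q'.1).source) :
    extChartAt I.tangent q' ((extChartAt I.tangent q).symm z) =
      (chartChange I q.1 q'.1 z.1,
        fderivWithin ℝ (chartChange I q.1 q'.1) (range I) z.1 z.2) := by
  rw [extChartAt_tangent_apply]
  refine Prod.ext rfl ?_
  rw [← tangentCoordChange_eq_fderivWithin _ _ hz]
  exact tangentCoordChange_comp (I := I) (w := q.1)
    ⟨⟨(extChartAt I q.1).map_target hz, mem_extChartAt_source _⟩, hz'⟩

lemma metricInChart_chartChange (g : RMetric I M) {x x' : M} {y : E}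
    (hy : y ∈ (extChartAt I x).target)
    (hy' : (extChartAt I x).symm y ∈ (extChartAt I x').source) (u v : E) :
    metricInChart g x y u v = metricInChart g x' (chartChange I x x' y)
      (fderivWithin ℝ (chartChange I x x') (range I) y u)
      (fderivWithin ℝ (chartChange I x x') (range I) y v) := by
  have h1 : (extChartAt I x').symm (chartChange I x x' y) = (extChartAt I x).symm y :=
    (extChartAt I x').left_inv hy'
  have h2 : chartChange I x x' y ∈ (extChartAt I x').target := (extChartAt I x').map_source hy'
  rw [metricInChart_apply g hy, metricInChart_apply g h2,
    ← tangentCoordChange_eq_fderivWithin _ _ hy]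
  change _ = metricAt g ((extChartAt I x').symm (chartChange I x x' y))
    (tangentCoordChange I x' ((extChartAt I x').symm (chartChange I x x' y))
      ((extChartAt I x').symm (chartChange I x x' y)) _)
    (tangentCoordChange I x' ((extChartAt I x').symm (chartChange I x x' y))
      ((extChartAt I x').symm (chartChange I x x' y)) _)
  rw [h1, tangentCoordChange_tangentCoordChange ((extChartAt I x).map_target hy) hy',
    tangentCoordChange_tangentCoordChange ((extChartAt I x).map_target hy) hy']

lemma metricInChart_symm (g : RMetric I M) {x : M} {y : E} (hy : y ∈ (extChartAt I x).target)
    (u v : E) : metricInChart g x y u v = metricInChart g x y v u := by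
  rw [metricInChart_apply g hy, metricInChart_apply g hy, metricAt_symm]

lemma metricInChart_pos (g : RMetric I M) {x : M} {y : E} (hy : y ∈ (extChartAt I x).target)
    {v : E} (hv : v ≠ 0) : 0 < metricInChart g x y v v := by
  rw [metricInChart_apply g hy]
  refine metricAt_pos g _ fun h => hv ?_
  rw [← tangentCoordChange_inverse ((extChartAt I x).map_target hy) (mem_extChartAt_source _) v, h,
    map_zero]

lemma metricInChart_isInvertible [FiniteDimensional ℝ E] (g : RMetric I M) {x : M} {y : E}
    (hy : y ∈ (extChartAt I x).target) : (metricInChart g x y).IsInvertible :=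
  isInvertible_of_posDef fun _ hv => metricInChart_pos g hy hv

/-- The squared norm of a tangent vector, in coordinates. -/
lemma metricAt_eq_metricInChart (g : RMetric I M) {q p : TangentBundle I M}
    (hp : p.1 ∈ (extChartAt I q.1).source) :
    metricAt g p.1 p.2 p.2 = metricInChart g q.1 (extChartAt I.tangent q p).1
      (extChartAt I.tangent q p).2 (extChartAt I.tangent q p).2 := by
  rw [extChartAt_tangent_apply, metricInChart_apply g ((extChartAt I q.1).map_source hp)]
  simp only [(extChartAt I q.1).left_inv hp]
  have h := tangentCoordChange_inverse (mem_extChartAt_source (I := I) p.1) hp p.2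
  exact congrArg₂ (fun a b => metricAt g p.1 a b) h.symm h.symm

lemma contDiffOn_metricInChart [FiniteDimensional ℝ E] (g : RMetric I M) (x : M) :
    ContDiffOn ℝ ∞ (metricInChart g x) (extChartAt I x).target := by
  refine contDiffOn_clm_apply.2 fun u => contDiffOn_clm_apply.2 fun v => ?_
  rw [← contMDiffOn_iff_contDiffOn]
  have hsec : ∀ u : E, ContMDiffOn 𝓘(ℝ, E) I.tangent ∞
      (fun y => (extChartAt I.tangent (⟨x, (0 : E)⟩ : TangentBundle I M)).symm (y, u))
      (extChartAt I x).target := fun u => by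
    have h1 := contMDiffOn_extChartAt_symm (I := I.tangent) (n := ∞)
      (⟨x, (0 : E)⟩ : TangentBundle I M)
    have h2 : ContMDiffOn 𝓘(ℝ, E) 𝓘(ℝ, E × E) ∞ (fun y : E => (y, u)) (extChartAt I x).target :=
      (contDiff_id.prodMk contDiff_const).contMDiff.contMDiffOn
    exact h1.comp h2 fun y hy => mem_extChartAt_tangent_target.2 hy
  have hb : ContMDiffOn 𝓘(ℝ, E) I ∞ (extChartAt I x).symm (extChartAt I x).target :=
    contMDiffOn_extChartAt_symm x
  have key := ContMDiffOn.clm_bundle_apply₂ (F₁ := E) (F₂ := E) (F₃ := ℝ)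
    (E₃ := Bundle.Trivial M ℝ) (b := (extChartAt I x).symm)
    (ψ := fun y => g.inner ((extChartAt I x).symm y))
    (g.contMDiff.comp_contMDiffOn hb) (hsec u) (hsec v)
  intro y hy
  have h1 := (contMDiffWithinAt_totalSpace.1 (key y hy)).2
  refine h1.congr (fun z hz => ?_) ?_
  · exact metricInChart_apply g hz u v
  · exact metricInChart_apply g hy u v

lemma contDiffWithinAt_metricInChart [FiniteDimensional ℝ E] (g : RMetric I M) {x : M} {y : E}
    (hy : y ∈ (extChartAt I x).target) :
    ContDiffWithinAt ℝ ∞ (metricInChart g x) (range I) y :=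
  (contDiffOn_metricInChart g x y hy).mono_of_mem_nhdsWithin
    (extChartAt_target_mem_nhdsWithin_of_mem hy)

/-- The geodesic vector field in the chart of `TM` at `q`. -/
noncomputable def chartSpray (g : RMetric I M) (q : TangentBundle I M) : E × E → E × E :=
  sprayOf (metricInChart g q.1) (range I)

lemma contDiffWithinAt_chartSpray [FiniteDimensional ℝ E] (g : RMetric I M) {q : TangentBundle I M}
    {z : E × E} (hz : z ∈ (extChartAt I.tangent q).target) :
    ContDiffWithinAt ℝ ∞ (chartSpray g q) (range I.tangent) z := by
  rw [mem_extChartAt_tangent_target] at hz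
  rw [range_tangent]
  exact ContDiffWithinAt.sprayOf I.uniqueDiffOn (extChartAt_target_subset_range _ hz)
    (contDiffWithinAt_metricInChart g hz) (metricInChart_isInvertible g hz)

/-- A change of charts of `TM` relates the expressions of the geodesic vector field. -/
lemma exists_hasFDerivWithinAt_chartSpray [FiniteDimensional ℝ E] (g : RMetric I M)
    {q q' p : TangentBundle I M} (hq : p.1 ∈ (extChartAt I q.1).source)
    (hq' : p.1 ∈ (extChartAt I q'.1).source) :
    ∃ L : E × E →L[ℝ] E × E,
      HasFDerivWithinAt (extChartAt I.tangent q' ∘ (extChartAt I.tangent q).symm) L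
        (range I.tangent) (extChartAt I.tangent q p) ∧
      L (chartSpray g q (extChartAt I.tangent q p)) =
        chartSpray g q' (extChartAt I.tangent q' p) := by
  set y := extChartAt I q.1 p.1 with hy
  set φ := chartChange I q.1 q'.1 with hφ
  have hyt : y ∈ (extChartAt I q.1).target := (extChartAt I q.1).map_source hq
  have hys : (extChartAt I q.1).symm y = p.1 := (extChartAt I q.1).left_inv hq
  have hyr : y ∈ range I := extChartAt_target_subset_range _ hyt
  have hφy : φ y ∈ (extChartAt I q'.1).target := by
    rw [hφ, chartChange, Function.comp_apply, hys]
    exact (extChartAt I q'.1).map_source hq'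
  have hφC : ContDiffWithinAt ℝ 2 φ (range I) y := by
    refine contDiffWithinAt_ext_coord_change q'.1 q.1 ?_
    rw [PartialEquiv.trans_source'', PartialEquiv.symm_symm, PartialEquiv.symm_target]
    exact mem_image_of_mem _ ⟨hq, hq'⟩
  have hev : ∀ᶠ z in 𝓝[range I] y, z ∈ (extChartAt I q.1).target ∧
      (extChartAt I q.1).symm z ∈ (extChartAt I q'.1).source := by
    refine (eventually_mem_set.2 (extChartAt_target_mem_nhdsWithin_of_mem hyt)).and ?_
    have h1 : ContinuousWithinAt (extChartAt I q.1).symm (range I) y :=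
      (continuousAt_extChartAt_symm'' hyt).continuousWithinAt
    exact h1.eventually (by rw [hys]; exact (isOpen_extChartAt_source q'.1).mem_nhds hq')
  obtain ⟨L, hL, hL'⟩ := hasFDerivWithinAt_tangent_spray (φ := φ) (G := metricInChart g q'.1)
    (G' := metricInChart g q.1) I.uniqueDiffOn hyr (I.range_subset_closure_interior hyr) hφC
    (Eventually.of_forall fun z => mem_range_self _)
    ((contDiffWithinAt_metricInChart g hφy).differentiableWithinAt (by simp))
    (hev.mono fun z hz u v => metricInChart_chartChange g hz.1 hz.2 u v)
    ((contDiffWithinAt_metricInChart g hyt).differentiableWithinAt (by simp))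
    (metricInChart_symm g hφy) (metricInChart_isInvertible g hφy) (metricInChart_isInvertible g hyt)
    (fun w => ⟨tangentCoordChange I q'.1 q.1 p.1 w, by
      rw [← tangentCoordChange_eq_fderivWithin _ _ hyt, hys, tangentCoordChange_inverse hq' hq]⟩)
    (extChartAt I.tangent q p).2
  have heq : ∀ z : E × E, z.1 ∈ (extChartAt I q.1).target ∧
      (extChartAt I q.1).symm z.1 ∈ (extChartAt I q'.1).source →
      (extChartAt I.tangent q' ∘ (extChartAt I.tangent q).symm) z =
        (φ z.1, fderivWithin ℝ φ (range I) z.1 z.2) := fun z hz =>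
    extChartAt_tangent_comp_symm q q' hz.1 hz.2
  refine ⟨L, ?_, ?_⟩
  · rw [range_tangent]
    refine hL.congr_of_eventuallyEq ?_ (heq _ ⟨hyt, by rw [hys]; exact hq'⟩)
    have h1 : Tendsto Prod.fst (𝓝[range I ×ˢ (univ : Set E)] (extChartAt I.tangent q p))
        (𝓝[range I] y) :=
      tendsto_nhdsWithin_iff.2 ⟨continuousWithinAt_fst,
        eventually_mem_nhdsWithin.mono fun z hz => hz.1⟩
    exact (h1.eventually hev).mono heq
  · have h1 : extChartAt I.tangent q' p = (φ y, fderivWithin ℝ φ (range I) y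
        (extChartAt I.tangent q p).2) := by
      have h2 := heq (extChartAt I.tangent q p) ⟨hyt, by
        change (extChartAt I q.1).symm y ∈ _
        rw [hys]; exact hq'⟩
      rw [Function.comp_apply,
        (extChartAt I.tangent q).left_inv (mem_extChartAt_tangent_source.2 hq)] at h2
      exact h2
    rw [h1]
    exact hL'

end

/-! ### Orbits of the geodesic flow in charts -/

section

variable {E : Type*} [NormedAddCommGroup E] [NormedSpace ℝ E] {H : Type*} [TopologicalSpace H]
  {I : ModelWithCorners ℝ E H} {M : Type*} [TopologicalSpace M] [ChartedSpace H M]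
  [IsManifold I ∞ M]

lemma metricInChart_self (g : RMetric I M) (x : M) :
    metricInChart g x (extChartAt I x x) = metricAt g x := by
  have h1 : (extChartAt I x).symm (extChartAt I x x) = x :=
    (extChartAt I x).left_inv (mem_extChartAt_source x)
  ext u v
  rw [metricInChart_apply g (mem_extChartAt_target x), h1,
    tangentCoordChange_self (mem_extChartAt_source x),
    tangentCoordChange_self (mem_extChartAt_source x)]

lemma extChartAt_tangent_self (p : TangentBundle I M) :
    extChartAt I.tangent p p = (extChartAt I p.1 p.1, p.2) := by
  rw [extChartAt_tangent_apply]
  exact Prod.ext rfl (tangentCoordChange_self (mem_extChartAt_source _))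

lemma mem_unitTangent_iff {g : RMetric I M} {p : TangentBundle I M} :
    p ∈ unitTangent g ↔ metricAt g p.1 p.2 p.2 = 1 := Iff.rfl

variable [FiniteDimensional ℝ E]

lemma christoffelFirst_self (g : RMetric I M) (x : M) (v : E) :
    christoffelFirst g x v v =
      christoffelFirstOf (metricInChart g x) (range I) (extChartAt I x x) v := by
  ext w
  have h1 : DifferentiableWithinAt ℝ (metricInChart g x) (range I) (extChartAt I x x) :=
    (contDiffWithinAt_metricInChart g (mem_extChartAt_target x)).differentiableWithinAt (by simp)
  have hu : UniqueDiffWithinAt ℝ (range I) (extChartAt I x x) :=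
    I.uniqueDiffOn _ (mem_range_self _)
  rw [christoffelFirstOf_apply hu h1]
  have h2 : christoffelFirst g x v v w = (1 / 2 : ℝ) * (dMetric g x v v w + dMetric g x v v w
    - dMetric g x w v v) := rfl
  rw [h2]
  change (1 / 2 : ℝ) * (_ + _ -
    fderivWithin ℝ (metricInChart g x) (range I) (extChartAt I x x) w v v) = _
  have h3 : dMetric g x v v w =
    fderivWithin ℝ (metricInChart g x) (range I) (extChartAt I x x) v v w := rfl
  rw [h3]
  ring

lemma geodesicField_eq (g : RMetric I M) (p : TangentBundle I M) :
    (geodesicField g p : E × E) = chartSpray g p (extChartAt I.tangent p p) := by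
  rw [extChartAt_tangent_self]
  refine Prod.ext rfl ?_
  change -((metricAt g p.1).inverse (christoffelFirst g p.1 p.2 p.2)) =
    -((metricInChart g p.1 (extChartAt I p.1 p.1)).inverse
      (christoffelFirstOf (metricInChart g p.1) (range I) (extChartAt I p.1 p.1) p.2))
  rw [metricInChart_self]
  exact congrArg (fun ξ => -((metricAt g p.1).inverse ξ)) (christoffelFirst_self g p.1 p.2)

/-- Being an integral curve of the geodesic vector field does not depend on the chart. -/
lemma hasDerivWithinAt_chartSpray (g : RMetric I M) {β : ℝ → TangentBundle I M} {J : Set ℝ} {t : ℝ}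
    (hβ : ContinuousWithinAt β J t) (ht : t ∈ J) {q q' : TangentBundle I M}
    (hq : β t ∈ (extChartAt I.tangent q).source) (hq' : β t ∈ (extChartAt I.tangent q').source)
    (h : HasDerivWithinAt (extChartAt I.tangent q ∘ β)
      (chartSpray g q (extChartAt I.tangent q (β t))) J t) :
    HasDerivWithinAt (extChartAt I.tangent q' ∘ β)
      (chartSpray g q' (extChartAt I.tangent q' (β t))) J t := by
  obtain ⟨L, hL, hLs⟩ := exists_hasFDerivWithinAt_chartSpray g
    (mem_extChartAt_tangent_source.1 hq) (mem_extChartAt_tangent_source.1 hq')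
  have h1 := HasFDerivWithinAt.comp_hasDerivWithinAt (f := extChartAt I.tangent q ∘ β) t hL h
    (fun r _ => mem_range_self _)
  rw [hLs] at h1
  refine h1.congr_of_eventuallyEq_of_mem ?_ ht
  filter_upwards [hβ.eventually ((isOpen_extChartAt_source q).mem_nhds hq)] with r hr
  simp only [Function.comp_apply, (extChartAt I.tangent q).left_inv hr]

lemma isMIntegralCurveOn_geodesicField_iff (g : RMetric I M) {β : ℝ → TangentBundle I M}
    {J : Set ℝ} : IsMIntegralCurveOn (I := I.tangent) β (geodesicField g) J ↔
      ∀ t ∈ J, ContinuousWithinAt β J t ∧ HasDerivWithinAt (extChartAt I.tangent (β t) ∘ β)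
        (chartSpray g (β t) (extChartAt I.tangent (β t) (β t))) J t := by
  refine forall₂_congr fun t _ => and_congr_right fun _ => ?_
  rw [← geodesicField_eq]
  have hset : (extChartAt 𝓘(ℝ, ℝ) t).symm ⁻¹' J ∩ range 𝓘(ℝ, ℝ) = J := by
    rw [extChartAt_model_space_eq_id, modelWithCornersSelf_coe, range_id, inter_univ]
    rfl
  have h1 : ∀ w : E × E, HasFDerivWithinAt (extChartAt I.tangent (β t) ∘ β)
      (ContinuousLinearMap.smulRight (1 : ℝ →L[ℝ] ℝ) w)
      ((extChartAt 𝓘(ℝ, ℝ) t).symm ⁻¹' J ∩ range 𝓘(ℝ, ℝ)) t ↔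
      HasDerivWithinAt (extChartAt I.tangent (β t) ∘ β) w J t := fun w => by
    rw [hset, ContinuousLinearMap.smulRight_one_eq_toSpanSingleton]
    rfl
  exact h1 (geodesicField g (β t))

/-- An orbit of the geodesic flow solves the geodesic equation in every chart. -/
lemma hasDerivWithinAt_of_isMIntegralCurveOn {g : RMetric I M} {β : ℝ → TangentBundle I M}
    {J : Set ℝ} (hβ : IsMIntegralCurveOn (I := I.tangent) β (geodesicField g) J)
    {t : ℝ} (ht : t ∈ J) {q : TangentBundle I M} (hq : β t ∈ (extChartAt I.tangent q).source) :
    HasDerivWithinAt (extChartAt I.tangent q ∘ β)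
      (chartSpray g q (extChartAt I.tangent q (β t))) J t :=
  have h := (isMIntegralCurveOn_geodesicField_iff g).1 hβ t ht
  hasDerivWithinAt_chartSpray g h.1 ht (mem_extChartAt_source _) hq h.2

/-- A solution of the geodesic equation in a chart defines an orbit of the geodesic flow. -/
lemma isMIntegralCurveOn_of_hasDerivWithinAt {g : RMetric I M} {q : TangentBundle I M}
    {c : ℝ → E × E} {J : Set ℝ} (hc : ∀ t ∈ J, c t ∈ (extChartAt I.tangent q).target ∧
      HasDerivWithinAt c (chartSpray g q (c t)) J t) :
    IsMIntegralCurveOn (I := I.tangent) (fun t => (extChartAt I.tangent q).symm (c t))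
      (geodesicField g) J := by
  rw [isMIntegralCurveOn_geodesicField_iff]
  intro t ht
  obtain ⟨h1, h2⟩ := hc t ht
  have hcont : ContinuousWithinAt (fun t => (extChartAt I.tangent q).symm (c t)) J t :=
    ContinuousAt.comp_continuousWithinAt (f := c) (g := (extChartAt I.tangent q).symm)
      (continuousAt_extChartAt_symm'' h1) h2.continuousWithinAt
  refine ⟨hcont, hasDerivWithinAt_chartSpray g hcont ht (q := q)
    ((extChartAt I.tangent q).map_target h1) (mem_extChartAt_source _) ?_⟩
  rw [(extChartAt I.tangent q).right_inv h1]
  exact h2.congr_of_mem (fun r hr => (extChartAt I.tangent q).right_inv (hc r hr).1) ht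

lemma isMIntegralCurveOn_union_Icc {g : RMetric I M} {β : ℝ → TangentBundle I M} {a b c : ℝ}
    (hab : a ≤ b) (hbc : b ≤ c)
    (h1 : IsMIntegralCurveOn (I := I.tangent) β (geodesicField g) (Icc a b))
    (h2 : IsMIntegralCurveOn (I := I.tangent) β (geodesicField g) (Icc b c)) :
    IsMIntegralCurveOn (I := I.tangent) β (geodesicField g) (Icc a c) := by
  rw [isMIntegralCurveOn_geodesicField_iff] at *
  intro t ht
  refine ⟨?_, HasDerivWithinAt.union_Icc hab hbc (fun h => (h1 t h).2) (fun h => (h2 t h).2) ht⟩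
  rw [← Icc_union_Icc_eq_Icc hab hbc]
  refine ContinuousWithinAt.union ?_ ?_
  · by_cases h : t ∈ Icc a b
    · exact (h1 t h).1
    · exact continuousWithinAt_of_notMem_closure (by rwa [isClosed_Icc.closure_eq])
  · by_cases h : t ∈ Icc b c
    · exact (h2 t h).1
    · exact continuousWithinAt_of_notMem_closure (by rwa [isClosed_Icc.closure_eq])

lemma isMIntegralCurveOn_congr {g : RMetric I M} {β β' : ℝ → TangentBundle I M} {J : Set ℝ}
    (h : IsMIntegralCurveOn (I := I.tangent) β (geodesicField g) J) (heq : EqOn β' β J) :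
    IsMIntegralCurveOn (I := I.tangent) β' (geodesicField g) J := by
  rw [isMIntegralCurveOn_geodesicField_iff] at *
  intro t ht
  rw [heq ht]
  refine ⟨(h t ht).1.congr heq (heq ht), (h t ht).2.congr_of_mem (fun r hr => ?_) ht⟩
  simp only [Function.comp_apply, heq hr]

lemma isMIntegralCurveOn_shift {g : RMetric I M} {β : ℝ → TangentBundle I M} {a b s : ℝ}
    (h : IsMIntegralCurveOn (I := I.tangent) β (geodesicField g) (Icc a b)) :
    IsMIntegralCurveOn (I := I.tangent) (fun t => β (s + t)) (geodesicField g)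
      (Icc (a - s) (b - s)) := by
  rw [isMIntegralCurveOn_geodesicField_iff] at *
  intro t ht
  have hm : MapsTo (fun r => s + r) (Icc (a - s) (b - s)) (Icc a b) := fun r hr =>
    ⟨by linarith [hr.1], by linarith [hr.2]⟩
  obtain ⟨h1, h2⟩ := h (s + t) (hm ht)
  refine ⟨h1.comp (f := fun r => s + r) (continuous_const_add s).continuousWithinAt hm, ?_⟩
  have h3 := h2.scomp (h := fun r => s + r) t ((hasDerivAt_id t).const_add s).hasDerivWithinAt hm
  rw [one_smul] at h3
  exact h3

/-- Every curve is an orbit on a trivial interval. -/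
lemma isMIntegralCurveOn_Icc_self (g : RMetric I M) (β : ℝ → TangentBundle I M) (a : ℝ) :
    IsMIntegralCurveOn (I := I.tangent) β (geodesicField g) (Icc a a) := by
  rw [isMIntegralCurveOn_geodesicField_iff, Icc_self]
  rintro t rfl
  exact ⟨continuousWithinAt_singleton,
    HasFDerivWithinAt.of_subsingleton subsingleton_singleton⟩

/-- The geodesic flow conserves the speed. -/
lemma metricAt_eq_of_isMIntegralCurveOn {g : RMetric I M} {β : ℝ → TangentBundle I M} {a b : ℝ}
    (hβ : IsMIntegralCurveOn (I := I.tangent) β (geodesicField g) (Icc a b)) :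
    ∀ t ∈ Icc a b, metricAt g (β t).1 (β t).2 (β t).2 = metricAt g (β a).1 (β a).2 (β a).2 := by
  have hder : ∀ t ∈ Icc a b, HasDerivWithinAt
      (fun r => metricAt g (β r).1 (β r).2 (β r).2) 0 (Icc a b) t := by
    intro t ht
    have h1 := (isMIntegralCurveOn_geodesicField_iff g).1 hβ t ht
    have h2 := hasDerivWithinAt_energy (G := metricInChart g (β t).1) (s := range I)
      (c := extChartAt I.tangent (β t) ∘ β) (J := Icc a b) (t := t)
      (I.uniqueDiffOn _ (mem_range_self _))
      ((contDiffWithinAt_metricInChart g (mem_extChartAt_target _)).differentiableWithinAt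
        (by simp))
      (metricInChart_symm g (mem_extChartAt_target _))
      (metricInChart_isInvertible g (mem_extChartAt_target _)) h1.2 (fun r _ => mem_range_self _)
    refine h2.congr_of_eventuallyEq_of_mem ?_ ht
    filter_upwards [h1.1.eventually ((isOpen_extChartAt_source (I := I.tangent) (β t)).mem_nhds
      (mem_extChartAt_source _))] with r hr
    exact metricAt_eq_metricInChart g (mem_extChartAt_tangent_source.1 hr)
  refine constant_of_has_deriv_right_zero (fun t ht => (hder t ht).continuousWithinAt)
    fun t ht => ?_
  refine (hder t (Ico_subset_Icc_self ht)).mono_of_mem_nhdsWithin ?_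
  exact mem_of_superset (Icc_mem_nhdsGE ht.2) (Icc_subset_Icc ht.1 le_rfl)

lemma mem_unitTangent_of_isMIntegralCurveOn {g : RMetric I M} {β : ℝ → TangentBundle I M}
    {a b : ℝ} (hβ : IsMIntegralCurveOn (I := I.tangent) β (geodesicField g) (Icc a b)) {s t : ℝ}
    (hs : s ∈ Icc a b) (h : β s ∈ unitTangent g) (ht : t ∈ Icc a b) : β t ∈ unitTangent g := by
  rw [mem_unitTangent_iff, metricAt_eq_of_isMIntegralCurveOn hβ t ht,
    ← metricAt_eq_of_isMIntegralCurveOn hβ s hs]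
  exact h

end

/-! ### Compactness of the unit tangent bundle -/

section

variable {E : Type*} [NormedAddCommGroup E] [NormedSpace ℝ E] {H : Type*} [TopologicalSpace H]
  {I : ModelWithCorners ℝ E H} {M : Type*} [TopologicalSpace M] [ChartedSpace H M]
  [IsManifold I ∞ M]

instance [T2Space M] : T2Space (TangentBundle I M) := by
  refine ⟨fun p p' hpp' => ?_⟩
  have hproj : Continuous (fun p : TangentBundle I M => p.1) :=
    FiberBundle.continuous_proj E (TangentSpace I)
  by_cases h : p.1 = p'.1
  · set e := extChartAt I.tangent p
    have hs : IsOpen e.source := isOpen_extChartAt_source p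
    have hp : p ∈ e.source := mem_extChartAt_source p
    have hp' : p' ∈ e.source := by
      rw [mem_extChartAt_tangent_source, ← h]
      exact mem_extChartAt_source _
    obtain ⟨u, v, hu, hv, hpu, hpv, huv⟩ := t2_separation (fun h => hpp' (e.injOn hp hp' h))
    have hc : ContinuousOn e e.source := continuousOn_extChartAt p
    refine ⟨e.source ∩ e ⁻¹' u, e.source ∩ e ⁻¹' v, hc.isOpen_inter_preimage hs hu,
      hc.isOpen_inter_preimage hs hv, ⟨hp, hpu⟩, ⟨hp', hpv⟩, ?_⟩
    exact (huv.preimage e).mono inter_subset_right inter_subset_right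
  · obtain ⟨u, v, hu, hv, hpu, hpv, huv⟩ := t2_separation h
    exact ⟨_, _, hu.preimage hproj, hv.preimage hproj, hpu, hpv, huv.preimage _⟩

lemma contMDiff_metricAt (g : RMetric I M) :
    ContMDiff I.tangent 𝓘(ℝ, ℝ) ∞ (fun p : TangentBundle I M => metricAt g p.1 p.2 p.2) := by
  have hb : ContMDiff I.tangent I ∞ (fun p : TangentBundle I M => p.1) :=
    contMDiff_proj (TangentSpace I)
  have hid : ContMDiff I.tangent I.tangent ∞
      (fun p : TangentBundle I M => TotalSpace.mk' E (E := TangentSpace I) p.1 p.2) := contMDiff_id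
  have key := ContMDiff.clm_bundle_apply₂ (F₁ := E) (F₂ := E) (F₃ := ℝ)
    (E₃ := Bundle.Trivial M ℝ) (b := fun p : TangentBundle I M => p.1)
    (ψ := fun p : TangentBundle I M => g.inner p.1)
    (g.contMDiff.comp hb) hid hid
  intro p
  exact (contMDiffAt_totalSpace.1 (key p)).2

lemma isClosed_unitTangent (g : RMetric I M) : IsClosed (unitTangent g) :=
  isClosed_eq (contMDiff_metricAt g).continuous continuous_const

variable [FiniteDimensional ℝ E]

lemma exists_pos_mul_sq_le {b : E →L[ℝ] E →L[ℝ] ℝ} (hb : ∀ v, v ≠ 0 → 0 < b v v) :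
    ∃ c > 0, ∀ b' : E →L[ℝ] E →L[ℝ] ℝ, ‖b' - b‖ < c → ∀ v, c * ‖v‖ ^ 2 ≤ b' v v := by
  have : ProperSpace E := FiniteDimensional.proper_real E
  obtain ⟨c, hc, H⟩ := (isCompact_sphere (0 : E) 1).exists_forall_le'
    (f := fun v => b v v) (a := 0) (by fun_prop)
    (fun v hv => hb v (by rintro rfl; simp at hv))
  refine ⟨c / 2, half_pos hc, fun b' hb' v => ?_⟩
  have h1 : c * ‖v‖ ^ 2 ≤ b v v := by
    rcases eq_or_ne v 0 with rfl | hv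
    · simp
    · have hv' : 0 < ‖v‖ := norm_pos_iff.2 hv
      have h2 := H (‖v‖⁻¹ • v) (by simp [norm_smul, hv'.ne'])
      simp only [map_smul, smul_apply, smul_eq_mul] at h2
      calc c * ‖v‖ ^ 2 ≤ ‖v‖⁻¹ * (‖v‖⁻¹ * b v v) * ‖v‖ ^ 2 := by gcongr
        _ = b v v := by field_simp
  have h3 : |(b' - b) v v| ≤ c / 2 * ‖v‖ ^ 2 := by
    have h4 := (b' - b).le_opNorm₂ v v
    rw [Real.norm_eq_abs] at h4
    refine h4.trans ?_
    rw [mul_assoc, ← sq]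
    gcongr
  rw [sub_apply, sub_apply, abs_le] at h3
  linarith [h3.1]

lemma eventually_norm_sub_lt {X F W : Type*} [NormedAddCommGroup F] [NormedSpace ℝ F]
    [NormedAddCommGroup W] [NormedSpace ℝ W] {G : F → W} {s : Set F} {y : F}
    (hG : ContDiffWithinAt ℝ ∞ G s y) {φ : X → F} {l : Filter X} (hφ : Tendsto φ l (𝓝[s] y))
    {c : ℝ} (hc : 0 < c) : ∀ᶠ x in l, ‖G (φ x) - G y‖ < c := by
  simpa [dist_eq_norm] using (hG.continuousWithinAt.tendsto.comp hφ).eventually (ball_mem_nhds _ hc)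

theorem isCompact_unitTangent [CompactSpace M] (g : RMetric I M) :
    IsCompact (unitTangent g) := by
  have : ProperSpace E := FiniteDimensional.proper_real E
  rw [isCompact_iff_ultrafilter_le_nhds]
  intro f hf
  rw [le_principal_iff] at hf
  obtain ⟨x, -, hx⟩ := isCompact_univ (X := M).ultrafilter_le_nhds
    (f.map (fun p : TangentBundle I M => p.1)) (by simp)
  have hx' : Tendsto (fun p : TangentBundle I M => p.1) f (𝓝 x) := hx
  let q : TangentBundle I M := ⟨x, 0⟩
  have hsrc : ∀ᶠ p in (f : Filter (TangentBundle I M)), p.1 ∈ (extChartAt I x).source :=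
    hx'.eventually ((isOpen_extChartAt_source x).mem_nhds (mem_extChartAt_source x))
  have hfst : Tendsto (fun p : TangentBundle I M => extChartAt I x p.1) f
      (𝓝[range I] (extChartAt I x x)) :=
    tendsto_nhdsWithin_iff.2 ⟨(continuousAt_extChartAt x).tendsto.comp hx',
      Eventually.of_forall fun p => mem_range_self _⟩
  obtain ⟨c, hc, H⟩ := exists_pos_mul_sq_le fun v hv =>
    metricInChart_pos g (x := x) (mem_extChartAt_target x) hv
  have hbound : ∀ᶠ p in (f : Filter (TangentBundle I M)),
      (extChartAt I.tangent q p).2 ∈ closedBall (0 : E) (√(1 / c)) := by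
    filter_upwards [hf, hsrc, eventually_norm_sub_lt
      (contDiffWithinAt_metricInChart g (mem_extChartAt_target x)) hfst hc] with p h1 h2 h3
    have h4 := H _ h3 (extChartAt I.tangent q p).2
    have h5 := metricAt_eq_metricInChart g (q := q) (p := p) h2
    rw [mem_unitTangent_iff.1 h1] at h5
    have h6 : c * ‖(extChartAt I.tangent q p).2‖ ^ 2 ≤ 1 := h4.trans_eq h5.symm
    rw [mem_closedBall, dist_zero_right]
    refine Real.le_sqrt_of_sq_le ?_
    rw [le_div_iff₀ hc]
    linarith
  obtain ⟨w, -, hw⟩ := (isCompact_closedBall (0 : E) (√(1 / c))).ultrafilter_le_nhds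
    (f.map (fun p : TangentBundle I M => (extChartAt I.tangent q p).2))
    (by rw [le_principal_iff]; exact hbound)
  have hw' : Tendsto (fun p : TangentBundle I M => (extChartAt I.tangent q p).2) f (𝓝 w) := hw
  have hlim : Tendsto (extChartAt I.tangent q) f (𝓝 (extChartAt I x x, w)) :=
    (hfst.mono_right nhdsWithin_le_nhds).prodMk_nhds hw'
  have htar : (extChartAt I x x, w) ∈ (extChartAt I.tangent q).target :=
    mem_extChartAt_tangent_target.2 (mem_extChartAt_target x)
  have hconv : Tendsto id (f : Filter (TangentBundle I M))
      (𝓝 ((extChartAt I.tangent q).symm (extChartAt I x x, w))) := by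
    refine Tendsto.congr' ?_ ((continuousAt_extChartAt_symm'' htar).tendsto.comp hlim)
    filter_upwards [hsrc] with p hp
    exact (extChartAt I.tangent q).left_inv (mem_extChartAt_tangent_source.2 hp)
  exact ⟨_, (isClosed_unitTangent g).mem_of_tendsto hconv hf, hconv⟩

end

/-! ### Local existence, uniqueness and maximal time of geodesics -/

section

variable (d : ℕ) [NeZero d]

/-- The first coordinate of the base point, on the model space of the tangent bundle: the manifold
is given by `height ≥ 0` in charts. -/
noncomputable def height :
    EuclideanSpace ℝ (Fin d) × EuclideanSpace ℝ (Fin d) →L[ℝ] ℝ :=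
  (EuclideanSpace.proj (0 : Fin d) : EuclideanSpace ℝ (Fin d) →L[ℝ] ℝ).comp
    (ContinuousLinearMap.fst ℝ _ _)

lemma height_apply (z : EuclideanSpace ℝ (Fin d) × EuclideanSpace ℝ (Fin d)) :
    height d z = z.1 0 := rfl

lemma height_ne_zero : height d ≠ 0 := fun h => by
  have := DFunLike.congr_fun h (EuclideanSpace.single (0 : Fin d) (1 : ℝ), 0)
  simp [height_apply] at this

lemma range_tangent_eq : range (𝓡∂ d).tangent = {z | 0 ≤ height d z} := by
  rw [range_tangent, range_modelWithCornersEuclideanHalfSpace]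
  ext z
  simp [height_apply]

end

section

variable {d : ℕ} [NeZero d] {M : Type*} [TopologicalSpace M]
  [ChartedSpace (EuclideanHalfSpace d) M] [IsManifold (𝓡∂ d) ∞ M]

local notation "TM" => TangentBundle (𝓡∂ d) M

lemma height_extChartAt_nonneg (q p : TM) : 0 ≤ height d (extChartAt (𝓡∂ d).tangent q p) := by
  have h : extChartAt (𝓡∂ d).tangent q p ∈ range (𝓡∂ d).tangent := mem_range_self _
  rwa [range_tangent_eq] at h

lemma exists_ball_subset_target (q : TM) : ∃ r > 0,
    ∀ z ∈ ball (extChartAt (𝓡∂ d).tangent q q) r, 0 ≤ height d z →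
      z ∈ (extChartAt (𝓡∂ d).tangent q).target := by
  have h := extChartAt_target_mem_nhdsWithin (I := (𝓡∂ d).tangent) q
  rw [range_tangent_eq, mem_nhdsWithin_iff] at h
  obtain ⟨r, hr, h⟩ := h
  exact ⟨r, hr, fun z hz hz' => h ⟨hz, hz'⟩⟩

/-- In a chart, the geodesic vector field extends across the boundary. -/
lemma exists_extension_chartSpray (g : RMetric (𝓡∂ d) M) (q : TM) (m : ℕ) :
    ∃ Y, ContDiff ℝ m Y ∧ ∃ r > 0, ∀ z ∈ ball (extChartAt (𝓡∂ d).tangent q q) r,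
      0 ≤ height d z → z ∈ (extChartAt (𝓡∂ d).tangent q).target ∧ Y z = chartSpray g q z := by
  have h1 := contDiffWithinAt_chartSpray g (mem_extChartAt_target (I := (𝓡∂ d).tangent) q)
  rw [range_tangent_eq] at h1
  obtain ⟨Y, hY, hYe⟩ := exists_contDiff_extension (n := m) (height d) (height_ne_zero d)
    (height_extChartAt_nonneg q q) (h1.of_le (by exact_mod_cast le_top))
  obtain ⟨r₁, hr₁, H₁⟩ := exists_ball_subset_target q
  obtain ⟨r₂, hr₂, H₂⟩ := Metric.eventually_nhds_iff_ball.1 hYe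
  exact ⟨Y, hY, min r₁ r₂, lt_min hr₁ hr₂, fun z hz hz' =>
    ⟨H₁ z (ball_subset_ball (min_le_left _ _) hz) hz',
      H₂ z (ball_subset_ball (min_le_right _ _) hz) hz'⟩⟩

lemma isODESolution_extChartAt {g : RMetric (𝓡∂ d) M} {q : TM}
    {Y : EuclideanSpace ℝ (Fin d) × EuclideanSpace ℝ (Fin d) →
      EuclideanSpace ℝ (Fin d) × EuclideanSpace ℝ (Fin d)} {r : ℝ}
    (hY : ∀ z ∈ ball (extChartAt (𝓡∂ d).tangent q q) r,
      0 ≤ height d z → z ∈ (extChartAt (𝓡∂ d).tangent q).target ∧ Y z = chartSpray g q z)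
    {β : ℝ → TM} {a b : ℝ}
    (hβ : IsMIntegralCurveOn (I := (𝓡∂ d).tangent) β (geodesicField g) (Icc a b))
    (h : ∀ t ∈ Icc a b, β t ∈ (extChartAt (𝓡∂ d).tangent q).source ∧
      extChartAt (𝓡∂ d).tangent q (β t) ∈ ball (extChartAt (𝓡∂ d).tangent q q) r) :
    IsODESolution Y (extChartAt (𝓡∂ d).tangent q ∘ β) a b := fun t ht => by
  rw [Function.comp_apply, (hY _ (h t ht).2 (height_extChartAt_nonneg _ _)).2]
  exact hasDerivWithinAt_of_isMIntegralCurveOn hβ ht (h t ht).1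

lemma isMIntegralCurveOn_of_isODESolution {g : RMetric (𝓡∂ d) M} {q : TM}
    {Y : EuclideanSpace ℝ (Fin d) × EuclideanSpace ℝ (Fin d) →
      EuclideanSpace ℝ (Fin d) × EuclideanSpace ℝ (Fin d)} {r : ℝ}
    (hY : ∀ z ∈ ball (extChartAt (𝓡∂ d).tangent q q) r,
      0 ≤ height d z → z ∈ (extChartAt (𝓡∂ d).tangent q).target ∧ Y z = chartSpray g q z)
    {c : ℝ → EuclideanSpace ℝ (Fin d) × EuclideanSpace ℝ (Fin d)} {a b : ℝ}
    (hc : IsODESolution Y c a b)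
    (h : ∀ t ∈ Icc a b, c t ∈ ball (extChartAt (𝓡∂ d).tangent q q) r ∧ 0 ≤ height d (c t)) :
    IsMIntegralCurveOn (I := (𝓡∂ d).tangent)
      (fun t => (extChartAt (𝓡∂ d).tangent q).symm (c t)) (geodesicField g) (Icc a b) := by
  refine isMIntegralCurveOn_of_hasDerivWithinAt fun t ht => ?_
  obtain ⟨h1, h2⟩ := hY _ (h t ht).1 (h t ht).2
  refine ⟨h1, ?_⟩
  rw [← h2]
  exact hc t ht

variable [T2Space M]

/-- Near `q`, the geodesic flow is the restriction to `height ≥ 0` of a flow in the chart at `q`: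
orbits of that flow with `height ≥ 0` are geodesics, and conversely. -/
theorem exists_chart_flow (g : RMetric (𝓡∂ d) M) (q : TM) :
    ∃ (φ : ℝ × (EuclideanSpace ℝ (Fin d) × EuclideanSpace ℝ (Fin d)) →
        EuclideanSpace ℝ (Fin d) × EuclideanSpace ℝ (Fin d)) (ε : ℝ) (O : Set TM),
      0 < ε ∧ O ∈ 𝓝 q ∧ ContinuousAt φ (0, extChartAt (𝓡∂ d).tangent q q) ∧ ∀ p ∈ O,
      p ∈ (extChartAt (𝓡∂ d).tangent q).source ∧
      φ (0, extChartAt (𝓡∂ d).tangent q p) = extChartAt (𝓡∂ d).tangent q p ∧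
      ContinuousOn (fun t => φ (t, extChartAt (𝓡∂ d).tangent q p)) (Icc (-ε) ε) ∧
      (∀ a b, -ε ≤ a → b ≤ ε →
        (∀ t ∈ Icc a b, 0 ≤ height d (φ (t, extChartAt (𝓡∂ d).tangent q p))) →
        IsMIntegralCurveOn (I := (𝓡∂ d).tangent) (fun t => (extChartAt (𝓡∂ d).tangent q).symm
          (φ (t, extChartAt (𝓡∂ d).tangent q p))) (geodesicField g) (Icc a b)) ∧
      (∀ T ≤ ε, ∀ β, IsGeodesicOrbit g p T β → ∀ t ∈ Icc 0 T,
        β t ∈ (extChartAt (𝓡∂ d).tangent q).source ∧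
        extChartAt (𝓡∂ d).tangent q (β t) = φ (t, extChartAt (𝓡∂ d).tangent q p)) := by
  obtain ⟨Y, hY, r, hr, hYr⟩ := exists_extension_chartSpray g q 1
  set e := extChartAt (𝓡∂ d).tangent q with he
  set z₀ := e q with hz₀
  obtain ⟨Φ, hΦ, ε₀, hε₀, H⟩ := exists_contDiff_localFlow one_ne_zero hY z₀
  have hΦ0 : Φ (0, z₀) = z₀ := (H z₀ (mem_ball_self hε₀)).1
  have hcont : ContinuousAt Φ (0, z₀) := hΦ.continuousAt
  obtain ⟨δ, hδ, hbox⟩ := exists_box (hcont.eventually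
    (show ball z₀ (r / 2) ∈ 𝓝 (Φ (0, z₀)) by rw [hΦ0]; exact ball_mem_nhds _ (half_pos hr)))
  set ε := min δ ε₀ / 2 with hε
  have hm : 0 < min δ ε₀ := lt_min hδ hε₀
  have hεpos : 0 < ε := half_pos hm
  have hεδ : ε < δ := (half_lt_self hm).trans_le (min_le_left _ _)
  have hεε : ε < ε₀ := (half_lt_self hm).trans_le (min_le_right _ _)
  refine ⟨Φ, ε, e.source ∩ e ⁻¹' (ball z₀ (min δ ε₀)), hεpos, ?_, hcont, ?_⟩
  · exact inter_mem ((isOpen_extChartAt_source q).mem_nhds (mem_extChartAt_source q))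
      ((continuousAt_extChartAt q).preimage_mem_nhds (ball_mem_nhds _ hm))
  rintro p ⟨hps, hpb⟩
  have hpδ : e p ∈ ball z₀ δ := ball_subset_ball (min_le_left _ _) hpb
  have hpε : e p ∈ ball z₀ ε₀ := ball_subset_ball (min_le_right _ _) hpb
  obtain ⟨hp0, hpder⟩ := H _ hpε
  have hsol : ∀ a b, -ε ≤ a → b ≤ ε → IsODESolution Y (fun t => Φ (t, e p)) a b :=
    fun a b ha hb t ht =>
      (hpder t ⟨by linarith [ht.1], by linarith [ht.2]⟩).hasDerivWithinAt
  have hmem : ∀ t ∈ Icc (-ε) ε, Φ (t, e p) ∈ ball z₀ (r / 2) := fun t ht =>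
    hbox t (e p) (abs_lt.2 ⟨by linarith [ht.1], by linarith [ht.2]⟩) hpδ
  have hΦc : ContinuousOn (fun t => Φ (t, e p)) (Icc (-ε) ε) := fun t ht =>
    (hsol _ _ le_rfl le_rfl t ht).continuousWithinAt
  refine ⟨hps, hp0, hΦc, fun a b ha hb hpos =>
    isMIntegralCurveOn_of_isODESolution hYr (hsol a b ha hb) fun t ht => ⟨?_, hpos t ht⟩, ?_⟩
  · exact ball_subset_ball (by linarith) (hmem t ⟨ha.trans ht.1, ht.2.trans hb⟩)
  rintro T hT β ⟨hβ0, hβ⟩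
  have hβc : ContinuousOn β (Icc 0 T) := fun t ht => (hβ t ht).1
  have hsub : Icc 0 T ⊆ Icc (-ε) ε := Icc_subset_Icc (by linarith) hT
  set S : Set ℝ := {t | β t ∈ e.source ∧ e (β t) = Φ (t, e p)} with hS
  have hclosed : IsClosed (S ∩ Icc 0 T) := by
    refine isClosed_of_closure_subset fun t ht => ?_
    have htI : t ∈ Icc 0 T := isClosed_Icc.closure_subset_iff.2 inter_subset_right ht
    have : (𝓝[S ∩ Icc 0 T] t).NeBot := mem_closure_iff_nhdsWithin_neBot.1 ht
    have h1 : Tendsto β (𝓝[S ∩ Icc 0 T] t) (𝓝 (β t)) :=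
      (hβc t htI).mono inter_subset_right
    have h2 : Tendsto (fun t => Φ (t, e p)) (𝓝[S ∩ Icc 0 T] t) (𝓝 (Φ (t, e p))) :=
      (hΦc t (hsub htI)).mono (inter_subset_right.trans hsub)
    have h3 : 0 ≤ height d (Φ (t, e p)) := by
      refine ge_of_tendsto (((height d).continuous.tendsto _).comp h2) ?_
      filter_upwards [self_mem_nhdsWithin] with s hs
      rw [Function.comp_apply, ← hs.1.2]
      exact height_extChartAt_nonneg _ _
    have h4 := (hYr _ (ball_subset_ball (by linarith) (hmem t (hsub htI))) h3).1
    have h5 : Tendsto β (𝓝[S ∩ Icc 0 T] t) (𝓝 (e.symm (Φ (t, e p)))) := by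
      refine ((continuousAt_extChartAt_symm'' h4).tendsto.comp h2).congr' ?_
      filter_upwards [self_mem_nhdsWithin] with s hs
      rw [Function.comp_apply, ← hs.1.2]
      exact e.left_inv hs.1.1
    have h6 : β t = e.symm (Φ (t, e p)) := tendsto_nhds_unique h1 h5
    refine ⟨⟨?_, ?_⟩, htI⟩
    · rw [h6]; exact e.map_target h4
    · rw [h6]; exact e.right_inv h4
  have hsubset : Icc 0 T ⊆ S := by
    refine hclosed.Icc_subset_of_forall_mem_nhdsWithin ⟨hβ0 ▸ hps, ?_⟩ ?_
    · rw [hβ0]; exact hp0.symm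
    rintro t ⟨⟨hts, hte⟩, ht⟩
    have htI : t ∈ Icc 0 T := Ico_subset_Icc_self ht
    have h1 : ∀ᶠ s in 𝓝[Icc 0 T] t, β s ∈ e.source ∧ e (β s) ∈ ball z₀ r := by
      have h2 : ContinuousWithinAt (e ∘ β) (Icc 0 T) t :=
        (continuousAt_extChartAt' hts).comp_continuousWithinAt (hβc t htI)
      refine ((hβc t htI).eventually ((isOpen_extChartAt_source q).mem_nhds hts)).and
        (h2.eventually (isOpen_ball.mem_nhds ?_))
      rw [Function.comp_apply, hte]
      exact ball_subset_ball (by linarith) (hmem t (hsub htI))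
    obtain ⟨η, hη, hη'⟩ := mem_nhdsWithin_iff.1 h1
    set b := min T (t + η / 2) with hb
    have htb : t < b := lt_min ht.2 (by linarith)
    have hbT : b ≤ T := min_le_left _ _
    have h3 : ∀ s ∈ Icc t b, β s ∈ e.source ∧ e (β s) ∈ ball z₀ r := fun s hs => by
      refine hη' ⟨?_, ht.1.trans hs.1, hs.2.trans hbT⟩
      rw [mem_ball, Real.dist_eq, abs_of_nonneg (by linarith [hs.1])]
      linarith [hs.2, min_le_right T (t + η / 2)]
    have h4 := isODESolution_extChartAt hYr (hβ.mono (Icc_subset_Icc ht.1 hbT)) h3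
    have h5 := h4.eqOn hY (hsol t b (by linarith [ht.1]) (hbT.trans hT))
      (left_mem_Icc.2 htb.le) hte
    filter_upwards [Ioc_mem_nhdsGT htb] with s hs
    exact ⟨(h3 s (Ioc_subset_Icc_self hs)).1, h5 (Ioc_subset_Icc_self hs)⟩
  exact fun t ht => hsubset ht

/-- Geodesics are determined by their initial vectors. -/
theorem IsGeodesicOrbit.eqOn {g : RMetric (𝓡∂ d) M} {p : TM} {T : ℝ} {β β' : ℝ → TM}
    (h : IsGeodesicOrbit g p T β) (h' : IsGeodesicOrbit g p T β') : EqOn β β' (Icc 0 T) := by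
  have hβc : ContinuousOn β (Icc 0 T) := fun t ht => (h.2 t ht).1
  have hβc' : ContinuousOn β' (Icc 0 T) := fun t ht => (h'.2 t ht).1
  have hclosed : IsClosed ({t | β t = β' t} ∩ Icc 0 T) := by
    refine isClosed_of_closure_subset fun t ht => ?_
    have htI : t ∈ Icc 0 T := isClosed_Icc.closure_subset_iff.2 inter_subset_right ht
    have hne : NeBot (𝓝[{t : ℝ | β t = β' t} ∩ Icc 0 T] t) := mem_closure_iff_nhdsWithin_neBot.1 ht
    have h1 : Tendsto β (𝓝[{t : ℝ | β t = β' t} ∩ Icc 0 T] t) (𝓝 (β t)) :=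
      (hβc t htI).mono inter_subset_right
    have h2 : Tendsto β' (𝓝[{t : ℝ | β t = β' t} ∩ Icc 0 T] t) (𝓝 (β' t)) :=
      (hβc' t htI).mono inter_subset_right
    refine ⟨tendsto_nhds_unique (h1.congr' ?_) h2, htI⟩
    filter_upwards [self_mem_nhdsWithin] with s hs using hs.1
  refine hclosed.Icc_subset_of_forall_mem_nhdsWithin (h.1.trans h'.1.symm) ?_
  rintro t ⟨hte, ht⟩
  have hte : β t = β' t := hte
  obtain ⟨φ, ε, O, hε, hO, -, H⟩ := exists_chart_flow g (β t)
  obtain ⟨-, -, -, -, Hu⟩ := H (β t) (mem_of_mem_nhds hO)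
  set b := min (T - t) ε with hb
  have hb0 : 0 < b := lt_min (by linarith [ht.2]) hε
  have key : ∀ {β : ℝ → TM}, IsGeodesicOrbit g p T β →
      IsGeodesicOrbit g (β t) b (fun s => β (t + s)) := fun {β} h =>
    ⟨by simp, (isMIntegralCurveOn_shift (s := t) h.2).mono
      (Icc_subset_Icc (by linarith [ht.1]) (min_le_left _ _))⟩
  have h1 := Hu b (min_le_right _ _) _ (key h)
  have h2 := Hu b (min_le_right _ _) _ (hte ▸ key h')
  filter_upwards [Ioc_mem_nhdsGT (show t < t + b by linarith)] with s hs
  have hs' : s - t ∈ Icc 0 b := ⟨by linarith [hs.1], by linarith [hs.2]⟩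
  have h3 := h1 _ hs'
  have h4 := h2 _ hs'
  rw [add_sub_cancel] at h3 h4
  exact (extChartAt (𝓡∂ d).tangent (β t)).injOn h3.1 h4.1 (h3.2.trans h4.2.symm)

end

/-! ### Exit times -/

section

variable {d : ℕ} [NeZero d] {M : Type*} [TopologicalSpace M]
  [ChartedSpace (EuclideanHalfSpace d) M] [IsManifold (𝓡∂ d) ∞ M]

local notation "TM" => TangentBundle (𝓡∂ d) M

lemma mem_boundary_iff_height {q p : TM} (hp : p ∈ (extChartAt (𝓡∂ d).tangent q).source) :
    p.1 ∈ (𝓡∂ d).boundary M ↔ height d (extChartAt (𝓡∂ d).tangent q p) = 0 := by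
  have hs := mem_extChartAt_tangent_source.1 hp
  have hs' : p.1 ∈ (chartAt (EuclideanHalfSpace d) q.1).source := by rwa [extChartAt_source] at hs
  have h1 : p.1 ∈ (𝓡∂ d).boundary M ↔ ¬ (𝓡∂ d).IsInteriorPoint p.1 :=
    (𝓡∂ d).isBoundaryPoint_iff_not_isInteriorPoint p.1
  have h2 : (𝓡∂ d).IsInteriorPoint p.1 ↔
      extChartAt (𝓡∂ d) q.1 p.1 ∈ interior (range (𝓡∂ d)) := by
    rw [(𝓡∂ d).isInteriorPoint_iff_of_mem_atlas (n := ∞) (by simp)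
      (chart_mem_atlas (EuclideanHalfSpace d) q.1) hs']
    refine ⟨fun h => OpenPartialHomeomorph.interior_extend_target_subset_interior_range _ h,
      fun h => (chartAt _ q.1).mem_interior_extend_target ?_ h⟩
    exact (chartAt _ q.1).map_source hs'
  rw [h1, h2, interior_range_modelWithCornersEuclideanHalfSpace]
  have h3 := height_extChartAt_nonneg q p
  have h4 : height d (extChartAt (𝓡∂ d).tangent q p) = extChartAt (𝓡∂ d) q.1 p.1 0 := rfl
  rw [h4] at h3 ⊢
  rw [mem_ofPred_eq, not_lt]
  exact ⟨fun h => le_antisymm h h3, fun h => h.le⟩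

lemma height_pos_of_notMem_boundary {q p : TM} (hp : p ∈ (extChartAt (𝓡∂ d).tangent q).source)
    (h : p.1 ∉ (𝓡∂ d).boundary M) : 0 < height d (extChartAt (𝓡∂ d).tangent q p) :=
  (height_extChartAt_nonneg q p).lt_of_ne fun h' => h ((mem_boundary_iff_height hp).2 h'.symm)

lemma zero_mem_lifetimes (g : RMetric (𝓡∂ d) M) (p : TM) : (0 : ℝ) ∈ lifetimes g p :=
  ⟨le_rfl, fun _ => p, rfl, isMIntegralCurveOn_Icc_self g _ 0⟩

lemma IsGeodesicOrbit.mono {g : RMetric (𝓡∂ d) M} {p : TM} {T T' : ℝ} {β : ℝ → TM}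
    (h : IsGeodesicOrbit g p T β) (hT : T' ≤ T) : IsGeodesicOrbit g p T' β :=
  ⟨h.1, h.2.mono (Icc_subset_Icc le_rfl hT)⟩

lemma exitTime_nonneg {g : RMetric (𝓡∂ d) M} {p : TM} (h : BddAbove (lifetimes g p)) :
    0 ≤ exitTime g p := le_csSup h (zero_mem_lifetimes g p)

lemma le_exitTime {g : RMetric (𝓡∂ d) M} {p : TM} (h : BddAbove (lifetimes g p)) {T : ℝ}
    (hT : 0 ≤ T) {β : ℝ → TM} (hβ : IsGeodesicOrbit g p T β) : T ≤ exitTime g p :=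
  le_csSup h ⟨hT, β, hβ⟩

lemma IsGeodesicOrbit.shift {g : RMetric (𝓡∂ d) M} {p : TM} {T : ℝ} {β : ℝ → TM}
    (h : IsGeodesicOrbit g p T β) {t : ℝ} (ht : 0 ≤ t) :
    IsGeodesicOrbit g (β t) (T - t) (fun s => β (t + s)) :=
  ⟨by simp, (isMIntegralCurveOn_shift (s := t) h.2).mono (Icc_subset_Icc (by linarith) le_rfl)⟩

/-- Concatenation of orbits. -/
lemma IsGeodesicOrbit.exists_append {g : RMetric (𝓡∂ d) M} {p : TM} {T S : ℝ} {β β' : ℝ → TM}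
    (h : IsGeodesicOrbit g p T β) (hT : 0 ≤ T) (h' : IsGeodesicOrbit g (β T) S β') (hS : 0 ≤ S) :
    ∃ β'', IsGeodesicOrbit g p (T + S) β'' ∧ EqOn β'' β (Icc 0 T) := by
  have g1 : EqOn (fun t => if t ≤ T then β t else β' (t - T)) β (Icc 0 T) := fun t ht => if_pos ht.2
  have g2 : EqOn (fun t => if t ≤ T then β t else β' (t - T)) (fun t => β' (-T + t))
      (Icc T (T + S)) := fun t ht => by
    rcases ht.1.eq_or_lt with h1 | h1
    · simp only [← h1, le_refl, if_true, neg_add_cancel, h'.1]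
    · simp only [if_neg (not_le.2 h1), sub_eq_neg_add]
  refine ⟨fun t => if t ≤ T then β t else β' (t - T), ⟨by simp [hT, h.1], ?_⟩, g1⟩
  refine isMIntegralCurveOn_union_Icc hT (by linarith) (isMIntegralCurveOn_congr h.2 g1)
    (isMIntegralCurveOn_congr (β := fun t => β' (-T + t)) ?_ g2)
  have h3 := isMIntegralCurveOn_shift (s := -T) h'.2
  rwa [sub_neg_eq_add, sub_neg_eq_add, zero_add, add_comm S] at h3

variable [T2Space M]

/-- Orbits exist in both directions near interior points. -/
lemma exists_orbit_of_notMem_boundary (g : RMetric (𝓡∂ d) M) {p : TM}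
    (hp : p.1 ∉ (𝓡∂ d).boundary M) : ∃ (δ : ℝ) (β : ℝ → TM), 0 < δ ∧ β 0 = p ∧
      IsMIntegralCurveOn (I := (𝓡∂ d).tangent) β (geodesicField g) (Icc (-δ) δ) := by
  obtain ⟨φ, ε, O, hε, hO, hφ, H⟩ := exists_chart_flow g p
  obtain ⟨hps, h0, hc, horb, -⟩ := H p (mem_of_mem_nhds hO)
  have hpos : 0 < height d (φ (0, extChartAt (𝓡∂ d).tangent p p)) := by
    rw [h0]; exact height_pos_of_notMem_boundary hps hp
  have hev : ∀ᶠ y in 𝓝 ((0 : ℝ), extChartAt (𝓡∂ d).tangent p p), 0 < height d (φ y) :=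
    ((height d).continuous.continuousAt.comp hφ).eventually (lt_mem_nhds hpos)
  obtain ⟨δ, hδ, hbox⟩ := exists_box hev
  refine ⟨min ε (δ / 2), _, lt_min hε (half_pos hδ), ?_,
    horb _ _ ?_ (min_le_left _ _) fun t ht => ?_⟩
  · simp only [h0]
    exact (extChartAt (𝓡∂ d).tangent p).left_inv hps
  · exact neg_le_neg (min_le_left _ _)
  · refine (hbox t _ ?_ (by simpa using hδ)).le
    have h1 : |t| ≤ min ε (δ / 2) := abs_le.2 ht
    linarith [min_le_right ε (δ / 2)]

/-- The orbit of a unit vector exists up to the exit time, which is attained. -/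
theorem exists_orbit_exitTime [CompactSpace M] {g : RMetric (𝓡∂ d) M} (hnt : NonTrapping g)
    {p : TM} (hp : p ∈ unitTangent g) : ∃ β, IsGeodesicOrbit g p (exitTime g p) β := by
  have hbdd := hnt p hp
  set τ := exitTime g p with hτ
  have hτ0 : 0 ≤ τ := exitTime_nonneg hbdd
  have hex : ∀ t, t < τ → ∃ β, IsGeodesicOrbit g p t β := fun t ht => by
    obtain ⟨T, ⟨-, β, hβ⟩, hT⟩ := exists_lt_of_lt_csSup ⟨0, zero_mem_lifetimes g p⟩ ht
    exact ⟨β, hβ.mono hT.le⟩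
  rcases hτ0.eq_or_lt with h | hτpos
  · rw [← h]
    exact (zero_mem_lifetimes g p).2
  have hne : Nonempty (ℝ → TM) := ⟨fun _ => p⟩
  choose! B hB using hex
  -- a cluster point of the orbit as the time tends to the exit time
  have hmem : ∀ᶠ t in 𝓝[<] τ, B t t ∈ unitTangent g := by
    filter_upwards [Ioo_mem_nhdsLT hτpos] with t ht
    refine mem_unitTangent_of_isMIntegralCurveOn (hB t ht.2).2 (left_mem_Icc.2 ht.1.le) ?_
      (right_mem_Icc.2 ht.1.le)
    rwa [(hB t ht.2).1]
  obtain ⟨q, -, hq⟩ := (isCompact_unitTangent g).exists_mapClusterPt_of_frequently hmem.frequently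
  obtain ⟨φ, ε, O, hε, hO, -, H⟩ := exists_chart_flow g q
  have hfr := hq.frequently hO
  obtain ⟨t₀, ht₀O, ht₀, ht₀'⟩ : ∃ t₀, B t₀ t₀ ∈ O ∧ t₀ ∈ Ioo 0 τ ∧ τ - ε < t₀ := by
    have h1 : ∀ᶠ t in 𝓝[<] τ, t ∈ Ioo 0 τ ∧ τ - ε < t := by
      filter_upwards [Ioo_mem_nhdsLT hτpos, Ioo_mem_nhdsLT (show τ - ε < τ by linarith)]
        with t h2 h3 using ⟨h2, h3.1⟩
    exact (hfr.and_eventually h1).exists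
  obtain ⟨hps, h0, hc, horb, huniq⟩ := H _ ht₀O
  set z := extChartAt (𝓡∂ d).tangent q (B t₀ t₀) with hz
  have hagree : ∀ T, t₀ ≤ T → T < τ →
      IsGeodesicOrbit g (B t₀ t₀) (T - t₀) (fun s => B T (t₀ + s)) :=
    fun T h1 h2 => by
      have h3 := (hB T h2).shift ht₀.1.le
      rwa [((hB T h2).mono h1).eqOn (hB t₀ ht₀.2) (right_mem_Icc.2 ht₀.1.le)] at h3
  have hpos : ∀ s ∈ Ico 0 (τ - t₀), 0 ≤ height d (φ (s, z)) := fun s hs => by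
    have h1 := huniq (t₀ + s - t₀) (by linarith [hs.2]) _
      (hagree (t₀ + s) (by linarith [hs.1]) (by linarith [hs.2])) s ⟨hs.1, by linarith⟩
    rw [← h1.2]
    exact height_extChartAt_nonneg _ _
  have hpos' : ∀ s ∈ Icc 0 (τ - t₀), 0 ≤ height d (φ (s, z)) := by
    have hcl : closure (Ico 0 (τ - t₀)) = Icc 0 (τ - t₀) := closure_Ico (by linarith [ht₀.2])
    intro s hs
    rw [← hcl] at hs
    have : (𝓝[Ico 0 (τ - t₀)] s).NeBot := mem_closure_iff_nhdsWithin_neBot.1 hs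
    rw [hcl] at hs
    have h1 : Tendsto (fun t => φ (t, z)) (𝓝[Ico 0 (τ - t₀)] s) (𝓝 (φ (s, z))) :=
      (hc s ⟨by linarith [hs.1], by linarith [hs.2]⟩).mono
        (Ico_subset_Icc_self.trans (Icc_subset_Icc (by linarith) (by linarith)))
    refine ge_of_tendsto (((height d).continuous.tendsto _).comp h1) ?_
    filter_upwards [self_mem_nhdsWithin] with r hr using hpos r hr
  have hlast := horb 0 (τ - t₀) (by linarith) (by linarith) hpos'
  obtain ⟨β, hβ, -⟩ := (hB t₀ ht₀.2).exists_append ht₀.1.le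
    (S := τ - t₀) ⟨by rw [h0]; exact (extChartAt (𝓡∂ d).tangent q).left_inv hps, hlast⟩
    (by linarith [ht₀.2])
  rw [add_sub_cancel] at hβ
  exact ⟨β, hβ⟩

/-- At the exit time, an orbit is at the boundary. -/
theorem mem_boundarySM_exitTime {g : RMetric (𝓡∂ d) M} (hnt : NonTrapping g)
    {p : TM} (hp : p ∈ unitTangent g) {β : ℝ → TM} (hβ : IsGeodesicOrbit g p (exitTime g p) β) :
    β (exitTime g p) ∈ boundarySM g := by
  have hτ0 := exitTime_nonneg (hnt p hp)
  refine ⟨mem_unitTangent_of_isMIntegralCurveOn hβ.2 (left_mem_Icc.2 hτ0) (hβ.1.symm ▸ hp)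
    (right_mem_Icc.2 hτ0), ?_⟩
  by_contra h
  obtain ⟨δ, β', hδ, hβ'0, hβ'⟩ := exists_orbit_of_notMem_boundary g h
  obtain ⟨β'', hβ'', -⟩ := hβ.exists_append hτ0 (S := δ)
    ⟨hβ'0, hβ'.mono (Icc_subset_Icc (by linarith) le_rfl)⟩ hδ.le
  have := le_exitTime (hnt p hp) (by linarith) hβ''
  linarith

lemma exitTime_of_orbit [CompactSpace M] {g : RMetric (𝓡∂ d) M} (hnt : NonTrapping g)
    {p : TM} (hp : p ∈ unitTangent g) {T : ℝ} (hT : 0 ≤ T) {β : ℝ → TM}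
    (hβ : IsGeodesicOrbit g p T β) : exitTime g (β T) = exitTime g p - T := by
  have hpT : β T ∈ unitTangent g := mem_unitTangent_of_isMIntegralCurveOn hβ.2
    (left_mem_Icc.2 hT) (hβ.1.symm ▸ hp) (right_mem_Icc.2 hT)
  obtain ⟨β', hβ'⟩ := exists_orbit_exitTime hnt hp
  have hle := le_exitTime (hnt p hp) hT hβ
  refine le_antisymm ?_ ?_
  · obtain ⟨β₂, hβ₂⟩ := exists_orbit_exitTime hnt hpT
    have h0 := exitTime_nonneg (hnt _ hpT)
    obtain ⟨β₃, hβ₃, -⟩ := hβ.exists_append hT hβ₂ h0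
    linarith [le_exitTime (hnt p hp) (by linarith) hβ₃]
  · have h1 := hβ'.shift hT
    rw [(hβ'.mono hle).eqOn hβ (right_mem_Icc.2 hT)] at h1
    exact le_exitTime (hnt _ hpT) (by linarith) h1

end

/-! ### Regularity of transported functions on the unit tangent bundle -/

section

variable {E : Type*} [NormedAddCommGroup E] [NormedSpace ℝ E] {H : Type*} [TopologicalSpace H]
  {I : ModelWithCorners ℝ E H} {M : Type*} [TopologicalSpace M] [ChartedSpace H M]
  [IsManifold I ∞ M]

/-- The projection `(x, v) ↦ (x, v/|v|)` to the unit tangent bundle. -/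
noncomputable def unitize (g : RMetric I M) (q : TangentBundle I M) : TangentBundle I M :=
  ⟨q.1, (√(g.inner q.1 q.2 q.2))⁻¹ • q.2⟩

lemma unitize_of_mem {g : RMetric I M} {p : TangentBundle I M} (hp : p ∈ unitTangent g) :
    unitize g p = p := by
  have h : g.inner p.1 p.2 p.2 = 1 := hp
  rw [unitize, h, Real.sqrt_one, inv_one, one_smul]

lemma apply_normalize_self {b : E →L[ℝ] E →L[ℝ] ℝ} {v : E} (h : 0 < b v v) :
    b ((√(b v v))⁻¹ • v) ((√(b v v))⁻¹ • v) = 1 := by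
  simp only [map_smul, smul_apply, smul_eq_mul]
  rw [← mul_assoc, ← mul_inv, Real.mul_self_sqrt h.le]
  exact inv_mul_cancel₀ h.ne'

lemma unitize_mem {g : RMetric I M} {p : TangentBundle I M}
    (hp : 0 < metricAt g p.1 p.2 p.2) : unitize g p ∈ unitTangent g :=
  apply_normalize_self (b := metricAt g p.1) (v := p.2) hp

lemma eventually_metricAt_pos {g : RMetric I M} {p : TangentBundle I M} (hp : p ∈ unitTangent g) :
    ∀ᶠ p' in 𝓝 p, 0 < metricAt g p'.1 p'.2 p'.2 := by
  have h : 0 < metricAt g p.1 p.2 p.2 := by rw [mem_unitTangent_iff.1 hp]; exact one_pos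
  exact (contMDiff_metricAt g).continuous.continuousAt.eventually (lt_mem_nhds h)

lemma contMDiffAt_unitize {g : RMetric I M} {p : TangentBundle I M} (hp : p ∈ unitTangent g) :
    ContMDiffAt I.tangent I.tangent ∞ (unitize g) p := by
  have hid := contMDiffAt_totalSpace.1
    (contMDiffAt_id (I := I.tangent) (n := ∞) (x := p))
  refine contMDiffAt_totalSpace.2 ⟨hid.1, ?_⟩
  have h : metricAt g p.1 p.2 p.2 ≠ 0 := by rw [mem_unitTangent_iff.1 hp]; exact one_ne_zero
  have hs : ContMDiffAt I.tangent 𝓘(ℝ, ℝ) ∞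
      (fun p : TangentBundle I M => (√(metricAt g p.1 p.2 p.2))⁻¹) p := by
    have h1 : ContDiffAt ℝ ∞ (fun x : ℝ => (√x)⁻¹) (metricAt g p.1 p.2 p.2) :=
      (Real.contDiffAt_sqrt h).inv (by
        rw [mem_unitTangent_iff.1 hp]; simp)
    exact ContMDiffAt.comp p (g := fun x : ℝ => (√x)⁻¹)
      (f := fun p : TangentBundle I M => metricAt g p.1 p.2 p.2) h1.contMDiffAt
      (contMDiff_metricAt g p)
  have h2 := hs.smul hid.2
  refine h2.congr_of_eventuallyEq (Eventually.of_forall fun p' => ?_)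
  exact map_smul (tangentCoordChange I p'.1 p.1 p'.1) (√(metricAt g p'.1 p'.2 p'.2))⁻¹ (p'.2 : E)

variable {W : Type*} [NormedAddCommGroup W] [NormedSpace ℝ W]

/-- A smooth function on the unit tangent bundle extends smoothly off it. -/
lemma SmoothOnSM.contMDiffAt_unitize {g : RMetric I M} {f : TangentBundle I M → W}
    (hf : SmoothOnSM g f) {p : TangentBundle I M} (hp : p ∈ unitTangent g) :
    ContMDiffAt I.tangent 𝓘(ℝ, W) ∞ (fun p => f (unitize g p)) p := by
  have h1 : ContMDiffWithinAt I.tangent 𝓘(ℝ, W) ∞ f (unitTangent g) (unitize g p) := by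
    rw [unitize_of_mem hp]; exact hf p hp
  rw [← contMDiffWithinAt_univ]
  have hev := (eventually_metricAt_pos hp).mono fun p' hp' => unitize_mem hp'
  refine ContMDiffWithinAt.mono_of_mem_nhdsWithin (ContMDiffWithinAt.comp' p h1
    (GeodesicTransport.contMDiffAt_unitize hp).contMDiffWithinAt (s := univ)) ?_
  rw [univ_inter, nhdsWithin_univ]
  exact hev

lemma contDiffWithinAt_chart_of_contMDiffAt {f : TangentBundle I M → W} {p : TangentBundle I M}
    (hf : ContMDiffAt I.tangent 𝓘(ℝ, W) ∞ f p) :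
    ContDiffWithinAt ℝ ∞ (f ∘ (extChartAt I.tangent p).symm) (range I.tangent)
      (extChartAt I.tangent p p) := by
  have h := (contMDiffAt_iff.1 hf).2
  rw [extChartAt_model_space_eq_id] at h
  exact h

end

section

variable {d : ℕ} [NeZero d] {M : Type*} [TopologicalSpace M]
  [ChartedSpace (EuclideanHalfSpace d) M] [IsManifold (𝓡∂ d) ∞ M]

local notation "TM" => TangentBundle (𝓡∂ d) M

lemma exists_extension_smoothOnSM {W : Type} [NormedAddCommGroup W] [NormedSpace ℝ W]
    {g : RMetric (𝓡∂ d) M} {N : TM → W} (hN : SmoothOnSM g N) {q : TM} (hq : q ∈ unitTangent g)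
    (m : ℕ) : ∃ N' : EuclideanSpace ℝ (Fin d) × EuclideanSpace ℝ (Fin d) → W, ContDiff ℝ m N' ∧
      ∃ r > 0, ∀ z ∈ ball (extChartAt (𝓡∂ d).tangent q q) r, 0 ≤ height d z →
        (extChartAt (𝓡∂ d).tangent q).symm z ∈ unitTangent g →
        N' z = N ((extChartAt (𝓡∂ d).tangent q).symm z) := by
  have h1 := contDiffWithinAt_chart_of_contMDiffAt (hN.contMDiffAt_unitize hq)
  rw [range_tangent_eq] at h1
  obtain ⟨N', hN', he⟩ := exists_contDiff_extension (n := m) (height d) (height_ne_zero d)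
    (height_extChartAt_nonneg q q) (h1.of_le (by exact_mod_cast le_top))
  obtain ⟨r, hr, H⟩ := Metric.eventually_nhds_iff_ball.1 he
  refine ⟨N', hN', r, hr, fun z hz hz' hz'' => ?_⟩
  rw [H z hz hz', Function.comp_apply, unitize_of_mem hz'']

/-- The covector represented by the outer unit normal. -/
lemma exists_metricAt_outerNormal (g : RMetric (𝓡∂ d) M) (x : M) :
    ∃ c : ℝ, 0 ≤ c ∧ ∀ w : EuclideanSpace ℝ (Fin d),
      metricAt g x (outerNormal g x) w = -(c * w 0) := by
  set m : EuclideanSpace ℝ (Fin d) := sharp g x (boundaryConormal x) with hm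
  set c : ℝ := (√(metricAt g x m m))⁻¹ with hc
  have hinv : (metricAt g x).IsInvertible :=
    isInvertible_of_posDef fun v hv => metricAt_pos g x hv
  have h1 : metricAt g x m = boundaryConormal x := apply_inverse_of_isInvertible hinv _
  refine ⟨c, inv_nonneg.2 (Real.sqrt_nonneg _), fun w => ?_⟩
  have h2 : metricAt g x (-(c • m)) w = -(c * w 0) := by
    have h3 : metricAt g x m w = w 0 := DFunLike.congr_fun h1 w
    rw [map_neg, map_smul, neg_apply, smul_apply, h3, smul_eq_mul]
  exact h2

/-- Strict convexity of the boundary, in coordinates: geodesics tangent to the boundary bend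
outwards. -/
lemma christoffel_pos_of_strictlyConvex {g : RMetric (𝓡∂ d) M} (hconv : StrictlyConvexBoundary g)
    {q : TM} (hq : q ∈ boundarySM g)
    (hv : height d (chartSpray g q (extChartAt (𝓡∂ d).tangent q q)) = 0) :
    (chartSpray g q (extChartAt (𝓡∂ d).tangent q q)).2 0 < 0 := by
  rw [← geodesicField_eq] at hv ⊢
  have hv0 : boundaryConormal q.1 q.2 = 0 := hv
  have hne : q.2 ≠ 0 := fun h => by
    have h1 : g.inner q.1 q.2 q.2 = 1 := hq.1
    rw [h] at h1
    simp at h1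
  have hII := hconv q.1 hq.2 q.2 hv0 hne
  set Γ : EuclideanSpace ℝ (Fin d) := christoffel g q.1 q.2 q.2 with hΓ
  obtain ⟨c, hc0, hc⟩ := exists_metricAt_outerNormal g q.1
  have h2 : secondFundamentalForm g q.1 q.2 = -metricAt g q.1 (outerNormal g q.1) Γ := rfl
  rw [h2, hc, neg_neg] at hII
  have h4 : 0 < Γ 0 := pos_of_mul_pos_right hII hc0
  change (-Γ) 0 < 0
  simpa using h4

lemma hasRegularTransport_of_mem_boundarySM {V : Type} [NormedAddCommGroup V] [NormedSpace ℝ V]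
    [FiniteDimensional ℝ V] {g : RMetric (𝓡∂ d) M} (hconv : StrictlyConvexBoundary g) {q : TM}
    (hq : q ∈ boundarySM g) {k m : ℕ} (hk : k ≠ 0) (hm : 2 * k + 3 ≤ m)
    {Y : EuclideanSpace ℝ (Fin d) × EuclideanSpace ℝ (Fin d) →
      EuclideanSpace ℝ (Fin d) × EuclideanSpace ℝ (Fin d)} (hY : ContDiff ℝ m Y) {r : ℝ}
    (hr : 0 < r) (hYr : ∀ z ∈ ball (extChartAt (𝓡∂ d).tangent q q) r, 0 ≤ height d z →
      z ∈ (extChartAt (𝓡∂ d).tangent q).target ∧ Y z = chartSpray g q z)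
    {N : EuclideanSpace ℝ (Fin d) × EuclideanSpace ℝ (Fin d) → V →L[ℝ] V} (hN : ContDiff ℝ m N)
    (w₀ : V) :
    HasRegularTransport Y N w₀ (height d) (extChartAt (𝓡∂ d).tangent q q) k := by
  set z₀ := extChartAt (𝓡∂ d).tangent q q with hz₀
  have h0 : height d z₀ = 0 := (mem_boundary_iff_height (mem_extChartAt_source q)).1 hq.2
  have hkm : (k : ℕ∞ω) ≤ m := by exact_mod_cast (by omega : k ≤ m)
  by_cases h1 : height d (Y z₀) = 0
  · refine hasRegularTransport_of_glancing hm hY hN w₀ h0 h1 ?_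
    have hYz : Y z₀ = chartSpray g q z₀ := (hYr z₀ (mem_ball_self hr) h0.ge).2
    have hu : UniqueDiffWithinAt ℝ {z | 0 ≤ height d z} z₀ := by
      rw [← range_tangent_eq]
      exact (𝓡∂ d).tangent.uniqueDiffOn _ (mem_range_self _)
    have hd : HasFDerivAt Y (fderiv ℝ Y z₀) z₀ :=
      (hY.differentiable (by exact_mod_cast (by omega : m ≠ 0)) z₀).hasFDerivAt
    -- on the half-space, the height of `Y` at `(y, v)` is the first coordinate of `v`
    let π₂ : EuclideanSpace ℝ (Fin d) × EuclideanSpace ℝ (Fin d) →L[ℝ] ℝ :=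
      (EuclideanSpace.proj (0 : Fin d) : EuclideanSpace ℝ (Fin d) →L[ℝ] ℝ).comp
        (ContinuousLinearMap.snd ℝ _ _)
    have h2 : HasFDerivWithinAt (fun z => height d (Y z)) ((height d).comp (fderiv ℝ Y z₀))
        {z | 0 ≤ height d z} z₀ := ((height d).hasFDerivAt.comp z₀ hd).hasFDerivWithinAt
    have h3 : HasFDerivWithinAt (fun z => height d (Y z)) π₂ {z | 0 ≤ height d z} z₀ := by
      refine π₂.hasFDerivWithinAt.congr_of_eventuallyEq ?_ ?_
      · filter_upwards [self_mem_nhdsWithin, nhdsWithin_le_nhds (ball_mem_nhds z₀ hr)] with z hz hz'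
        rw [(hYr z hz' hz).2]
        rfl
      · rw [hYz]; rfl
    have h4 := DFunLike.congr_fun (hu.eq h2 h3) (Y z₀)
    change height d (fderiv ℝ Y z₀ (Y z₀)) = (Y z₀).2 0 at h4
    rw [h4, hYz]
    exact christoffel_pos_of_strictlyConvex hconv hq (hYz ▸ h1)
  · exact hasRegularTransport_of_transversal hk (hY.of_le hkm) (hN.of_le hkm) w₀ h0 h1

/-- `U` is transported by `N` along the orbits of the geodesic flow in the unit tangent bundle. -/
def IsTransported {V : Type} [NormedAddCommGroup V] [NormedSpace ℝ V] (g : RMetric (𝓡∂ d) M)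
    (N : TM → V →L[ℝ] V) (U : TM → V) : Prop :=
  ∀ (β : ℝ → TM) (a b : ℝ),
    IsMIntegralCurveOn (I := (𝓡∂ d).tangent) β (geodesicField g) (Icc a b) →
    (∀ t ∈ Icc a b, β t ∈ unitTangent g) →
    ∀ t ∈ Icc a b, HasDerivWithinAt (fun t => U (β t)) (N (β t) (U (β t))) (Icc a b) t

variable {V : Type} [NormedAddCommGroup V] [NormedSpace ℝ V] [FiniteDimensional ℝ V]

/-- A transported function which is constant on the boundary is smooth near the boundary. -/
lemma contMDiffWithinAt_of_mem_boundarySM {g : RMetric (𝓡∂ d) M}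
    (hconv : StrictlyConvexBoundary g) {N : TM → V →L[ℝ] V} (hN : SmoothOnSM g N) {U : TM → V}
    (hU : IsTransported g N U) {w₀ : V} (hU₀ : ∀ p ∈ boundarySM g, U p = w₀) {k : ℕ} (hk : k ≠ 0)
    {q : TM} (hq : q ∈ boundarySM g) :
    ContMDiffWithinAt (𝓡∂ d).tangent 𝓘(ℝ, V) k U (unitTangent g) q := by
  obtain ⟨Y, hY, r₁, hr₁, hYr⟩ := exists_extension_chartSpray g q (2 * k + 3)
  obtain ⟨N', hN', r₂, hr₂, hNr⟩ := exists_extension_smoothOnSM hN hq.1 (2 * k + 3)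
  obtain ⟨U', hU', H⟩ := hasRegularTransport_of_mem_boundarySM hconv hq hk le_rfl hY hr₁ hYr hN' w₀
  set e := extChartAt (𝓡∂ d).tangent q with he
  have hev := H (ball (e q) (min r₁ r₂)) (ball_mem_nhds _ (lt_min hr₁ hr₂))
  have heq : ∀ᶠ p in 𝓝[unitTangent g] q, U p = U' (e p) := by
    filter_upwards [self_mem_nhdsWithin,
      nhdsWithin_le_nhds ((continuousAt_extChartAt (I := (𝓡∂ d).tangent) q).eventually hev),
      nhdsWithin_le_nhds ((isOpen_extChartAt_source (I := (𝓡∂ d).tangent) q).mem_nhds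
        (mem_extChartAt_source (I := (𝓡∂ d).tangent) q))]
      with p hp hev hps
    obtain ⟨a, b, c, ha, hb, hc0, hc, hcO, hW⟩ := hev (height_extChartAt_nonneg q p)
    have h1 : ∀ t ∈ Icc a b, c t ∈ ball (e q) r₁ ∧ 0 ≤ height d (c t) := fun t ht =>
      ⟨ball_subset_ball (min_le_left _ _) (hcO t ht).1, (hcO t ht).2⟩
    have horb := isMIntegralCurveOn_of_isODESolution hYr hc h1
    have h0 : (0 : ℝ) ∈ Icc a b := ⟨ha, hb⟩
    have hp0 : e.symm (c 0) = p := by rw [hc0]; exact e.left_inv hps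
    have hSM : ∀ t ∈ Icc a b, e.symm (c t) ∈ unitTangent g := fun t ht =>
      mem_unitTangent_of_isMIntegralCurveOn horb h0
        (show e.symm (c 0) ∈ unitTangent g by rw [hp0]; exact hp) ht
    have hbdry : ∀ t ∈ Icc a b, height d (c t) = 0 → U (e.symm (c t)) = w₀ := fun t ht h => by
      have h2 := (hYr _ (h1 t ht).1 (h1 t ht).2).1
      refine hU₀ _ ⟨hSM t ht, (mem_boundary_iff_height (e.map_target h2)).2 ?_⟩
      rw [← h]
      exact congrArg (height d) (e.right_inv h2)
    have h3 := hW (fun t => U (e.symm (c t))) (fun t ht => ?_)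
      (hbdry a (left_mem_Icc.2 (ha.trans hb)))
      (hbdry b (right_mem_Icc.2 (ha.trans hb)))
    · simp only [hp0] at h3
      exact h3
    · have h4 := hU _ a b horb hSM t ht
      rwa [← hNr (c t) (ball_subset_ball (min_le_right _ _) (hcO t ht).1) (hcO t ht).2 (hSM t ht)]
        at h4
  have hmain : ContMDiffWithinAt (𝓡∂ d).tangent 𝓘(ℝ, V) k (fun p => U' (e p))
      (unitTangent g) q := by
    refine ContMDiffWithinAt.comp q (g := U') (f := e) hU'.contMDiffWithinAt
      (contMDiffAt_extChartAt (n := k)).contMDiffWithinAt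
      (fun p _ => height_extChartAt_nonneg q p)
  exact hmain.congr_of_eventuallyEq heq (heq.self_of_nhdsWithin hq.1)

end

section

variable {d : ℕ} [NeZero d] {M : Type*} [TopologicalSpace M]
  [ChartedSpace (EuclideanHalfSpace d) M] [IsManifold (𝓡∂ d) ∞ M]
  {V : Type} [NormedAddCommGroup V] [NormedSpace ℝ V] [FiniteDimensional ℝ V]

local notation "TM" => TangentBundle (𝓡∂ d) M

/-- Along an orbit, the regularity of a transported function is locally constant near times at
which the orbit is in the interior. -/
lemma eventually_contMDiffWithinAt_iff_of_notMem_boundary {g : RMetric (𝓡∂ d) M}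
    {N : TM → V →L[ℝ] V} (hN : SmoothOnSM g N) {U : TM → V} (hU : IsTransported g N U) {k : ℕ}
    (hk : k ≠ 0) {γ : ℝ → TM} {a b t₀ : ℝ}
    (hγ : IsMIntegralCurveOn (I := (𝓡∂ d).tangent) γ (geodesicField g) (Icc a b))
    (ht₀ : t₀ ∈ Icc a b) (hSM : γ t₀ ∈ unitTangent g) (hint : (γ t₀).1 ∉ (𝓡∂ d).boundary M) :
    ∀ᶠ t in 𝓝[Icc a b] t₀,
      (ContMDiffWithinAt (𝓡∂ d).tangent 𝓘(ℝ, V) k U (unitTangent g) (γ t) ↔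
        ContMDiffWithinAt (𝓡∂ d).tangent 𝓘(ℝ, V) k U (unitTangent g) (γ t₀)) := by
  have : IsManifold (𝓡∂ d).tangent k TM := IsManifold.of_le (n := ∞) (by exact_mod_cast le_top)
  obtain ⟨Y, hY, r₁, hr₁, hYr⟩ := exists_extension_chartSpray g (γ t₀) k
  obtain ⟨N', hN', r₂, hr₂, hNr⟩ := exists_extension_smoothOnSM hN hSM k
  obtain ⟨φ, ρ, hρ, hφ, hφODE, H⟩ := exists_flow_contDiffWithinAt_iff hk hY hN'
    (extChartAt (𝓡∂ d).tangent (γ t₀) (γ t₀))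
  set e := extChartAt (𝓡∂ d).tangent (γ t₀) with he
  set z₀ := e (γ t₀) with hz₀
  have hsrc : γ t₀ ∈ e.source := mem_extChartAt_source _
  have hφ0 : φ (0, z₀) = z₀ := (hφODE z₀ (mem_ball_self hρ)).1
  have hev : ∀ᶠ y in 𝓝 ((0 : ℝ), z₀), φ y ∈ ball z₀ (min r₁ r₂) ∧ 0 < height d (φ y) := by
    refine (hφ.eventually (?_ : ∀ᶠ z in 𝓝 (φ (0, z₀)), z ∈ ball z₀ (min r₁ r₂) ∧ 0 < height d z))
    rw [hφ0]
    exact Eventually.and (ball_mem_nhds _ (lt_min hr₁ hr₂))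
      ((height d).continuous.continuousAt.eventually
      (lt_mem_nhds (height_pos_of_notMem_boundary hsrc hint)))
  obtain ⟨ε, hε, hbox⟩ := exists_box hev
  set S := e.symm ⁻¹' unitTangent g ∩ range (𝓡∂ d).tangent with hS
  obtain ⟨ε', hε', hε'ρ, hε'ε⟩ : ∃ ε' > 0, ε' ≤ ρ ∧ ε' < ε :=
    ⟨min ρ (ε / 2), lt_min hρ (half_pos hε), min_le_left _ _,
      (min_le_right _ _).trans_lt (half_lt_self hε)⟩
  have hflow : ∀ z ∈ S ∩ ball z₀ ε', (∀ t ∈ Icc (-ε') ε', φ (t, z) ∈ S) ∧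
      IsTransport N' (fun t => φ (t, z)) (fun t => (U ∘ e.symm) (φ (t, z))) (-ε') ε' := by
    rintro z ⟨hzS, hzε⟩
    have h0 : (0 : ℝ) ∈ Icc (-ε') ε' := ⟨by linarith, hε'.le⟩
    have h1 : ∀ t ∈ Icc (-ε') ε', φ (t, z) ∈ ball z₀ (min r₁ r₂) ∧ 0 < height d (φ (t, z)) :=
      fun t ht => hbox t z ((abs_le.2 ht).trans_lt hε'ε) (lt_trans hzε hε'ε)
    obtain ⟨h2, h3⟩ := hφODE z (ball_subset_ball hε'ρ hzε)
    have horb := isMIntegralCurveOn_of_isODESolution hYr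
      (h3.mono (neg_le_neg hε'ρ) hε'ρ) fun t ht =>
        ⟨ball_subset_ball (min_le_left _ _) (h1 t ht).1, (h1 t ht).2.le⟩
    have hmem : ∀ t ∈ Icc (-ε') ε', e.symm (φ (t, z)) ∈ unitTangent g := fun t ht =>
      mem_unitTangent_of_isMIntegralCurveOn horb h0
        (show e.symm (φ (0, z)) ∈ unitTangent g by rw [h2]; exact hzS.1) ht
    refine ⟨fun t ht => ⟨hmem t ht, ?_⟩, fun t ht => ?_⟩
    · rw [range_tangent_eq]
      exact (h1 t ht).2.le
    · have h4 := hU _ _ _ horb hmem t ht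
      rwa [← hNr _ (ball_subset_ball (min_le_right _ _) (h1 t ht).1) (h1 t ht).2.le (hmem t ht)]
        at h4
  obtain ⟨δ, hδ, hδε, Hδ⟩ := H ε' hε' hε'ρ (U ∘ e.symm) S hflow
  have hz₀S : z₀ ∈ S := ⟨by
    rw [mem_preimage, hz₀, e.left_inv hsrc]; exact hSM, mem_range_self _⟩
  -- in the chart, the orbit is an orbit of the local flow
  have hγc : ContinuousWithinAt γ (Icc a b) t₀ := (hγ t₀ ht₀).1
  have hnear : ∀ᶠ t in 𝓝[Icc a b] t₀, γ t ∈ e.source ∧ e (γ t) ∈ ball z₀ r₁ :=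
    hγc.eventually (Eventually.and
      ((isOpen_extChartAt_source (I := (𝓡∂ d).tangent) (γ t₀)).mem_nhds hsrc)
      ((continuousAt_extChartAt (I := (𝓡∂ d).tangent) (γ t₀)).eventually (ball_mem_nhds _ hr₁)))
  obtain ⟨η, hη, Hη⟩ := Metric.mem_nhdsWithin_iff.1 hnear
  obtain ⟨η', hη', hη'η, hη'δ⟩ : ∃ η' > 0, η' < η ∧ η' < δ :=
    ⟨min (η / 2) (δ / 2), lt_min (half_pos hη) (half_pos hδ),
      (min_le_left _ _).trans_lt (half_lt_self hη), (min_le_right _ _).trans_lt (half_lt_self hδ)⟩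
  have hγ' := isMIntegralCurveOn_shift (s := t₀) hγ
  have hI : ∀ s ∈ Icc (max (a - t₀) (-η')) (min (b - t₀) η'),
      γ (t₀ + s) ∈ e.source ∧ e (γ (t₀ + s)) ∈ ball z₀ r₁ := fun s hs => by
    have h1 := max_le_iff.1 hs.1
    have h2 := le_min_iff.1 hs.2
    refine Hη ⟨?_, by linarith, by linarith⟩
    rw [mem_ball, Real.dist_eq, add_sub_cancel_left]
    exact (abs_le.2 ⟨h1.2, h2.2⟩).trans_lt hη'η
  have hc := isODESolution_extChartAt hYr
    (hγ'.mono (Icc_subset_Icc (le_max_left _ _) (min_le_left _ _))) hI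
  have h0mem : (0 : ℝ) ∈ Icc (max (a - t₀) (-η')) (min (b - t₀) η') :=
    ⟨max_le (by linarith [ht₀.1]) (by linarith), le_min (by linarith [ht₀.2]) hη'.le⟩
  have heq := hc.eqOn (hY.of_le (by exact_mod_cast Nat.one_le_iff_ne_zero.2 hk))
    ((hφODE z₀ (mem_ball_self hρ)).2.mono
      ((neg_le_neg (by linarith)).trans (le_max_right _ _))
      ((min_le_right _ _).trans (by linarith))) h0mem (by
      change e (γ (t₀ + 0)) = φ (0, z₀)
      rw [add_zero, hφ0])
  have hconv : ∀ p ∈ e.source, (ContMDiffWithinAt (𝓡∂ d).tangent 𝓘(ℝ, V) k U (unitTangent g) p ↔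
      ContDiffWithinAt ℝ k (U ∘ e.symm) S (e p)) := fun p hp => by
    rw [contMDiffWithinAt_iff_source_of_mem_source (x := γ t₀)
      (by rwa [he, extChartAt_source] at hp)]
    exact contMDiffWithinAt_iff_contDiffWithinAt
  filter_upwards [self_mem_nhdsWithin, nhdsWithin_le_nhds (ball_mem_nhds t₀ hη')] with t ht ht'
  have hs : |t - t₀| < η' := ht'
  have hsI : t - t₀ ∈ Icc (max (a - t₀) (-η')) (min (b - t₀) η') :=
    ⟨max_le (by linarith [ht.1]) (abs_lt.1 hs).1.le,
      le_min (by linarith [ht.2]) (abs_lt.1 hs).2.le⟩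
  have h1 := heq hsI
  have h2 := (hI _ hsI).1
  simp only [Function.comp_apply, add_sub_cancel] at h1 h2
  rw [hconv _ h2, hconv _ hsrc, h1]
  exact Hδ hz₀S _ (abs_lt.1 (hs.trans hη'δ))

/-- A function on `SM` which is transported along the geodesic flow, and constant on the boundary,
is smooth: it is smooth near the boundary, and regularity propagates along the orbits, all of
which reach the boundary. -/
theorem smoothOnSM_of_isTransported [T2Space M] [CompactSpace M] {g : RMetric (𝓡∂ d) M}
    (hconv : StrictlyConvexBoundary g) (hnt : NonTrapping g) {N : TM → V →L[ℝ] V}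
    (hN : SmoothOnSM g N) {U : TM → V} (hU : IsTransported g N U) {w₀ : V}
    (hU₀ : ∀ p ∈ boundarySM g, U p = w₀) : SmoothOnSM g U := by
  intro p hp
  suffices h : ∀ k : ℕ, k ≠ 0 →
      ContMDiffWithinAt (𝓡∂ d).tangent 𝓘(ℝ, V) k U (unitTangent g) p by
    refine contMDiffWithinAt_infty.2 fun k => (h (k + 1) k.succ_ne_zero).of_le ?_
    exact_mod_cast k.le_succ
  intro k hk
  have : IsManifold (𝓡∂ d).tangent k TM := IsManifold.of_le (n := ∞) (by exact_mod_cast le_top)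
  obtain ⟨β, hβ⟩ := exists_orbit_exitTime hnt hp
  have hτ := exitTime_nonneg (hnt p hp)
  have hmem : ∀ t ∈ Icc 0 (exitTime g p), β t ∈ unitTangent g := fun t ht =>
    mem_unitTangent_of_isMIntegralCurveOn hβ.2 (left_mem_Icc.2 hτ) (hβ.1.symm ▸ hp) ht
  have hend := mem_boundarySM_exitTime hnt hp hβ
  have hiff := isPreconnected_Icc.induction₂ (s := Icc 0 (exitTime g p)) (fun s t =>
    (ContMDiffWithinAt (𝓡∂ d).tangent 𝓘(ℝ, V) k U (unitTangent g) (β t) ↔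
      ContMDiffWithinAt (𝓡∂ d).tangent 𝓘(ℝ, V) k U (unitTangent g) (β s))) (fun t ht => ?_)
    (fun _ _ _ _ _ _ h1 h2 => h2.trans h1) (fun _ _ _ _ h => h.symm) (left_mem_Icc.2 hτ)
    (right_mem_Icc.2 hτ)
  · rw [← hβ.1]
    exact hiff.1 (contMDiffWithinAt_of_mem_boundarySM hconv hN hU hU₀ hk hend)
  · by_cases hb : (β t).1 ∈ (𝓡∂ d).boundary M
    · have h1 := contMDiffWithinAt_of_mem_boundarySM hconv hN hU hU₀ hk
        (show β t ∈ boundarySM g from ⟨hmem t ht, hb⟩)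
      have h2 := (contMDiffWithinAt_iff_contMDiffWithinAt_nhdsWithin (by simp)).1 h1
      rw [insert_eq_of_mem (hmem t ht)] at h2
      have h3 : Tendsto β (𝓝[Icc 0 (exitTime g p)] t) (𝓝[unitTangent g] (β t)) :=
        tendsto_nhdsWithin_iff.2 ⟨(hβ.2 t ht).1,
          eventually_mem_nhdsWithin.mono hmem⟩
      exact (h3.eventually h2).mono fun s hs => iff_of_true hs h1
    · exact eventually_contMDiffWithinAt_iff_of_notMem_boundary hN hU hk hβ.2 ht (hmem t ht) hb

end

/-! ### The derivative along the geodesic vector field -/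

section

variable {d : ℕ} [NeZero d] {M : Type*} [TopologicalSpace M]
  [ChartedSpace (EuclideanHalfSpace d) M] [IsManifold (𝓡∂ d) ∞ M]
  {V : Type} [NormedAddCommGroup V] [NormedSpace ℝ V]

local notation "TM" => TangentBundle (𝓡∂ d) M

/-- The derivative along the geodesic vector field at `p`, computed in the chart of `TM` at `q`. -/
noncomputable def chartDeriv (g : RMetric (𝓡∂ d) M) (f : TM → V) (q p : TM) : V :=
  fderivWithin ℝ ((fun p => f (unitize g p)) ∘ (extChartAt (𝓡∂ d).tangent q).symm)
    (range (𝓡∂ d).tangent) (extChartAt (𝓡∂ d).tangent q p)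
    (chartSpray g q (extChartAt (𝓡∂ d).tangent q p))

lemma geodesicDeriv_eq_chartDeriv {g : RMetric (𝓡∂ d) M} {f : TM → V} (hf : SmoothOnSM g f)
    {p : TM} (hp : p ∈ unitTangent g) : geodesicDeriv g f p = chartDeriv g f p p := by
  have h : MDifferentiableAt (𝓡∂ d).tangent 𝓘(ℝ, V) (fun p => f (unitize g p)) p :=
    (hf.contMDiffAt_unitize hp).mdifferentiableAt (by simp)
  have h1 := h.mfderiv
  have h2 : (geodesicField g p : EuclideanSpace ℝ (Fin d) × EuclideanSpace ℝ (Fin d)) =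
    chartSpray g p (extChartAt (𝓡∂ d).tangent p p) := geodesicField_eq g p
  unfold chartDeriv
  rw [← h2]
  exact DFunLike.congr_fun h1 _

lemma contDiffWithinAt_unitize_symm {g : RMetric (𝓡∂ d) M} {f : TM → V} (hf : SmoothOnSM g f)
    {p q : TM} (hp : p ∈ unitTangent g) (hpq : p ∈ (extChartAt (𝓡∂ d).tangent q).source) :
    ContDiffWithinAt ℝ ∞ ((fun p => f (unitize g p)) ∘ (extChartAt (𝓡∂ d).tangent q).symm)
      (range (𝓡∂ d).tangent) (extChartAt (𝓡∂ d).tangent q p) := by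
  have h := hf.contMDiffAt_unitize hp
  rw [← contMDiffWithinAt_univ, contMDiffWithinAt_iff_source_of_mem_source (x := q)
    (by rwa [extChartAt_source] at hpq), contMDiffWithinAt_iff_contDiffWithinAt, preimage_univ,
    univ_inter] at h
  exact h

/-- The derivative of a smooth function along an orbit. -/
lemma hasDerivWithinAt_comp_orbit_chartDeriv {g : RMetric (𝓡∂ d) M} {f : TM → V}
    (hf : SmoothOnSM g f) {β : ℝ → TM} {J : Set ℝ}
    (hβ : IsMIntegralCurveOn (I := (𝓡∂ d).tangent) β (geodesicField g) J)
    (hSM : ∀ t ∈ J, β t ∈ unitTangent g) {t : ℝ} (ht : t ∈ J) {q : TM}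
    (hq : β t ∈ (extChartAt (𝓡∂ d).tangent q).source) :
    HasDerivWithinAt (fun t => f (β t)) (chartDeriv g f q (β t)) J t := by
  have h1 := hasDerivWithinAt_of_isMIntegralCurveOn hβ ht hq
  have h2 := ((contDiffWithinAt_unitize_symm hf (hSM t ht) hq).differentiableWithinAt
    (by simp)).hasFDerivWithinAt
  have h3 := HasFDerivWithinAt.comp_hasDerivWithinAt (t := range (𝓡∂ d).tangent)
    (f := extChartAt (𝓡∂ d).tangent q ∘ β) t h2 h1 (fun s _ => mem_range_self _)
  refine h3.congr_of_eventuallyEq ?_ ?_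
  · filter_upwards [self_mem_nhdsWithin,
      (hβ t ht).1 ((isOpen_extChartAt_source (I := (𝓡∂ d).tangent) q).mem_nhds hq)] with s hs hs'
    simp only [Function.comp_apply]
    rw [(extChartAt (𝓡∂ d).tangent q).left_inv hs', unitize_of_mem (hSM s hs)]
  · simp only [Function.comp_apply]
    rw [(extChartAt (𝓡∂ d).tangent q).left_inv hq, unitize_of_mem (hSM t ht)]

lemma hasDerivWithinAt_comp_orbit {g : RMetric (𝓡∂ d) M} {f : TM → V}
    (hf : SmoothOnSM g f) {β : ℝ → TM} {J : Set ℝ}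
    (hβ : IsMIntegralCurveOn (I := (𝓡∂ d).tangent) β (geodesicField g) J)
    (hSM : ∀ t ∈ J, β t ∈ unitTangent g) {t : ℝ} (ht : t ∈ J) :
    HasDerivWithinAt (fun t => f (β t)) (geodesicDeriv g f (β t)) J t := by
  rw [geodesicDeriv_eq_chartDeriv hf (hSM t ht)]
  exact hasDerivWithinAt_comp_orbit_chartDeriv hf hβ hSM ht (mem_extChartAt_source _)

lemma continuousAt_chartDeriv {g : RMetric (𝓡∂ d) M} {f : TM → V} (hf : SmoothOnSM g f)
    {q : TM} (hq : q ∈ unitTangent g) :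
    ContinuousAt (chartDeriv g f q) q := by
  have h1 := (contDiffWithinAt_unitize_symm hf hq (mem_extChartAt_source q)).fderivWithin_right
    (m := 0) (𝓡∂ d).tangent.uniqueDiffOn (by simp) (mem_range_self _)
  have h2 := (contDiffWithinAt_chartSpray g (mem_extChartAt_target (I := (𝓡∂ d).tangent) q))
  have h3 := h1.continuousWithinAt.clm_apply h2.continuousWithinAt
  have h4 : Tendsto (extChartAt (𝓡∂ d).tangent q) (𝓝 q)
      (𝓝[range (𝓡∂ d).tangent] (extChartAt (𝓡∂ d).tangent q q)) :=
    tendsto_nhdsWithin_iff.2 ⟨continuousAt_extChartAt (I := (𝓡∂ d).tangent) q,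
      Eventually.of_forall fun p => mem_range_self _⟩
  exact h3.tendsto.comp h4

/-- Interior points are dense in the unit tangent bundle. -/
lemma mem_closure_notMem_boundary {g : RMetric (𝓡∂ d) M} {q : TM} (hq : q ∈ unitTangent g) :
    q ∈ closure {p | p ∈ unitTangent g ∧ p.1 ∉ (𝓡∂ d).boundary M} := by
  set e := extChartAt (𝓡∂ d).tangent q with he
  let z : ℝ → EuclideanSpace ℝ (Fin d) × EuclideanSpace ℝ (Fin d) := fun s =>
    e q + s • (EuclideanSpace.single (0 : Fin d) (1 : ℝ), 0)
  have hz : Continuous z := by fun_prop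
  have hz0 : z 0 = e q := by simp [z]
  have hheight : ∀ s, height d (z s) = height d (e q) + s := fun s => by
    simp only [z, map_add, map_smul, height_apply, smul_eq_mul]
    simp
  have h0 := height_extChartAt_nonneg q q
  have htend : Tendsto z (𝓝[>] 0) (𝓝[range (𝓡∂ d).tangent] (e q)) := by
    refine tendsto_nhdsWithin_iff.2 ⟨?_, ?_⟩
    · rw [← hz0]
      exact hz.continuousAt.mono_left nhdsWithin_le_nhds
    · filter_upwards [self_mem_nhdsWithin] with s hs
      rw [range_tangent_eq, mem_ofPred_eq, hheight]
      exact add_nonneg h0 (le_of_lt hs)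
  have htarget : ∀ᶠ s in 𝓝[>] (0 : ℝ), z s ∈ e.target :=
    htend (extChartAt_target_mem_nhdsWithin (I := (𝓡∂ d).tangent) q)
  have hsymm : Tendsto (fun s => e.symm (z s)) (𝓝[>] 0) (𝓝 q) := by
    have h1 : ContinuousAt e.symm (e q) := continuousAt_extChartAt_symm (I := (𝓡∂ d).tangent) q
    have h2 : Tendsto e.symm (𝓝 (e q)) (𝓝 q) := by
      have h3 := h1.tendsto
      rwa [e.left_inv (mem_extChartAt_source q)] at h3
    exact h2.comp (htend.mono_right nhdsWithin_le_nhds)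
  have hunit : Tendsto (unitize g) (𝓝 q) (𝓝 q) := by
    have h1 := (contMDiffAt_unitize hq).continuousAt.tendsto
    rwa [unitize_of_mem hq] at h1
  refine mem_closure_of_tendsto (hunit.comp hsymm) ?_
  filter_upwards [htarget, self_mem_nhdsWithin,
    hsymm.eventually (eventually_metricAt_pos hq)] with s hs hs0 hpos
  refine ⟨unitize_mem hpos, fun hb => ?_⟩
  have h1 := (mem_boundary_iff_height (e.map_target hs)).1
    (show (e.symm (z s)).1 ∈ (𝓡∂ d).boundary M from hb)
  have h2 : height d (e (e.symm (z s))) = height d (z s) := congrArg (height d) (e.right_inv hs)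
  have h3 : height d (z s) = 0 := h2.symm.trans h1
  rw [hheight] at h3
  have hs1 : (0 : ℝ) < s := hs0
  linarith

/-- The derivative along the geodesic vector field of a transported function. At interior points
it is the derivative along an orbit; at boundary points, where there may be no orbit, the equation
follows by continuity. -/
lemma geodesicDeriv_of_isTransported [T2Space M] {g : RMetric (𝓡∂ d) M} {N : TM → V →L[ℝ] V}
    (hN : SmoothOnSM g N) {U : TM → V} (hU : SmoothOnSM g U) (hNU : IsTransported g N U) {q : TM}
    (hq : q ∈ unitTangent g) : geodesicDeriv g U q = N q (U q) := by
  rw [geodesicDeriv_eq_chartDeriv hU hq]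
  set S := {p : TM | p ∈ unitTangent g ∧ p.1 ∉ (𝓡∂ d).boundary M} with hS
  have hne : (𝓝[S] q).NeBot := mem_closure_iff_nhdsWithin_neBot.1 (mem_closure_notMem_boundary hq)
  have h1 : Tendsto (chartDeriv g U q) (𝓝[S] q) (𝓝 (chartDeriv g U q q)) :=
    (continuousAt_chartDeriv hU hq).mono_left nhdsWithin_le_nhds
  have h2 : Tendsto (fun p => N p (U p)) (𝓝[S] q) (𝓝 (N q (U q))) :=
    (((hN q hq).continuousWithinAt.clm_apply (hU q hq).continuousWithinAt).mono
      fun p hp => hp.1)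
  refine tendsto_nhds_unique_of_eventuallyEq h1 h2 ?_
  filter_upwards [self_mem_nhdsWithin, nhdsWithin_le_nhds
    ((isOpen_extChartAt_source (I := (𝓡∂ d).tangent) q).mem_nhds (mem_extChartAt_source q))]
    with p hp hpq
  obtain ⟨δ, β, hδ, hβ0, hβ⟩ := exists_orbit_of_notMem_boundary g hp.2
  have h0 : (0 : ℝ) ∈ Icc (-δ) δ := ⟨by linarith, hδ.le⟩
  have hSM : ∀ t ∈ Icc (-δ) δ, β t ∈ unitTangent g := fun t ht =>
    mem_unitTangent_of_isMIntegralCurveOn hβ h0 (hβ0.symm ▸ hp.1) ht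
  have h3 := hasDerivWithinAt_comp_orbit_chartDeriv hU hβ hSM h0 (q := q) (hβ0.symm ▸ hpq)
  have h4 := hNU β _ _ hβ hSM 0 h0
  have h5 := (uniqueDiffOn_Icc (show -δ < δ by linarith) 0 h0).eq_deriv _ h3 h4
  rwa [hβ0] at h5

end

/-! ### Matrix differential equations and scattering data -/

section

variable {n : ℕ}

local notation "Mat" => Matrix (Fin n) (Fin n) ℂ

lemma eq_of_hasDerivWithinAt_zero {W : ℝ → Mat} {a b : ℝ}
    (h : ∀ t ∈ Icc a b, HasDerivWithinAt W 0 (Icc a b) t) {s t : ℝ} (hs : s ∈ Icc a b)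
    (ht : t ∈ Icc a b) : W s = W t := by
  have h1 := (convex_Icc a b).norm_image_sub_le_of_norm_hasDerivWithin_le (C := 0)
    (f' := fun _ => (0 : Mat)) h (fun _ _ => by simp) ht hs
  rw [zero_mul] at h1
  exact sub_eq_zero.1 (norm_le_zero_iff.1 h1)

/-- The fundamental solution of `V' = -α V` with `V(b) = 1`, and its inverse, the solution of
`Z' = Z α` with `Z(b) = 1`. -/
lemma exists_fundamental_solution {α : ℝ → Mat} {a b : ℝ} (hab : a ≤ b)
    (hα : ContinuousOn α (Icc a b)) :
    ∃ V Z : ℝ → Mat, V b = 1 ∧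
      (∀ t ∈ Icc a b, HasDerivWithinAt V (-(α t * V t)) (Icc a b) t) ∧
      (∀ t ∈ Icc a b, HasDerivWithinAt Z (Z t * α t) (Icc a b) t) ∧
      ∀ t ∈ Icc a b, Z t * V t = 1 := by
  have : CompleteSpace Mat := FiniteDimensional.complete ℝ _
  obtain ⟨V, hVb, hV⟩ := exists_linear_solution hab
    (N := fun t => -(ContinuousLinearMap.mul ℝ Mat (α t)))
    (((ContinuousLinearMap.mul ℝ Mat).continuous.comp_continuousOn hα).neg) 1
  obtain ⟨Z, hZb, hZ⟩ := exists_linear_solution hab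
    (N := fun t => (ContinuousLinearMap.mul ℝ Mat).flip (α t))
    ((ContinuousLinearMap.mul ℝ Mat).flip.continuous.comp_continuousOn hα) 1
  have hV' : ∀ t ∈ Icc a b, HasDerivWithinAt V (-(α t * V t)) (Icc a b) t := hV
  have hZ' : ∀ t ∈ Icc a b, HasDerivWithinAt Z (Z t * α t) (Icc a b) t := hZ
  refine ⟨V, Z, hVb, hV', hZ', fun t ht => ?_⟩
  have h1 : ∀ t ∈ Icc a b, HasDerivWithinAt (fun t => Z t * V t) 0 (Icc a b) t := fun t ht => by
    have h2 := (hZ' t ht).mul (hV' t ht)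
    have h3 : Z t * α t * V t + Z t * -(α t * V t) = 0 := by noncomm_ring
    rwa [h3] at h2
  have h2 := eq_of_hasDerivWithinAt_zero h1 ht (right_mem_Icc.2 hab)
  rwa [hVb, hZb, one_mul] at h2

/-- Uniqueness for the matrix equation `V' = -α V`. -/
lemma eqOn_of_hasDerivWithinAt {α V W : ℝ → Mat} {a b : ℝ} (hab : a ≤ b)
    (hα : ContinuousOn α (Icc a b))
    (hV : ∀ t ∈ Icc a b, HasDerivWithinAt V (-(α t * V t)) (Icc a b) t)
    (hW : ∀ t ∈ Icc a b, HasDerivWithinAt W (-(α t * W t)) (Icc a b) t) (h : V b = W b) :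
    EqOn V W (Icc a b) := by
  obtain ⟨F, Z, hFb, hF, hZ, hZF⟩ := exists_fundamental_solution hab hα
  have hb := right_mem_Icc.2 hab
  have key : ∀ X : ℝ → Mat, (∀ t ∈ Icc a b, HasDerivWithinAt X (-(α t * X t)) (Icc a b) t) →
      ∀ t ∈ Icc a b, X t = F t * (Z b * X b) := fun X hX t ht => by
    have h1 : ∀ t ∈ Icc a b, HasDerivWithinAt (fun t => Z t * X t) 0 (Icc a b) t := fun t ht => by
      have h2 := (hZ t ht).mul (hX t ht)
      have h3 : Z t * α t * X t + Z t * -(α t * X t) = 0 := by noncomm_ring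
      rwa [h3] at h2
    have h2 : Z t * X t = Z b * X b := eq_of_hasDerivWithinAt_zero h1 ht hb
    rw [← h2, ← mul_assoc, mul_eq_one_comm.1 (hZF t ht), one_mul]
  intro t ht
  rw [key V hV t ht, key W hW t ht, h]

end

section

variable {E : Type*} [NormedAddCommGroup E] [NormedSpace ℝ E] {H : Type*} [TopologicalSpace H]
  {I : ModelWithCorners ℝ E H} {M : Type*} [TopologicalSpace M] [ChartedSpace H M]
  [IsManifold I ∞ M] {R : Type*} [NormedRing R] [NormedAlgebra ℝ R]

/-- The generator of the transport equation `W' = -a W + W b`. -/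
noncomputable def gaugeGenerator (a b : R) : R →L[ℝ] R :=
  -(ContinuousLinearMap.mul ℝ R a) + (ContinuousLinearMap.mul ℝ R).flip b

lemma gaugeGenerator_apply (a b w : R) : gaugeGenerator a b w = -(a * w) + w * b := rfl

lemma SmoothOnSM.gaugeGenerator {g : RMetric I M} {A B : TangentBundle I M → R}
    (hA : SmoothOnSM g A) (hB : SmoothOnSM g B) :
    SmoothOnSM g (fun p => gaugeGenerator (A p) (B p)) := by
  have h1 : SmoothOnSM g (fun p => (-ContinuousLinearMap.mul ℝ R) (A p)) :=
    (-ContinuousLinearMap.mul ℝ R).contMDiff.comp_contMDiffOn hA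
  have h2 : SmoothOnSM g (fun p => (ContinuousLinearMap.mul ℝ R).flip (B p)) :=
    (ContinuousLinearMap.mul ℝ R).flip.contMDiff.comp_contMDiffOn hB
  exact ContMDiffOn.add h1 h2

end

section

variable {d : ℕ} [NeZero d] {M : Type*} [TopologicalSpace M]
  [ChartedSpace (EuclideanHalfSpace d) M] [IsManifold (𝓡∂ d) ∞ M] {n : ℕ}

local notation "TM" => TangentBundle (𝓡∂ d) M
local notation "Mat" => Matrix (Fin n) (Fin n) ℂ

lemma scatteringData_eq {g : RMetric (𝓡∂ d) M} {A : TM → Mat} {p : TM} {V : Mat}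
    (h : ∀ S, IsScatteringValue g A p S ↔ S = V) : scatteringData g A p = V := by
  have h1 : ∃ S, IsScatteringValue g A p S := ⟨V, (h V).2 rfl⟩
  rw [scatteringData, dif_pos h1]
  exact (h _).1 h1.choose_spec

lemma hasDerivWithinAt_shift {V : Type*} [NormedAddCommGroup V] [NormedSpace ℝ V] {W : ℝ → V}
    {a b a' b' s t : ℝ} {w : V} (ha : a ≤ s + a') (hb : s + b' ≤ b)
    (h : HasDerivWithinAt W w (Icc a b) (s + t)) :
    HasDerivWithinAt (fun t => W (s + t)) w (Icc a' b') t := by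
  have h1 : HasDerivWithinAt (fun t => s + t) 1 (Icc a' b') t :=
    ((hasDerivAt_id t).const_add s).hasDerivWithinAt
  have h2 := HasDerivWithinAt.scomp t (h := fun t => s + t) h h1 fun r hr =>
    ⟨by linarith [hr.1], by linarith [hr.2]⟩
  rwa [one_smul] at h2

variable [T2Space M] [CompactSpace M]

/-- Along an orbit, up to the exit time, the scattering data are the solution of the matrix
equation with final value `1`. -/
lemma exists_scatteringData_eq {g : RMetric (𝓡∂ d) M} (hnt : NonTrapping g) {A : TM → Mat}
    (hA : SmoothOnSM g A) {p : TM} (hp : p ∈ unitTangent g) {β : ℝ → TM}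
    (hβ : IsGeodesicOrbit g p (exitTime g p) β) :
    ∃ V Z : ℝ → Mat, V (exitTime g p) = 1 ∧
      (∀ t ∈ Icc 0 (exitTime g p),
        HasDerivWithinAt V (-(A (β t) * V t)) (Icc 0 (exitTime g p)) t) ∧
      (∀ t ∈ Icc 0 (exitTime g p),
        HasDerivWithinAt Z (Z t * A (β t)) (Icc 0 (exitTime g p)) t) ∧
      ∀ t ∈ Icc 0 (exitTime g p), Z t * V t = 1 ∧ scatteringData g A (β t) = V t := by
  set τ := exitTime g p with hτ
  have hτ0 : 0 ≤ τ := exitTime_nonneg (hnt p hp)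
  have hSM : ∀ t ∈ Icc 0 τ, β t ∈ unitTangent g := fun t ht =>
    mem_unitTangent_of_isMIntegralCurveOn hβ.2 (left_mem_Icc.2 hτ0) (hβ.1.symm ▸ hp) ht
  have hAβ : ContinuousOn (fun t => A (β t)) (Icc 0 τ) :=
    hA.continuousOn.comp (fun t ht => (hβ.2 t ht).1) hSM
  obtain ⟨V, Z, hVτ, hV, hZ, hZV⟩ := exists_fundamental_solution hτ0 hAβ
  refine ⟨V, Z, hVτ, hV, hZ, fun t ht => ⟨hZV t ht, scatteringData_eq fun S => ?_⟩⟩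
  have hexit : exitTime g (β t) = τ - t := exitTime_of_orbit hnt hp ht.1 (hβ.mono ht.2)
  have hshift : IsGeodesicOrbit g (β t) (τ - t) (fun s => β (t + s)) := hβ.shift ht.1
  have hVs : ∀ s ∈ Icc 0 (τ - t), HasDerivWithinAt (fun s => V (t + s))
      (-(A (β (t + s)) * V (t + s))) (Icc 0 (τ - t)) s := fun s hs =>
    hasDerivWithinAt_shift (by linarith [ht.1]) (by linarith)
      (hV (t + s) ⟨by linarith [hs.1, ht.1], by linarith [hs.2]⟩)
  have h0 : (0 : ℝ) ∈ Icc 0 (τ - t) := left_mem_Icc.2 (by linarith [ht.2])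
  unfold IsScatteringValue
  rw [hexit]
  constructor
  · rintro ⟨β', U, hβ', hU, hU1, rfl⟩
    have heq := hβ'.eqOn hshift
    have h1 := eqOn_of_hasDerivWithinAt (α := fun s => A (β (t + s))) (h0.2)
      (hAβ.comp (by fun_prop) fun s hs => ⟨by linarith [hs.1, ht.1], by linarith [hs.2]⟩)
      (V := U) (fun s hs => by
        have h2 := hU s hs
        rwa [heq hs] at h2) hVs (by rw [hU1, add_sub_cancel, hVτ])
    simpa using h1 h0
  · rintro rfl
    exact ⟨_, _, hshift, hVs, by rw [add_sub_cancel, hVτ], by rw [add_zero]⟩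

/-- A geodesic which starts at the boundary and does not leave `M` at once points inwards. -/
lemma mem_influx_of_exitTime_pos {g : RMetric (𝓡∂ d) M} (hnt : NonTrapping g) {p : TM}
    (hp : p ∈ boundarySM g) (hτ : 0 < exitTime g p) : p ∈ influx g := by
  obtain ⟨β, hβ0, hβ⟩ := exists_orbit_exitTime hnt hp.1
  have h0 : (0 : ℝ) ∈ Icc 0 (exitTime g p) := left_mem_Icc.2 hτ.le
  have h1 := hasDerivWithinAt_of_isMIntegralCurveOn hβ h0 (q := p)
    (by rw [hβ0]; exact mem_extChartAt_source p)
  have h2 := (height d).hasFDerivAt.comp_hasDerivWithinAt 0 h1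
  rw [hβ0, ← geodesicField_eq] at h2
  have hv : (0 : ℝ) ≤ boundaryConormal p.1 p.2 := by
    have h3 : HasDerivWithinAt (fun t => height d (extChartAt (𝓡∂ d).tangent p (β t)))
        (boundaryConormal p.1 p.2) (Icc 0 (exitTime g p)) 0 := h2
    have h4 := (hasDerivWithinAt_iff_tendsto_slope.1 h3).mono_left
      (nhdsWithin_mono (0 : ℝ) (s := Ioo 0 (exitTime g p)) fun t ht =>
        ⟨⟨ht.1.le, ht.2.le⟩, ht.1.ne'⟩)
    rw [nhdsWithin_Ioo_eq_nhdsGT hτ] at h4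
    refine ge_of_tendsto h4 ?_
    filter_upwards [self_mem_nhdsWithin] with t ht
    have h5 : height d (extChartAt (𝓡∂ d).tangent p (β 0)) = 0 := by
      rw [hβ0]
      exact (mem_boundary_iff_height (mem_extChartAt_source p)).1 hp.2
    rw [slope_def_field, h5]
    exact div_nonneg (by linarith [height_extChartAt_nonneg p (β t)])
      (by have : (0 : ℝ) < t := ht
          linarith)
  refine ⟨hp, ?_⟩
  obtain ⟨c, hc, h6⟩ := exists_metricAt_outerNormal g p.1
  have h7 : metricAt g p.1 (p.2 : EuclideanSpace ℝ (Fin d)) (outerNormal g p.1) ≤ 0 :=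
    (metricAt_symm g p.1 _ _).trans_le ((h6 p.2).trans_le (neg_nonpos.2 (mul_nonneg hc hv)))
  exact h7

lemma scatteringData_of_exitTime_eq_zero {g : RMetric (𝓡∂ d) M} (hnt : NonTrapping g) {A : TM → Mat}
    (hA : SmoothOnSM g A) {p : TM} (hp : p ∈ unitTangent g) (hτ : exitTime g p = 0) :
    scatteringData g A p = 1 := by
  obtain ⟨β, hβ⟩ := exists_orbit_exitTime hnt hp
  obtain ⟨V, Z, hV1, -, -, h⟩ := exists_scatteringData_eq hnt hA hp hβ
  have h1 := (h 0 (by simp [hτ])).2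
  rw [hβ.1] at h1
  rw [h1, ← hV1, hτ]

lemma isUnit_scatteringData {g : RMetric (𝓡∂ d) M} (hnt : NonTrapping g) {A : TM → Mat}
    (hA : SmoothOnSM g A) {p : TM} (hp : p ∈ unitTangent g) : IsUnit (scatteringData g A p) := by
  obtain ⟨β, hβ⟩ := exists_orbit_exitTime hnt hp
  obtain ⟨V, Z, -, -, -, h⟩ := exists_scatteringData_eq hnt hA hp hβ
  obtain ⟨h1, h2⟩ := h 0 (left_mem_Icc.2 (exitTime_nonneg (hnt p hp)))
  rw [hβ.1] at h2
  rw [h2]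
  exact IsUnit.of_mul_eq_one_right _ h1

/-- The quotient of the scattering data of `A` and `B` intertwines the two matrix equations along
the geodesic flow. -/
lemma isTransported_scatteringData_mul_inv {g : RMetric (𝓡∂ d) M} (hnt : NonTrapping g)
    {A B : TM → Mat} (hA : SmoothOnSM g A) (hB : SmoothOnSM g B) :
    IsTransported g (fun p => gaugeGenerator (A p) (B p))
      (fun p => scatteringData g A p * (scatteringData g B p)⁻¹) := by
  intro β a b hβ hSM t ht
  have hab : a ≤ b := ht.1.trans ht.2
  have ha := hSM a (left_mem_Icc.2 hab)
  obtain ⟨γ, hγ⟩ := exists_orbit_exitTime hnt ha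
  have hβa : IsGeodesicOrbit g (β a) (b - a) (fun s => β (a + s)) := by
    refine ⟨congrArg β (add_zero a), ?_⟩
    have h1 := isMIntegralCurveOn_shift (s := a) hβ
    rwa [sub_self] at h1
  have hle := le_exitTime (hnt _ ha) (by linarith) hβa
  have heq := (hγ.mono hle).eqOn hβa
  obtain ⟨V, Z, -, hV, -, hVA⟩ := exists_scatteringData_eq hnt hA ha hγ
  obtain ⟨V', Z', -, -, hZ', hVB⟩ := exists_scatteringData_eq hnt hB ha hγ
  set τ := exitTime g (β a) with hτ
  have hmem : ∀ s ∈ Icc a b, -a + s ∈ Icc 0 (b - a) := fun s hs =>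
    ⟨by linarith [hs.1], by linarith [hs.2]⟩
  have hγβ : ∀ s ∈ Icc a b, γ (-a + s) = β s := fun s hs => by
    have h1 := heq (hmem s hs)
    simpa using h1
  have hU : ∀ s ∈ Icc a b, scatteringData g A (β s) * (scatteringData g B (β s))⁻¹ =
      V (-a + s) * Z' (-a + s) := fun s hs => by
    have hs' : -a + s ∈ Icc 0 τ := Icc_subset_Icc le_rfl hle (hmem s hs)
    rw [← hγβ s hs, (hVA _ hs').2, (hVB _ hs').2, Matrix.inv_eq_left_inv (hVB _ hs').1]
  have ht' : -a + t ∈ Icc 0 τ := Icc_subset_Icc le_rfl hle (hmem t ht)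
  have h1 := (hV _ ht').mul (hZ' _ ht')
  have h2 := hasDerivWithinAt_shift (a' := a) (b' := b) (by simp) (by linarith) h1
  refine (h2.congr_of_mem (fun s hs => hU s hs) ht).congr_deriv ?_
  change _ = -(A (β t) * (scatteringData g A (β t) * (scatteringData g B (β t))⁻¹)) +
    scatteringData g A (β t) * (scatteringData g B (β t))⁻¹ * B (β t)
  rw [hU t ht, hγβ t ht]
  noncomm_ring

/-- If `U` is a gauge transformation from `A` to `B` with `U = 1` on the boundary, then the
scattering data of `A` and `B` agree on the boundary. -/
lemma scatteringData_eq_of_gauge {g : RMetric (𝓡∂ d) M} (hnt : NonTrapping g)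
    {A B : TM → Mat} (hA : SmoothOnSM g A) (hB : SmoothOnSM g B) {U : TM → Mat}
    (hU : SmoothOnSM g U) (hU1 : ∀ p ∈ boundarySM g, U p = 1)
    (hAB : ∀ p ∈ unitTangent g, geodesicDeriv g U p = U p * B p - A p * U p) {p : TM}
    (hp : p ∈ boundarySM g) : scatteringData g A p = scatteringData g B p := by
  obtain ⟨β, hβ⟩ := exists_orbit_exitTime hnt hp.1
  have hend := hU1 _ (mem_boundarySM_exitTime hnt hp.1 hβ)
  obtain ⟨V, Z, hV1, hV, -, hVA⟩ := exists_scatteringData_eq hnt hA hp.1 hβ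
  obtain ⟨V', Z', hV1', hV', -, hVB⟩ := exists_scatteringData_eq hnt hB hp.1 hβ
  have hτ0 := exitTime_nonneg (hnt p hp.1)
  set τ := exitTime g p with hτ
  have hSM : ∀ t ∈ Icc 0 τ, β t ∈ unitTangent g := fun t ht =>
    mem_unitTangent_of_isMIntegralCurveOn hβ.2 (left_mem_Icc.2 hτ0) (hβ.1.symm ▸ hp.1) ht
  have hAβ : ContinuousOn (fun t => A (β t)) (Icc 0 τ) :=
    hA.continuousOn.comp (fun t ht => (hβ.2 t ht).1) hSM
  have h0 := left_mem_Icc.2 hτ0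
  have h1 : ∀ t ∈ Icc 0 τ, HasDerivWithinAt (fun t => U (β t) * V' t)
      (-(A (β t) * (U (β t) * V' t))) (Icc 0 τ) t := fun t ht => by
    have h2 := (hasDerivWithinAt_comp_orbit hU hβ.2 hSM ht).mul (hV' t ht)
    rw [hAB _ (hSM t ht)] at h2
    refine h2.congr_deriv ?_
    noncomm_ring
  have h2 := eqOn_of_hasDerivWithinAt hτ0 hAβ hV h1 (by rw [hV1, hend, hV1', one_mul]) h0
  have h3 := (hVA 0 h0).2
  have h4 := (hVB 0 h0).2
  simp only [hβ.1] at h2 h3 h4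
  rw [h3, h4, h2, hU1 p hp, one_mul]

end

end GeodesicTransport

theorem proposition3p5 {d : ℕ} [NeZero d] {M : Type*} [TopologicalSpace M] [T2Space M]
    [CompactSpace M] [ChartedSpace (EuclideanHalfSpace d) M] [IsManifold (𝓡∂ d) ∞ M]
    (g : GeodesicTransport.RMetric (𝓡∂ d) M)
    (hconv : GeodesicTransport.StrictlyConvexBoundary g)
    (hnt : GeodesicTransport.NonTrapping g)
    {n : ℕ} (A B : TangentBundle (𝓡∂ d) M → Matrix (Fin n) (Fin n) ℂ)
    (hA : GeodesicTransport.SmoothOnSM g A)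
    (hB : GeodesicTransport.SmoothOnSM g B) :
    (∀ p ∈ GeodesicTransport.influx g,
      GeodesicTransport.scatteringData g A p = GeodesicTransport.scatteringData g B p) ↔
    ∃ U : TangentBundle (𝓡∂ d) M → Matrix (Fin n) (Fin n) ℂ,
      GeodesicTransport.SmoothOnSM g U ∧
      (∀ p ∈ GeodesicTransport.unitTangent g, IsUnit (U p)) ∧
      (∀ p ∈ GeodesicTransport.boundarySM g, U p = 1) ∧
      ∀ p ∈ GeodesicTransport.unitTangent g,
        B p = (U p)⁻¹ * GeodesicTransport.geodesicDeriv g U p + (U p)⁻¹ * A p * U p := by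
  open GeodesicTransport in
  constructor
  · intro h
    have hunitA := fun p hp => isUnit_scatteringData hnt hA (p := p) hp
    have hunitB := fun p hp => isUnit_scatteringData hnt hB (p := p) hp
    have hU := isTransported_scatteringData_mul_inv hnt hA hB
    have hU1 : ∀ p ∈ boundarySM g, scatteringData g A p * (scatteringData g B p)⁻¹ = 1 := by
      intro p hp
      have hAB : scatteringData g A p = scatteringData g B p := by
        rcases (exitTime_nonneg (hnt p hp.1)).eq_or_lt with h0 | h0
        · rw [scatteringData_of_exitTime_eq_zero hnt hA hp.1 h0.symm,
            scatteringData_of_exitTime_eq_zero hnt hB hp.1 h0.symm]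
        · exact h p (mem_influx_of_exitTime_pos hnt hp h0)
      rw [hAB]
      exact Matrix.mul_nonsing_inv _ ((Matrix.isUnit_iff_isUnit_det _).1 (hunitB p hp.1))
    have hN := SmoothOnSM.gaugeGenerator hA hB
    have hsmooth := smoothOnSM_of_isTransported hconv hnt hN hU hU1
    have hunit : ∀ p ∈ unitTangent g,
        IsUnit (scatteringData g A p * (scatteringData g B p)⁻¹) := fun p hp =>
      (hunitA p hp).mul (Matrix.isUnit_nonsing_inv_iff.2 (hunitB p hp))
    refine ⟨_, hsmooth, hunit, hU1, fun p hp => ?_⟩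
    rw [geodesicDeriv_of_isTransported hN hsmooth hU hp, gaugeGenerator_apply]
    have h1 := Matrix.nonsing_inv_mul _ ((Matrix.isUnit_iff_isUnit_det _).1 (hunit p hp))
    set W := scatteringData g A p * (scatteringData g B p)⁻¹
    rw [mul_add, mul_neg, ← mul_assoc W⁻¹ W, h1, one_mul, mul_assoc W⁻¹ (A p) W]
    abel
  · rintro ⟨U, hU, hunit, hU1, hAB⟩ p hp
    refine scatteringData_eq_of_gauge hnt hA hB hU hU1 (fun q hq => ?_) hp.1
    have h1 := Matrix.mul_nonsing_inv _ ((Matrix.isUnit_iff_isUnit_det _).1 (hunit q hq))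
    rw [hAB q hq, mul_add, ← mul_assoc, h1, one_mul, mul_assoc (U q)⁻¹, ← mul_assoc (U q) (U q)⁻¹,
      h1, one_mul, add_sub_cancel_right]
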